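/- Let $G$ be a Carnot group: a simply connected Lie group of dimension $n$ whose Lie algebra has a stratification $\mathfrak g=\mathfrak g_1\oplus\dots\oplus\mathfrak g_m$ ($m\ge 1$) with $\mathfrak g_i\neq 0$ for $1\le i\le m$, $[\mathfrak g_1,\mathfrak g_j]=\mathfrak g_{j+1}$ for $j\ge 1$, and $\mathfrak g_{m+1}=0$, together with a scalar product on $\mathfrak g_1$. Let $\mathcal D$ be the left-invariant distribution, of rank $k=\dim\mathfrak g_1$, spanned by $\mathfrak g_1$, with the left-invariant metric $\langle\cdot,\cdot\rangle$, and let $\mathcal V_0$ be the left-invariant bundle spanned by $\mathfrak g_2\oplus\dots\oplus\mathfrak g_m$. Then $\mathcal V_0$ is a complement of $\mathcal D$, and $$\Delta_{\mathcal P}\,\phi=L^{\mathcal V_0}\phi\qquad\text{for all }\phi\in C^\infty(G).$$ Here $\Delta_{\mathcal P}=\operatorname{div}_{\mathcal P}\circ\operatorname{grad}$, where $\operatorname{grad}\phi$ is the horizontal gradient ($\langle\operatorname{grad}\phi,X\rangle=d\phi(X)$ for all horizontal $X$), $\operatorname{div}_{\mathcal P}$ is given by $\mathcal L_X\mathcal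 P=\operatorname{div}_{\mathcal P}(X)\,\mathcal P$, and $\mathcal P$ is Popp's volume. The latter is the smooth volume form (unique up to sign) such that $|\mathcal P_q(X_1,\dots,X_n)|=1$ for each basis of $T_qG$ that is adapted to the flag $\mathcal D^1=\mathcal D$, $\mathcal D^{i+1}=\mathcal D^i+[\mathcal D^i,\mathcal D]$, and whose classes form an orthonormal basis of $\bigoplus_i\mathcal D^i_q/\mathcal D^{i-1}_q$; the summands are orthogonal, and the norm on $\mathcal D^i_q/\mathcal D^{i-1}_q$ is the quotient norm for the surjection $\mathcal D_q^{\otimes i}\to\mathcal D^i_q/\mathcal D^{i-1}_q$, $v_1\otimes\dots\otimes v_i\mapsto[V_1,[V_2,\dots,[V_{i-1},V_i]]]_q$, with $V_j$ horizontal extensions of $v_j$. The microscopic Laplacian is $$(L^{\mathcal V_0}\phi)(q)=\lim_{t\to0^+}\frac{2k}{t^2}\int_{\{\lambda\in T_q^*G\,:\,2H(\lambda)=1\}}\bigl(\phi(\exp_q(t,\lambda))-\phi(q)\bigr)\,d\mu_q(\lambda),$$ where $H(\lambda)=\frac12\sum_{i=1}^k\langle\lambda,X_i\rangle^2$ for an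 orthonormal frame $X_1,\dots,X_k$ of $\mathcal D$, $\exp_q(t,\lambda)$ is the projection to $G$ of the point at time $t$ of the integral curve of the Hamiltonian vector field of $H$ on $T^*G$ with initial covector $\lambda$, and $\mu_q$ is any adapted measure: the product of the uniform probability measure on the unit sphere $\{2H=1\}$ of the annihilator $(\mathcal V_0)_q^\perp$ with a probability measure on $\mathcal D_q^\perp$ for which all linear functions are square-integrable (the product is transported to $T_q^*G=(\mathcal V_0)_q^\perp\oplus\mathcal D_q^\perp$ by addition). The claim includes that, for every adapted $\mu_q$ and every $q$, the exponential map is defined for small $t$ on all of $\{2H=1\}$, the integral exists for small $t$, the limit exists, and it is equal to $(\Delta_{\mathcal P}\phi)(q)$. -/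

import Mathlib

open MeasureTheory Filter Topology Set
open scoped Manifold ContDiff ENNReal

noncomputable section

namespace SubRiem

/-! ### Vector fields and differential forms on a manifold -/

section Manifold

variable (E : Type*) [NormedAddCommGroup E] [NormedSpace ℝ E]
  (M : Type*) [TopologicalSpace M] [ChartedSpace E M]

/-- A (not necessarily continuous) vector field. -/
abbrev VField := ∀ q : M, TangentSpace 𝓘(ℝ, E) q

/-- Covectors. In Mathlib every tangent space `T_q M` is a copy of the model space `E` (identified
through the preferred chart at `q`), so `T_q^* M` is the dual of `E`, for every `q`. A point of the
cotangent bundle is a pair in `M × Covec E`. -/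
abbrev Covec := E →L[ℝ] ℝ

/-- A field of alternating forms of degree `dim M`. -/
abbrev TopForm := ∀ q : M,
  (TangentSpace 𝓘(ℝ, E) q) [⋀^Fin (Module.finrank ℝ E)]→ₗ[ℝ] ℝ

variable {E M}

/-- Smooth vector fields. -/
def IsSmoothField [IsManifold 𝓘(ℝ, E) ∞ M] (X : VField E M) : Prop :=
  ContMDiff 𝓘(ℝ, E) (𝓘(ℝ, E)).tangent ∞
    (fun q => (⟨q, X q⟩ : TangentBundle 𝓘(ℝ, E) M))

/-- A field of top-degree forms is smooth if its values on smooth vector fields are smooth. -/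
def IsSmoothForm [IsManifold 𝓘(ℝ, E) ∞ M] (vol : TopForm E M) : Prop :=
  ∀ Y : Fin (Module.finrank ℝ E) → VField E M, (∀ i, IsSmoothField (Y i)) →
    ContMDiff 𝓘(ℝ, E) 𝓘(ℝ, ℝ) ∞ (fun q => vol q (fun i => Y i q))

/-- The differential of a function at a point, as a covector. -/
def dAt (φ : M → ℝ) (q : M) : Covec E := mfderiv 𝓘(ℝ, E) 𝓘(ℝ, ℝ) φ q

/-- The Lie derivative of a top-degree form:
`(ℒ_X vol)(Y₁, …, Yₙ) = X (vol (Y₁, …, Yₙ)) - ∑ i, vol (Y₁, …, [X, Yᵢ], …, Yₙ)`. -/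
def lieDerivForm (vol : TopForm E M) (X : VField E M)
    (Y : Fin (Module.finrank ℝ E) → VField E M) (q : M) : ℝ :=
  dAt (E := E) (fun p => vol p (fun i => Y i p)) q (X q)
    - ∑ i, vol q (Function.update (fun j => Y j q) i
        (VectorField.mlieBracket 𝓘(ℝ, E) X (Y i) q))

/-- `c = div_vol(X)(q)`, that is, `ℒ_X vol = c vol` at the point `q`. -/
def HasDivergenceAt [IsManifold 𝓘(ℝ, E) ∞ M] (vol : TopForm E M) (X : VField E M)
    (q : M) (c : ℝ) : Prop :=
  ∀ Y : Fin (Module.finrank ℝ E) → VField E M, (∀ i, IsSmoothField (Y i)) →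
    lieDerivForm vol X Y q = c * vol q (fun i => Y i q)

/-- The nested bracket `[V₀, [V₁, …, [V_{r-1}, V_r]]]`. -/
def nestedBracket : (r : ℕ) → (Fin (r + 1) → VField E M) → VField E M
  | 0, V => V 0
  | r + 1, V => VectorField.mlieBracket 𝓘(ℝ, E) (V 0) (nestedBracket r (fun j => V j.succ))

/-- The canonical symplectic form `∑ dpᵢ ∧ dxᵢ` in canonical coordinates `(x, p)` on the cotangent
bundle, where `p = ∑ pᵢ dxᵢ`. -/
def symplecticForm (z w : E × Covec E) : ℝ := z.2 w.1 - w.2 z.1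

/-- The Hamiltonian `H` written in the canonical coordinates of the cotangent bundle that are
induced by the chart at `x₀`. -/
def inChart (H : M → Covec E → ℝ) (x₀ : M) (z : E × Covec E) : ℝ :=
  H ((extChartAt 𝓘(ℝ, E) x₀).symm z.1)
    (ContinuousLinearMap.comp z.2 (show E →L[ℝ] E from
      mfderiv 𝓘(ℝ, E) 𝓘(ℝ, E) (extChartAt 𝓘(ℝ, E) x₀)
        ((extChartAt 𝓘(ℝ, E) x₀).symm z.1)))

/-- The canonical coordinates, induced by the chart at `x₀`, of a point of the cotangent bundle. -/
def coordsOf (x₀ : M) (l : M × Covec E) : E × Covec E :=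
  (extChartAt 𝓘(ℝ, E) x₀ l.1,
    ContinuousLinearMap.comp l.2 (show E →L[ℝ] E from
      mfderiv 𝓘(ℝ, E) 𝓘(ℝ, E) (extChartAt 𝓘(ℝ, E) x₀).symm (extChartAt 𝓘(ℝ, E) x₀ l.1)))

/-- `l` is, on the set `s` of times, an integral curve of the Hamiltonian vector field `Ĥ` of `H`,
defined by `dH = σ(·, Ĥ)`. The equation at time `t` is read in the chart at the base point
of `l t`; in coordinates, it consists of Hamilton's equations. -/
def IsHamiltonianCurveOn (H : M → Covec E → ℝ) (l : ℝ → M × Covec E) (s : Set ℝ) : Prop :=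
  ContinuousOn (fun t => (l t).1) s ∧
  ∀ t ∈ s, ∃ (dH : (E × Covec E) →L[ℝ] ℝ) (v : E × Covec E),
    HasFDerivAt (inChart H (l t).1) dH (coordsOf (l t).1 (l t)) ∧
    HasDerivWithinAt (fun τ => coordsOf (l t).1 (l τ)) v s t ∧
    ∀ z, dH z = symplecticForm z v

/-- The domain of the exponential map at `q`: the Hamiltonian curve that starts
at the covector `lam` at `q` is defined up to time `t`. -/
def InExpDomain (H : M → Covec E → ℝ) (q : M) (t : ℝ) (lam : Covec E) : Prop :=
  ∃ l : ℝ → M × Covec E, IsHamiltonianCurveOn H l (Icc 0 t) ∧ l 0 = (q, lam)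

open Classical in
/-- The exponential map `exp_q(t, lam)`: the end point at time `t` of the projection to `M` of the
Hamiltonian curve that starts at the covector `lam` at `q` (and `q`, outside the domain). -/
def normalExp (H : M → Covec E → ℝ) (q : M) (t : ℝ) (lam : Covec E) : M :=
  if h : InExpDomain H q t lam then (h.choose t).1 else q

variable (E M) in
/-- A distribution on `M` together with a scalar product on each of its fibres. -/
structure HorizontalStructure where
  /-- the distribution -/
  dist : ∀ q : M, Submodule ℝ (TangentSpace 𝓘(ℝ, E) q)
  /-- the scalar product -/
  inner : ∀ q : M, LinearMap.BilinForm ℝ (dist q)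
  symm : ∀ q u v, inner q u v = inner q v u
  pos : ∀ q u, u ≠ 0 → 0 < inner q u u

namespace HorizontalStructure

variable (S : HorizontalStructure E M)

theorem inner_nondegenerate (q : M) : (S.inner q).Nondegenerate := by
  constructor
  · intro u hu
    by_contra h
    exact (S.pos q u h).ne' (hu u)
  · intro u hu
    by_contra h
    exact (S.pos q u h).ne' (hu u)

variable [FiniteDimensional ℝ E]

instance (q : M) : FiniteDimensional ℝ (TangentSpace 𝓘(ℝ, E) q) :=
  inferInstanceAs (FiniteDimensional ℝ E)

/-- The rank of the distribution at `q`. -/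
def rank (q : M) : ℕ := Module.finrank ℝ (S.dist q)

/-- The restriction of a covector to the distribution. -/
def restrict (q : M) (lam : Covec E) : Module.Dual ℝ (S.dist q) :=
  (show TangentSpace 𝓘(ℝ, E) q →ₗ[ℝ] ℝ from lam.toLinearMap).domRestrict (S.dist q)

/-- The horizontal vector `u` with `⟨u, v⟩ = lam v` for all horizontal vectors `v`. -/
def sharp (q : M) (lam : Covec E) : S.dist q :=
  ((S.inner q).toDual (S.inner_nondegenerate q)).symm (S.restrict q lam)

theorem inner_sharp (q : M) (lam : Covec E) (v : S.dist q) :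
    S.inner q (S.sharp q lam) v = S.restrict q lam v := by
  simp [sharp]

/-- The horizontal gradient: `grad φ` is horizontal and `⟨grad φ, v⟩ = dφ(v)` for all horizontal
vectors `v`. -/
def grad (φ : M → ℝ) : VField E M := fun q => S.sharp q (dAt φ q)

/-- The sub-Riemannian Hamiltonian. It is half the squared norm of the restriction of the covector
to the distribution, so that `H(lam) = 1/2 ∑ ⟨lam, Xᵢ⟩²` for each orthonormal frame `Xᵢ` (this is
`hamiltonian_eq_sum` below). -/
def hamiltonian (q : M) (lam : Covec E) : ℝ := 1 / 2 * S.restrict q lam (S.sharp q lam)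

theorem hamiltonian_eq_sum (q : M) {ι : Type*} [Fintype ι] [DecidableEq ι]
    (X : Module.Basis ι ℝ (S.dist q))
    (hX : ∀ i j, S.inner q (X i) (X j) = if i = j then 1 else 0) (lam : Covec E) :
    S.hamiltonian q lam = 1 / 2 * ∑ i, (S.restrict q lam (X i)) ^ 2 := by
  have coeff : ∀ i, X.repr (S.sharp q lam) i = S.restrict q lam (X i) := by
    intro i
    rw [← S.inner_sharp q lam (X i)]
    conv_rhs => rw [← X.sum_repr (S.sharp q lam)]
    simp only [map_sum, map_smul, LinearMap.sum_apply, LinearMap.smul_apply, hX]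
    simp
  have key : S.sharp q lam = ∑ i, (S.restrict q lam (X i)) • X i := by
    simp only [← coeff, X.sum_repr]
  rw [hamiltonian, key]
  simp [sq]

/-- The unit cotangent space at `q`, `{lam | 2 H(lam) = 1}` (a cylinder). -/
def cylinder (q : M) : Set (Covec E) := {lam | 2 * S.hamiltonian q lam = 1}

/-! ### The macroscopic Laplacian -/

/-- `c = (Δ_vol φ)(q)`, where `Δ_vol = div_vol ∘ grad`. -/
def IsMacroLaplacianAt [IsManifold 𝓘(ℝ, E) ∞ M] (vol : TopForm E M) (φ : M → ℝ)
    (q : M) (c : ℝ) : Prop :=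
  HasDivergenceAt vol (S.grad φ) q c

/-! ### The microscopic Laplacian -/

/-- The annihilator of a subspace of the tangent space at `q`. -/
def annihilator (q : M) (W : Submodule ℝ (TangentSpace 𝓘(ℝ, E) q)) :
    Submodule ℝ (Covec E) where
  carrier := {lam | ∀ v ∈ W, lam v = 0}
  add_mem' := fun {a b} ha hb v hv => by
    have h : (a + b) v = a v + b v := rfl
    rw [h, ha v hv, hb v hv, add_zero]
  zero_mem' := fun _ _ => rfl
  smul_mem' := fun c a ha v hv => by
    have h : (c • a) v = c • a v := rfl
    rw [h, ha v hv, smul_zero]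

/-- The uniform probability measure on the sphere `{2 H = 1}` of a space `h` of covectors on which
`2 H` is positive definite (and hence the square of a Euclidean norm): the image, under the radial
projection, of the normalized Lebesgue measure of the unit ball `{2 H < 1}`. -/
def sphereMeasure (q : M) (h : Submodule ℝ (Covec E)) : Measure h :=
  (ProbabilityTheory.cond (Measure.addHaar : Measure h)
    {lam : h | 2 * S.hamiltonian q lam < 1}).map
      (fun lam : h => (Real.sqrt (2 * S.hamiltonian q lam))⁻¹ • lam)

/-- `μ` is a measure on the unit cotangent space at `q` that is adapted to the complement `V_q` of
the distribution: the product of the uniform probability measure of the unit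
sphere of the space `V_q^⊥` of horizontal covectors with a probability measure `ρ` on the space
`D_q^⊥` of vertical covectors that is 2-decreasing (linear functions are square-integrable). -/
def IsAdaptedAt (V : ∀ q : M, Submodule ℝ (TangentSpace 𝓘(ℝ, E) q)) (q : M)
    (μ : Measure (Covec E)) : Prop :=
  ∃ ρ : Measure (annihilator q (S.dist q)), IsProbabilityMeasure ρ ∧
    (∀ f : annihilator q (S.dist q) →L[ℝ] ℝ, MemLp f 2 ρ) ∧
    μ = ((S.sphereMeasure q (annihilator q (V q))).prod ρ).map
      (fun p => (p.1 : Covec E) + (p.2 : Covec E))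

/-- The limit that defines the microscopic Laplacian of `φ` at `q` with the measure `μ` exists and
is equal to `c`:
`c = lim_{t → 0+} (2 k / t²) ∫ (φ(exp_q(t, lam)) - φ(q)) dμ(lam)`, where `k` is the rank. It is part
of the claim that, for small `t`, the exponential map is defined on the whole unit cotangent space
and the integral exists. -/
def HasMicroLimitAt (μ : Measure (Covec E)) (φ : M → ℝ) (q : M) (c : ℝ) : Prop :=
  (∀ᶠ t in 𝓝[>] (0 : ℝ), ∀ lam ∈ S.cylinder q, InExpDomain S.hamiltonian q t lam) ∧
  (∀ᶠ t in 𝓝[>] (0 : ℝ),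
    Integrable (fun lam => φ (normalExp S.hamiltonian q t lam) - φ q) μ) ∧
  Tendsto (fun t : ℝ => 2 * (S.rank q : ℝ) / t ^ 2 *
    ∫ lam, (φ (normalExp S.hamiltonian q t lam) - φ q) ∂μ) (𝓝[>] 0) (𝓝 c)

/-- `c = (L^V φ)(q)`: the bundle `V` is a complement of the distribution, and the limit that defines
the microscopic Laplacian exists and is equal to `c` for every adapted measure. -/
def IsMicroLaplacianAt (V : ∀ q : M, Submodule ℝ (TangentSpace 𝓘(ℝ, E) q))
    (φ : M → ℝ) (q : M) (c : ℝ) : Prop :=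
  (∀ p : M, IsCompl (S.dist p) (V p)) ∧
  ∀ μ : Measure (Covec E), S.IsAdaptedAt V q μ → S.HasMicroLimitAt μ φ q c

/-! ### Popp's volume -/

/-- Horizontal (smooth) vector fields. -/
def IsHorizontalField [IsManifold 𝓘(ℝ, E) ∞ M] (X : VField E M) : Prop :=
  IsSmoothField X ∧ ∀ q, X q ∈ S.dist q

/-- The sections of the flag of the distribution: `D¹ = D` and `Dⁱ⁺¹ = Dⁱ + [Dⁱ, D]`,
with `D⁰ = 0`. -/
def flagFields [IsManifold 𝓘(ℝ, E) ∞ M] : ℕ → Submodule ℝ (VField E M)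
  | 0 => ⊥
  | 1 => Submodule.span ℝ {X | S.IsHorizontalField X}
  | i + 2 => flagFields (i + 1) ⊔ Submodule.span ℝ
      {Z | ∃ X ∈ flagFields (i + 1), ∃ Y, S.IsHorizontalField Y ∧
        Z = VectorField.mlieBracket 𝓘(ℝ, E) X Y}

/-- The fibre at `q` of the `i`-th term of the flag. -/
def flag [IsManifold 𝓘(ℝ, E) ∞ M] (i : ℕ) (q : M) : Submodule ℝ (TangentSpace 𝓘(ℝ, E) q) :=
  (S.flagFields i).map (LinearMap.proj q)

/-- For `v ∈ D^{r+1}_q`, the set of all squared norms `‖e‖²` of tensors `e ∈ D_q^{⊗(r+1)}` that are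
mapped to the class of `v` by the surjection `D_q^{⊗(r+1)} → D^{r+1}_q / D^r_q`,
`v₀ ⊗ ⋯ ⊗ v_r ↦ [V₀, [V₁, …, [V_{r-1}, V_r]]]_q` (`Vᵢ` a horizontal extension of `vᵢ`).
A tensor is given by its coefficients `c` in the basis of tensors `B_{a₀} ⊗ ⋯ ⊗ B_{a_r}`, which is
orthonormal if the `B_a` form an orthonormal basis of `D_q`. -/
def tensorNormSq [IsManifold 𝓘(ℝ, E) ∞ M] (q : M) (r : ℕ) (v : TangentSpace 𝓘(ℝ, E) q) : Set ℝ :=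
  {s | ∃ (B : Fin (S.rank q) → VField E M) (hB : ∀ a, S.IsHorizontalField (B a))
      (c : (Fin (r + 1) → Fin (S.rank q)) → ℝ),
      (∀ a b, S.inner q ⟨B a q, (hB a).2 q⟩ ⟨B b q, (hB b).2 q⟩ = if a = b then 1 else 0) ∧
      (∑ a, c a • nestedBracket r (fun j => B (a j)) q) - v ∈ S.flag r q ∧
      s = ∑ a, c a ^ 2}

/-- `b` is a basis of `T_q M` that is adapted to the flag of the distribution (`w j` is the order of
`b j` in the flag), and whose classes form an orthonormal basis of the graded space
`⨁ D^i_q / D^{i-1}_q`. The scalar product of `D^{r+1}_q / D^r_q` is the one whose squared norm is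
the minimum of the squared norms of the tensors that represent a vector. -/
def IsPoppBasis [IsManifold 𝓘(ℝ, E) ∞ M] (q : M)
    (b : Module.Basis (Fin (Module.finrank ℝ E)) ℝ (TangentSpace 𝓘(ℝ, E) q))
    (w : Fin (Module.finrank ℝ E) → ℕ) : Prop :=
  (∀ i, S.flag i q = Submodule.span ℝ (b '' {j | w j ≤ i})) ∧
  ∀ (r : ℕ) (x : Fin (Module.finrank ℝ E) → ℝ),
    IsLeast (S.tensorNormSq q r (∑ j with w j = r + 1, x j • b j))
      (∑ j with w j = r + 1, x j ^ 2)

/-- `vol` is Popp's volume form (which is defined up to sign): it is smooth and its value is `±1` on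
all adapted bases whose classes are orthonormal in the graded space. -/
def IsPoppVolume [IsManifold 𝓘(ℝ, E) ∞ M] (vol : TopForm E M) : Prop :=
  IsSmoothForm vol ∧ ∀ q b w, S.IsPoppBasis q b w → |vol q b| = 1

end HorizontalStructure

end Manifold

/-! ### Carnot groups -/

section Carnot

variable (E : Type*) [NormedAddCommGroup E] [NormedSpace ℝ E]
  (G : Type*) [TopologicalSpace G] [ChartedSpace E G] [Group G]

/-- The structure of a Carnot group on a simply connected Lie group: a stratification
`𝔤 = 𝔤₁ ⊕ ⋯ ⊕ 𝔤ₘ` of its Lie algebra, with `[𝔤₁, 𝔤ⱼ] = 𝔤ⱼ₊₁` and `𝔤ₘ₊₁ = 0`, and a scalar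
product on `𝔤₁`. -/
structure CarnotStructure where
  /-- the step `m` -/
  step : ℕ
  step_pos : 1 ≤ step
  /-- the layers; there is none (that is, `layer i = 0`) outside the range `1 ≤ i ≤ step` -/
  layer : ℕ → Submodule ℝ (GroupLieAlgebra 𝓘(ℝ, E) G)
  layer_zero : layer 0 = ⊥
  layer_ne_bot : ∀ i, 1 ≤ i → i ≤ step → layer i ≠ ⊥
  layer_eq_bot : ∀ i, step < i → layer i = ⊥
  isInternal : DirectSum.IsInternal layer
  bracket : ∀ j, 1 ≤ j →
    Submodule.span ℝ {z | ∃ x ∈ layer 1, ∃ y ∈ layer j, ⁅x, y⁆ = z} = layer (j + 1)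
  /-- the scalar product on the first layer -/
  inner : LinearMap.BilinForm ℝ (layer 1)
  symm : ∀ u v, inner u v = inner v u
  pos : ∀ u, u ≠ 0 → 0 < inner u u

variable {E G}

/-- The value at `q` of the left-invariant vector field that is `v` at the identity, as a linear
function of `v`. -/
def leftTranslate (q : G) :
    GroupLieAlgebra 𝓘(ℝ, E) G →ₗ[ℝ] TangentSpace 𝓘(ℝ, E) q where
  toFun v := mulInvariantVectorField v q
  map_add' u v := congrFun (mulInvariantVectorField_add u v) q
  map_smul' c v := congrFun (mulInvariantVectorField_smul c v) q

theorem leftTranslate_injective [LieGroup 𝓘(ℝ, E) ∞ G] (q : G) :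
    Function.Injective (leftTranslate (E := E) q) := by
  have hmul : ∀ g h : G, MDifferentiableAt 𝓘(ℝ, E) 𝓘(ℝ, E) (fun b => g * b) h := fun g h =>
    (contMDiff_mul_left (I := 𝓘(ℝ, E)) (n := ∞)).contMDiffAt.mdifferentiableAt (by simp)
  have A : mfderiv 𝓘(ℝ, E) 𝓘(ℝ, E) ((fun x => q⁻¹ * x) ∘ (fun x => q * x)) (1 : G) =
      ContinuousLinearMap.id _ _ := by
    have : (fun x => q⁻¹ * x) ∘ (fun x => q * x) = id := by ext x; simp
    rw [this, id_eq, mfderiv_id]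
  rw [mfderiv_comp (I' := 𝓘(ℝ, E)) _ (hmul _ _) (hmul _ _)] at A
  intro u v huv
  have h1 := DFunLike.congr_fun A u
  have h2 := DFunLike.congr_fun A v
  have h3 : mfderiv 𝓘(ℝ, E) 𝓘(ℝ, E) (fun x => q * x) (1 : G) u =
    mfderiv 𝓘(ℝ, E) 𝓘(ℝ, E) (fun x => q * x) (1 : G) v := huv
  exact h1.symm.trans ((congrArg _ h3).trans h2)

namespace CarnotStructure

variable [LieGroup 𝓘(ℝ, E) ∞ G] (C : CarnotStructure E G)

/-- The left-invariant distribution spanned by the first layer, with the left-invariant scalar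
product. -/
def horizontal : HorizontalStructure E G where
  dist q := (C.layer 1).map (leftTranslate q)
  inner q := C.inner.compl₁₂
    (Submodule.equivMapOfInjective _ (leftTranslate_injective q) (C.layer 1)).symm.toLinearMap
    (Submodule.equivMapOfInjective _ (leftTranslate_injective q) (C.layer 1)).symm.toLinearMap
  symm q u v := C.symm _ _
  pos q u hu := C.pos _ (by simpa using hu)

/-- The left-invariant complement `V₀ = 𝔤₂ ⊕ ⋯ ⊕ 𝔤ₘ`. -/
def complement (q : G) : Submodule ℝ (TangentSpace 𝓘(ℝ, E) q) :=
  (⨆ i ∈ Set.Icc 2 C.step, C.layer i).map (leftTranslate q)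

end CarnotStructure

end Carnot

end SubRiem

end

set_option linter.unusedSectionVars false

/-! Both Laplacians equal the sum of squares `∑ a, X_a (X_a φ)`, where the `X_a` are the
left-invariant extensions of an orthonormal basis `e` of the first layer. Everything is computed in
the left trivialization, in which a vector field is a function `x : G → E`, a covector at `q` is a
covector `ξ` of the Lie algebra (`leftMom`), and the bracket of `x` and `y` is `[x, y] + Dy(x) -
Dx(y)` (`mlieBracket_fieldOf`).

Macroscopic side. Left translates of one suitable graded basis are Popp bases at every point
(`exists_isPoppBasis`), so Popp's volume takes the values `±1` on this frame. By continuity and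
connectedness the sign is constant, and the volume is left-invariant (`IsPoppVolume.exists_form`).
For an invariant volume the divergence of `x` is `tr(Dx) - tr(ad x)`. The second trace vanishes for
horizontal `x`, since `ad x` shifts the layers (`trace_lieBr`); for the gradient the first trace is
the sum of squares (`isMacroLaplacianAt`).

Microscopic side. Hamilton's equations become `γ' = vel ξ`, `ξ' = ξ ∘ ad (vel ξ)` (`hamilton_iff`).
The energy is conserved, so on the noncompact cylinder the horizontal momenta stay bounded by 1 and
the momentum equation has linear growth. This gives an existence time that is uniform on the
cylinder, and a Taylor expansion of order two whose remainder is at most `B (1 + ‖ξ‖) t ^ 2`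
(`exists_expansion`). This bound is integrable for an adapted measure, so dominated convergence
applies. The term of first order has mean zero by the symmetry of the sphere. In the term of second
order, the horizontal momenta have covariance `1/k` times the identity. The remaining part consists
of products `ξ(e_b) ξ([e_b, e_a])`: as `[e_b, e_a]` lies in the second layer, inside the complement,
the second factor depends only on the vertical part of the covector, which is independent of the
centered first factor (`integral_coad`). Hence the limit is the sum of squares, whatever the
vertical measure is. -/

noncomputable section

namespace SubRiem

/-! ### Left trivialization of the tangent bundle -/

section Trivialization

variable {E : Type*} [NormedAddCommGroup E] [NormedSpace ℝ E]
  {G : Type*} [TopologicalSpace G] [ChartedSpace E G] [Group G]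

/-- The left translation `T_1 G → T_g G`, as a continuous linear map of the model space. -/
def transL (g : G) : E →L[ℝ] E :=
  show E →L[ℝ] E from mfderiv 𝓘(ℝ, E) 𝓘(ℝ, E) (fun b : G => g * b) (1 : G)

/-- The vector field with a given left trivialization. -/
def fieldOf (x : G → E) : VField E G := fun g => transL (E := E) g (x g)

variable [LieGroup 𝓘(ℝ, E) ∞ G]

/-- The Lie algebra structure on `GroupLieAlgebra` is stated at this smoothness. -/
instance instLieGroupMinSmoothness : LieGroup 𝓘(ℝ, E) (minSmoothness ℝ 3) G :=
  LieGroup.of_le (m := minSmoothness ℝ 3) (n := ∞) (by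
    rw [minSmoothness_of_isRCLikeNormedField]; exact WithTop.coe_le_coe.2 le_top)

theorem mdifferentiableAt_mul_left (g h : G) :
    MDifferentiableAt 𝓘(ℝ, E) 𝓘(ℝ, E) (fun b => g * b) h :=
  (contMDiff_mul_left (I := 𝓘(ℝ, E)) (n := ∞)).contMDiffAt.mdifferentiableAt (by simp)

/-- The inverse of `transL`. -/
def untransL (g : G) : E →L[ℝ] E :=
  show E →L[ℝ] E from mfderiv 𝓘(ℝ, E) 𝓘(ℝ, E) (fun b : G => g⁻¹ * b) g

theorem untransL_transL (g : G) (v : E) : untransL g (transL g v) = v := by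
  have A : mfderiv 𝓘(ℝ, E) 𝓘(ℝ, E) ((fun x => g⁻¹ * x) ∘ (fun x => g * x)) (1 : G) =
      ContinuousLinearMap.id _ _ := by
    have : (fun x => g⁻¹ * x) ∘ (fun x => g * x) = id := by ext x; simp
    rw [this, id_eq, mfderiv_id]
  rw [mfderiv_comp (I' := 𝓘(ℝ, E)) _ (mdifferentiableAt_mul_left _ _)
    (mdifferentiableAt_mul_left _ _)] at A
  have h1 := DFunLike.congr_fun A v
  have h2 : mfderiv 𝓘(ℝ, E) 𝓘(ℝ, E) (fun b : G => g⁻¹ * b) (g * 1) =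
      untransL (E := E) g := by
    rw [mul_one]; rfl
  exact (DFunLike.congr_fun h2.symm _).trans h1

theorem transL_untransL (g : G) (v : E) : transL g (untransL g v) = v := by
  have A : mfderiv 𝓘(ℝ, E) 𝓘(ℝ, E) ((fun x => g * x) ∘ (fun x => g⁻¹ * x)) g =
      ContinuousLinearMap.id _ _ := by
    have : (fun x => g * x) ∘ (fun x => g⁻¹ * x) = id := by ext x; simp
    rw [this, id_eq, mfderiv_id]
  rw [mfderiv_comp (I' := 𝓘(ℝ, E)) _ (mdifferentiableAt_mul_left _ _)
    (mdifferentiableAt_mul_left _ _)] at A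
  have h1 := DFunLike.congr_fun A v
  have h2 : mfderiv 𝓘(ℝ, E) 𝓘(ℝ, E) (fun b : G => g * b) (g⁻¹ * g) =
      transL (E := E) g := by
    rw [inv_mul_cancel]; rfl
  exact (DFunLike.congr_fun h2.symm _).trans h1

/-- Left translation as a linear equivalence. -/
def transLE (g : G) : E ≃L[ℝ] E :=
  ContinuousLinearEquiv.equivOfInverse (transL g) (untransL g) (untransL_transL g)
    (transL_untransL g)

@[simp] theorem transLE_apply (g : G) (v : E) : transLE g v = transL g v := rfl

theorem transL_injective (g : G) : Function.Injective (transL (E := E) g) :=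
  (transLE g).injective

/-- The trivialization centered at `a` is the identity on the fibre over `a`, so a map into this
single fibre is as smooth as its vector part. -/
theorem contMDiff_fiber_iff (a : G) (x : G → E) :
    ContMDiff 𝓘(ℝ, E) (𝓘(ℝ, E)).tangent ∞
      (fun g : G => (⟨a, x g⟩ : TangentBundle 𝓘(ℝ, E) G)) ↔ ContMDiff 𝓘(ℝ, E) 𝓘(ℝ, E) ∞ x := by
  have key : ∀ v : E, (trivializationAt E (TangentSpace 𝓘(ℝ, E)) a
      (⟨a, v⟩ : TangentBundle 𝓘(ℝ, E) G)).2 = v := by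
    intro v
    rw [TangentBundle.trivializationAt_apply]
    exact tangentCoordChange_self (I := 𝓘(ℝ, E)) (mem_extChartAt_source a)
  constructor
  · intro h g
    have := (Bundle.contMDiffAt_totalSpace.1 (h g)).2
    simpa only [key] using this
  · intro h g
    refine Bundle.contMDiffAt_totalSpace.2 ⟨contMDiffAt_const, ?_⟩
    simpa only [key] using h g

/-- The derivative of the multiplication, applied to a vector of the second factor. -/
theorem contMDiff_mul_translate {a : G → G} (ha : ContMDiff 𝓘(ℝ, E) 𝓘(ℝ, E) ∞ a)
    {Y : G → TangentBundle 𝓘(ℝ, E) G}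
    (hY : ContMDiff 𝓘(ℝ, E) (𝓘(ℝ, E)).tangent ∞ Y) :
    ContMDiff 𝓘(ℝ, E) (𝓘(ℝ, E)).tangent ∞ (fun g => (⟨a g * (Y g).1,
      mfderiv 𝓘(ℝ, E) 𝓘(ℝ, E) (fun b : G => a g * b) (Y g).1 (Y g).2⟩ :
        TangentBundle 𝓘(ℝ, E) G)) := by
  let fg : G → TangentBundle 𝓘(ℝ, E) G := fun g => ⟨a g, 0⟩
  have sfg : ContMDiff 𝓘(ℝ, E) (𝓘(ℝ, E)).tangent ∞ fg :=
    (Bundle.contMDiff_zeroSection ℝ (TangentSpace 𝓘(ℝ, E) (M := G))).comp ha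
  let F₁ : G → (TangentBundle 𝓘(ℝ, E) G × TangentBundle 𝓘(ℝ, E) G) := fun g => (fg g, Y g)
  have S₁ : ContMDiff 𝓘(ℝ, E) ((𝓘(ℝ, E)).tangent.prod (𝓘(ℝ, E)).tangent) ∞ F₁ :=
    sfg.prodMk hY
  let F₂ : (TangentBundle 𝓘(ℝ, E) G × TangentBundle 𝓘(ℝ, E) G) →
      TangentBundle (𝓘(ℝ, E).prod 𝓘(ℝ, E)) (G × G) :=
    (equivTangentBundleProd 𝓘(ℝ, E) G 𝓘(ℝ, E) G).symm
  have S₂ : ContMDiff ((𝓘(ℝ, E)).tangent.prod (𝓘(ℝ, E)).tangent)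
    (𝓘(ℝ, E).prod 𝓘(ℝ, E)).tangent ∞ F₂ := contMDiff_equivTangentBundleProd_symm
  let F₃ : TangentBundle (𝓘(ℝ, E).prod 𝓘(ℝ, E)) (G × G) → TangentBundle 𝓘(ℝ, E) G :=
    tangentMap (𝓘(ℝ, E).prod 𝓘(ℝ, E)) 𝓘(ℝ, E) (fun p : G × G => p.1 * p.2)
  have S₃ : ContMDiff (𝓘(ℝ, E).prod 𝓘(ℝ, E)).tangent (𝓘(ℝ, E)).tangent ∞ F₃ := by
    apply ContMDiff.contMDiff_tangentMap (n := ∞) (m := ∞) _ le_rfl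
    exact contMDiff_mul 𝓘(ℝ, E) ∞
  let S := (S₃.comp S₂).comp S₁
  convert! S with g
  simp only [Function.comp_apply, tangentMap, F₃, F₂, F₁, fg]
  rw [mfderiv_prod_eq_add_apply ((contMDiff_mul 𝓘(ℝ, E) ∞).mdifferentiableAt (by simp))]
  refine Eq.trans ?_ (congrArg₂ (· + ·) (map_zero _).symm rfl)
  exact (zero_add _).symm

/-- The field and its trivialization are exchanged by translations that depend smoothly on the
point: by `g⁻¹`, into the fibre over `1`, in one direction and by `g` in the other. Both are
instances of `contMDiff_mul_translate`. -/
theorem isSmoothField_fieldOf_iff (x : G → E) :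
    IsSmoothField (fieldOf x) ↔ ContMDiff 𝓘(ℝ, E) 𝓘(ℝ, E) ∞ x := by
  constructor
  · intro h
    rw [← contMDiff_fiber_iff (1 : G)]
    have h1 := contMDiff_mul_translate (contMDiff_inv 𝓘(ℝ, E) ∞) h
    convert h1 using 1
    funext g
    have h2 : ∀ a b : G, a = b → ∀ v w : E, v = w →
        (⟨a, v⟩ : TangentBundle 𝓘(ℝ, E) G) = ⟨b, w⟩ := by
      rintro a b rfl v w rfl; rfl
    exact h2 _ _ (inv_mul_cancel g).symm _ _ (untransL_transL (E := E) g (x g)).symm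
  · intro h
    have h1 := contMDiff_mul_translate (contMDiff_id (M := G)) ((contMDiff_fiber_iff (1 : G) x).2 h)
    unfold IsSmoothField
    convert h1 using 1
    funext g
    have h2 : ∀ a b : G, a = b → ∀ v w : E, v = w →
        (⟨a, v⟩ : TangentBundle 𝓘(ℝ, E) G) = ⟨b, w⟩ := by
      rintro a b rfl v w rfl; rfl
    exact h2 _ _ (mul_one g).symm _ _ rfl

theorem exists_eq_fieldOf (X : VField E G) : ∃ x : G → E, X = fieldOf x :=
  ⟨fun g => untransL (E := E) g (X g), funext fun g => (transL_untransL (E := E) g (X g)).symm⟩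

/-- The derivative of `f` along a left-invariant vector field. -/
def leftDeriv {F : Type*} [NormedAddCommGroup F] [NormedSpace ℝ F] (f : G → F) (g : G) : E →L[ℝ] F :=
  ContinuousLinearMap.comp (M₁ := E) (M₂ := E) (M₃ := F)
    (mfderiv 𝓘(ℝ, E) 𝓘(ℝ, F) f g) (transL (E := E) g)

theorem contMDiff_leftDeriv {F : Type*} [NormedAddCommGroup F] [NormedSpace ℝ F] {f : G → F}
    (hf : ContMDiff 𝓘(ℝ, E) 𝓘(ℝ, F) ∞ f) (v : E) :
    ContMDiff 𝓘(ℝ, E) 𝓘(ℝ, F) ∞ (fun g => leftDeriv (E := E) f g v) := by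
  have h1 : ContMDiff 𝓘(ℝ, E).tangent 𝓘(ℝ, F).tangent ∞ (tangentMap 𝓘(ℝ, E) 𝓘(ℝ, F) f) :=
    hf.contMDiff_tangentMap (m := ∞) le_rfl
  have h2 : IsSmoothField (fieldOf (fun _ : G => v)) :=
    (isSmoothField_fieldOf_iff _).2 contMDiff_const
  exact contMDiff_snd_tangentBundle_modelSpace F 𝓘(ℝ, F) |>.comp (h1.comp h2)

end Trivialization

end SubRiem

namespace SubRiem

/-! ### Lie brackets of vector fields in the left trivialization -/

section Bracket

variable {E : Type*} [NormedAddCommGroup E] [NormedSpace ℝ E] [FiniteDimensional ℝ E]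
  {G : Type*} [TopologicalSpace G] [ChartedSpace E G] [Group G] [LieGroup 𝓘(ℝ, E) ∞ G]

instance : CompleteSpace E := FiniteDimensional.complete ℝ E

variable (E G) in
/-- The bracket of the Lie algebra of `G`, on the model space. -/
def lieBr : E →ₗ[ℝ] E →ₗ[ℝ] E :=
  LinearMap.mk₂ ℝ (M := E) (Nₗ := E) (Pₗ := E)
    (fun u v => Bracket.bracket (L := GroupLieAlgebra 𝓘(ℝ, E) G)
      (M := GroupLieAlgebra 𝓘(ℝ, E) G) u v)
    (add_lie (L := GroupLieAlgebra 𝓘(ℝ, E) G) (M := GroupLieAlgebra 𝓘(ℝ, E) G))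
    (smul_lie (L := GroupLieAlgebra 𝓘(ℝ, E) G) (M := GroupLieAlgebra 𝓘(ℝ, E) G))
    (lie_add (L := GroupLieAlgebra 𝓘(ℝ, E) G) (M := GroupLieAlgebra 𝓘(ℝ, E) G))
    (lie_smul (L := GroupLieAlgebra 𝓘(ℝ, E) G) (M := GroupLieAlgebra 𝓘(ℝ, E) G))

theorem lieBr_self (u : E) : lieBr E G u u = 0 := lie_self (L := GroupLieAlgebra 𝓘(ℝ, E) G) u

theorem mlieBracket_const_const (v w : E) (g : G) :
    VectorField.mlieBracket 𝓘(ℝ, E) (fieldOf (fun _ : G => v)) (fieldOf (fun _ : G => w)) g =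
      transL (E := E) g (lieBr E G v w) :=
  (congrFun (mulInvariantVector_mlieBracket (I := 𝓘(ℝ, E)) (G := G) v w) g).symm

theorem IsSmoothField.mdifferentiableAt {X : VField E G} (hX : IsSmoothField X) (g : G) :
    MDifferentiableAt 𝓘(ℝ, E) (𝓘(ℝ, E)).tangent
      (fun q => (⟨q, X q⟩ : TangentBundle 𝓘(ℝ, E) G)) g :=
  hX.contMDiffAt.mdifferentiableAt (by simp)

theorem fieldOf_add (x y : G → E) : fieldOf (x + y) = fieldOf x + fieldOf y :=
  funext fun g => map_add (transL (E := E) g) (x g) (y g)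

theorem fieldOf_smul (f : G → ℝ) (x : G → E) : fieldOf (f • x) = f • fieldOf x :=
  funext fun g => map_smul (transL (E := E) g) (f g) (x g)

theorem leftDeriv_add {F : Type*} [NormedAddCommGroup F] [NormedSpace ℝ F] {x y : G → F}
    (hx : ContMDiff 𝓘(ℝ, E) 𝓘(ℝ, F) ∞ x) (hy : ContMDiff 𝓘(ℝ, E) 𝓘(ℝ, F) ∞ y) (g : G) :
    leftDeriv (E := E) (x + y) g = leftDeriv x g + leftDeriv y g := by
  have h : mfderiv 𝓘(ℝ, E) 𝓘(ℝ, F) (x + y) g = _ :=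
    mfderiv_add (hx.mdifferentiableAt (by simp)) (hy.mdifferentiableAt (by simp))
  ext v
  exact DFunLike.congr_fun h (transL g v)

theorem leftDeriv_smul_const {F : Type*} [NormedAddCommGroup F] [NormedSpace ℝ F] {f : G → ℝ}
    (hf : ContMDiff 𝓘(ℝ, E) 𝓘(ℝ, ℝ) ∞ f) (w : F) (g : G) (v : E) :
    leftDeriv (E := E) (fun g => f g • w) g v = leftDeriv f g v • w := by
  have h := (hf.mdifferentiableAt (by simp) (x := g)).hasMFDerivAt
  have h2 := ((ContinuousLinearMap.id ℝ ℝ).smulRight w).hasMFDerivAt (x := f g)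
  have h3 := (h2.comp g h).mfderiv
  exact DFunLike.congr_fun h3 (transL g v)

theorem leftDeriv_clm_comp {F F' : Type*} [NormedAddCommGroup F] [NormedSpace ℝ F]
    [NormedAddCommGroup F'] [NormedSpace ℝ F'] (L : F →L[ℝ] F') {x : G → F}
    (hx : ContMDiff 𝓘(ℝ, E) 𝓘(ℝ, F) ∞ x) (g : G) (v : E) :
    leftDeriv (E := E) (fun g => L (x g)) g v = L (leftDeriv x g v) := by
  have h := (hx.mdifferentiableAt (by simp) (x := g)).hasMFDerivAt
  have h2 := L.hasMFDerivAt (x := x g)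
  have h3 := (h2.comp g h).mfderiv
  exact DFunLike.congr_fun h3 (transL g v)

theorem contMDiff_clm_comp {F F' : Type*} [NormedAddCommGroup F] [NormedSpace ℝ F]
    [NormedAddCommGroup F'] [NormedSpace ℝ F'] (L : F →L[ℝ] F') {x : G → F}
    (hx : ContMDiff 𝓘(ℝ, E) 𝓘(ℝ, F) ∞ x) : ContMDiff 𝓘(ℝ, E) 𝓘(ℝ, F') ∞ (fun g => L (x g)) :=
  L.contMDiff.comp hx

/-- Induction principle for smooth functions with values in a finite-dimensional space. -/
theorem smooth_induction {p : (G → E) → Prop}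
    (hadd : ∀ x y, ContMDiff 𝓘(ℝ, E) 𝓘(ℝ, E) ∞ x → ContMDiff 𝓘(ℝ, E) 𝓘(ℝ, E) ∞ y →
      p x → p y → p (x + y))
    (hsmul : ∀ (f : G → ℝ) (w : E), ContMDiff 𝓘(ℝ, E) 𝓘(ℝ, ℝ) ∞ f → p (fun g => f g • w))
    (x : G → E) (hx : ContMDiff 𝓘(ℝ, E) 𝓘(ℝ, E) ∞ x) : p x := by
  let b := Module.finBasis ℝ E
  have hc : ∀ i, ContMDiff 𝓘(ℝ, E) 𝓘(ℝ, ℝ) ∞ (fun g => b.coord i (x g)) := fun i =>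
    contMDiff_clm_comp (LinearMap.toContinuousLinearMap (b.coord i)) hx
  have hs : x = ∑ i, fun g => b.coord i (x g) • b i := by
    funext g
    simp [Finset.sum_apply, b.sum_repr]
  rw [hs]
  refine (Finset.sum_induction _
    (fun y => ContMDiff 𝓘(ℝ, E) 𝓘(ℝ, E) ∞ y ∧ p y) ?_ ?_ ?_).2
  · rintro y z ⟨hy, py⟩ ⟨hz, pz⟩
    exact ⟨hy.add hz, hadd y z hy hz py pz⟩
  · refine ⟨contMDiff_const, ?_⟩
    have h0 := hsmul (fun _ => 0) 0 contMDiff_const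
    simp only [smul_zero] at h0
    exact h0
  · intro i _
    exact ⟨(hc i).smul contMDiff_const, hsmul _ _ (hc i)⟩

/-- Both sides are additive in `y`, and for `y = f • w` the formula is the Leibniz rule together
with the bracket of two left-invariant fields. -/
theorem mlieBracket_const_fieldOf (v : E) (y : G → E) (hy : ContMDiff 𝓘(ℝ, E) 𝓘(ℝ, E) ∞ y) (g : G) :
    VectorField.mlieBracket 𝓘(ℝ, E) (fieldOf (fun _ : G => v)) (fieldOf y) g =
      transL (E := E) g (lieBr E G v (y g) + leftDeriv y g v) := by
  revert y
  refine smooth_induction ?_ ?_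
  · intro x y hx hy px py
    rw [fieldOf_add, VectorField.mlieBracket_add_right
      (((isSmoothField_fieldOf_iff x).2 hx).mdifferentiableAt g)
      (((isSmoothField_fieldOf_iff y).2 hy).mdifferentiableAt g), px, py, leftDeriv_add hx hy]
    refine (map_add (transL (E := E) g) _ _).symm.trans (congrArg _ ?_)
    simp only [Pi.add_apply, map_add, _root_.add_apply]
    abel
  · intro f w hf
    have h : fieldOf (fun g => f g • w) = f • fieldOf (fun _ : G => w) := fieldOf_smul f _
    rw [h, VectorField.mlieBracket_smul_right (hf.mdifferentiableAt (by simp))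
      (((isSmoothField_fieldOf_iff _).2 contMDiff_const).mdifferentiableAt g),
      mlieBracket_const_const, leftDeriv_smul_const hf]
    have h2 : mvfderiv 𝓘(ℝ, E) f g (fieldOf (fun _ : G => v) g) = leftDeriv f g v := rfl
    rw [h2]
    refine Eq.trans (b := leftDeriv f g v • transL (E := E) g w +
      f g • transL (E := E) g (lieBr E G v w)) rfl ?_
    rw [← map_smul, ← map_smul, ← map_add, map_smul, add_comm]

/-- The bracket of vector fields, in the left trivialization. -/
theorem mlieBracket_fieldOf (x y : G → E) (hx : ContMDiff 𝓘(ℝ, E) 𝓘(ℝ, E) ∞ x)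
    (hy : ContMDiff 𝓘(ℝ, E) 𝓘(ℝ, E) ∞ y) (g : G) :
    VectorField.mlieBracket 𝓘(ℝ, E) (fieldOf x) (fieldOf y) g =
      transL (E := E) g (lieBr E G (x g) (y g) + leftDeriv y g (x g) - leftDeriv x g (y g)) := by
  revert x
  refine smooth_induction ?_ ?_
  · intro x x' hx hx' px px'
    rw [fieldOf_add, VectorField.mlieBracket_add_left
      (((isSmoothField_fieldOf_iff x).2 hx).mdifferentiableAt g)
      (((isSmoothField_fieldOf_iff x').2 hx').mdifferentiableAt g), px, px', leftDeriv_add hx hx']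
    refine (map_add (transL (E := E) g) _ _).symm.trans (congrArg _ ?_)
    simp only [Pi.add_apply, map_add, _root_.add_apply, LinearMap.add_apply]
    abel
  · intro f w hf
    have h : fieldOf (fun g => f g • w) = f • fieldOf (fun _ : G => w) := fieldOf_smul f _
    rw [h, VectorField.mlieBracket_smul_left (hf.mdifferentiableAt (by simp))
      (((isSmoothField_fieldOf_iff _).2 contMDiff_const).mdifferentiableAt g),
      mlieBracket_const_fieldOf _ _ hy, leftDeriv_smul_const hf]
    have h2 : mvfderiv 𝓘(ℝ, E) f g (fieldOf y g) = leftDeriv f g (y g) := rfl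
    rw [h2]
    refine Eq.trans (b := -leftDeriv f g (y g) • transL (E := E) g w +
      f g • transL (E := E) g (lieBr E G w (y g) + leftDeriv y g w)) rfl ?_
    simp only [map_sub, map_add, map_smul, LinearMap.smul_apply, smul_add, neg_smul]
    abel

end Bracket

end SubRiem

namespace SubRiem

/-! ### Nested brackets and quotient norms: linear algebra -/

section NestedBracket

variable {V : Type*} [AddCommGroup V] [Module ℝ V] (br : V →ₗ[ℝ] V →ₗ[ℝ] V)

/-- The nested bracket `[v₀, [v₁, …, [v_{r-1}, v_r]]]`, as a multilinear map. -/
def nestML : (r : ℕ) → MultilinearMap ℝ (fun _ : Fin (r + 1) => V) V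
  | 0 =>
    haveI : Subsingleton (Fin (0 + 1)) := inferInstanceAs (Subsingleton (Fin 1))
    MultilinearMap.ofSubsingleton ℝ V V 0 LinearMap.id
  | r + 1 => LinearMap.uncurryLeft
      { toFun := fun u => (br u).compMultilinearMap (nestML r)
        map_add' := fun u v => by ext; simp
        map_smul' := fun u v => by ext; simp }

theorem nestML_zero (v : Fin 1 → V) : nestML br 0 v = v 0 := by
  rfl

theorem nestML_succ (r : ℕ) (v : Fin (r + 1 + 1) → V) :
    nestML br (r + 1) v = br (v 0) (nestML br r (fun j => v j.succ)) := rfl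

/-- The sum of the nested brackets of the vectors of a family, with coefficients. -/
def nestSum {k : ℕ} (e : Fin k → V) (r : ℕ) : ((Fin (r + 1) → Fin k) → ℝ) →ₗ[ℝ] V where
  toFun c := ∑ a, c a • nestML br r (fun j => e (a j))
  map_add' c d := by simp [add_smul, Finset.sum_add_distrib]
  map_smul' s c := by simp [mul_smul, Finset.smul_sum]

theorem nestSum_apply {k : ℕ} (e : Fin k → V) (r : ℕ) (c : (Fin (r + 1) → Fin k) → ℝ) :
    nestSum br e r c = ∑ a, c a • nestML br r (fun j => e (a j)) := rfl

theorem nestML_mem_range {k : ℕ} (e : Fin k → V) (r : ℕ) (a : Fin (r + 1) → Fin k) :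
    nestML br r (fun j => e (a j)) ∈ LinearMap.range (nestSum br e r) := by
  classical
  refine ⟨Pi.single a 1, ?_⟩
  rw [nestSum_apply, Finset.sum_eq_single a]
  · simp
  · intro b _ hb
    simp [hb]
  · simp

theorem range_nestSum_eq_span {k : ℕ} (e : Fin k → V) (r : ℕ) :
    LinearMap.range (nestSum br e r) =
      Submodule.span ℝ (Set.range fun a : Fin (r + 1) → Fin k => nestML br r (fun j => e (a j))) := by
  apply le_antisymm
  · rintro _ ⟨c, rfl⟩
    exact Submodule.sum_mem _ fun a _ => Submodule.smul_mem _ _ (Submodule.subset_span ⟨a, rfl⟩)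
  · rw [Submodule.span_le]
    rintro _ ⟨a, rfl⟩
    exact nestML_mem_range br e r a

/-- The surjectivity of the map on tensors that defines the norm of a layer: a nested bracket of `r
+ 2` vectors is a bracket of one vector with a nested bracket of `r + 1`, and `L (r + 2)` is spanned
by brackets of `L 1` with `L (r + 1)`. -/
theorem range_nestSum {k : ℕ} (e : Fin k → V) (L : ℕ → Submodule ℝ V)
    (he : Submodule.span ℝ (Set.range e) = L 1)
    (hL : ∀ j, 1 ≤ j → Submodule.map₂ br (L 1) (L j) = L (j + 1)) (r : ℕ) :
    LinearMap.range (nestSum br e r) = L (r + 1) := by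
  induction r with
  | zero =>
    rw [range_nestSum_eq_span]
    change _ = L 1
    rw [← he]
    congr 1
    ext v
    simp only [nestML_zero, Set.mem_range]
    constructor
    · rintro ⟨a, rfl⟩
      exact ⟨a 0, rfl⟩
    · rintro ⟨a, rfl⟩
      exact ⟨fun _ => a, rfl⟩
  | succ r ih =>
    rw [← hL (r + 1) (by omega), ← ih, ← he, range_nestSum_eq_span, range_nestSum_eq_span,
      Submodule.map₂_span_span]
    congr 1
    ext v
    simp only [nestML_succ, Set.mem_range, Set.mem_image2]
    constructor
    · rintro ⟨a, rfl⟩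
      exact ⟨_, ⟨a 0, rfl⟩, _, ⟨fun j => a j.succ, rfl⟩, rfl⟩
    · rintro ⟨_, ⟨i, rfl⟩, _, ⟨a, rfl⟩, rfl⟩
      exact ⟨Fin.cons i a, by simp⟩

/-- The norm of tensors does not depend on the orthonormal basis. -/
theorem exists_nestSum_eq_of_orthogonal {k : ℕ} (e β : Fin k → V) (O : Fin k → Fin k → ℝ)
    (hβ : ∀ a, β a = ∑ s, O s a • e s) (hO : ∀ a b, ∑ s, O s a * O s b = if a = b then 1 else 0)
    (r : ℕ) (c : (Fin (r + 1) → Fin k) → ℝ) :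
    ∃ c' : (Fin (r + 1) → Fin k) → ℝ,
      nestSum br e r c' = nestSum br β r c ∧ ∑ a, c' a ^ 2 = ∑ a, c a ^ 2 := by
  classical
  -- The coefficients of the same tensor in the basis `e`, that is, the image of `c` under the
  -- tensor power of `O`. The Gram matrix of its columns factors over the slots, so this power is
  -- orthogonal too.
  refine ⟨fun a' => ∑ a, c a * ∏ j, O (a' j) (a j), ?_, ?_⟩
  · rw [nestSum_apply, nestSum_apply]
    simp only [hβ, MultilinearMap.map_sum, MultilinearMap.map_smul_univ, Finset.sum_smul,
      Finset.smul_sum, mul_smul]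
    exact Finset.sum_comm
  · have h1 : ∀ a b : Fin (r + 1) → Fin k,
        ∑ a' : Fin (r + 1) → Fin k, (∏ j, O (a' j) (a j)) * ∏ j, O (a' j) (b j) =
          if a = b then 1 else 0 := by
      intro a b
      simp only [← Finset.prod_mul_distrib]
      rw [← Fintype.prod_sum (fun j s => O s (a j) * O s (b j))]
      simp only [hO]
      by_cases h : a = b
      · subst h; simp
      · obtain ⟨j, hj⟩ := Function.ne_iff.1 h
        rw [if_neg h]
        exact Finset.prod_eq_zero (Finset.mem_univ j) (if_neg hj)
    have h2 : ∀ a' : Fin (r + 1) → Fin k, (∑ a : Fin (r + 1) → Fin k,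
        c a * ∏ j, O (a' j) (a j)) ^ 2 = ∑ a : Fin (r + 1) → Fin k, ∑ b : Fin (r + 1) → Fin k,
          c a * c b * ((∏ j, O (a' j) (a j)) * ∏ j, O (a' j) (b j)) := by
      intro a'
      rw [sq, Finset.sum_mul_sum]
      refine Finset.sum_congr rfl fun a _ => Finset.sum_congr rfl fun b _ => ?_
      ring
    have h3 : ∑ a' : Fin (r + 1) → Fin k, (∑ a : Fin (r + 1) → Fin k,
        c a * ∏ j, O (a' j) (a j)) ^ 2 = ∑ a : Fin (r + 1) → Fin k, ∑ b : Fin (r + 1) → Fin k,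
          c a * c b * ∑ a' : Fin (r + 1) → Fin k,
            ((∏ j, O (a' j) (a j)) * ∏ j, O (a' j) (b j)) := by
      simp only [h2]
      rw [Finset.sum_comm]
      refine Finset.sum_congr rfl fun a _ => ?_
      rw [Finset.sum_comm]
      refine Finset.sum_congr rfl fun b _ => ?_
      rw [Finset.mul_sum]
    rw [h3]
    simp only [h1, mul_ite, mul_one, mul_zero, Finset.sum_ite_eq, Finset.mem_univ, if_true, sq]

/-- The quotient norm of a linear map on `ℝ^ι` has an orthonormal basis. -/
theorem exists_basis_range_isLeast {ι : Type*} [Fintype ι] (T : (ι → ℝ) →ₗ[ℝ] V) :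
    ∃ (n : ℕ) (b : Module.Basis (Fin n) ℝ (LinearMap.range T)), ∀ x : Fin n → ℝ,
      IsLeast {s : ℝ | ∃ c : ι → ℝ, T c = ∑ j, x j • (b j : V) ∧ s = ∑ a, c a ^ 2}
        (∑ j, x j ^ 2) := by
  let T' : EuclideanSpace ℝ ι →ₗ[ℝ] V := T ∘ₗ (WithLp.linearEquiv 2 ℝ (ι → ℝ)).toLinearMap
  have hT' : LinearMap.range T' = LinearMap.range T :=
    LinearMap.range_comp_of_range_eq_top _ (LinearEquiv.range _)
  -- The representative of least norm is the one orthogonal to the kernel. So `T'` maps `K`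
  -- isometrically onto the range with the quotient norm, and carries an orthonormal basis of `K` to
  -- the required one.
  let K := (LinearMap.ker T')ᗮ
  have hK : IsCompl K (LinearMap.ker T') := (Submodule.isCompl_orthogonal _).symm
  let o := stdOrthonormalBasis ℝ K
  let b := (o.toBasis.map (LinearMap.kerComplementEquivRange T' hK)).map (LinearEquiv.ofEq _ _ hT')
  have hb : ∀ j, (b j : V) = T' (o j) := fun j => rfl
  have hnorm : ∀ x : Fin (Module.finrank ℝ K) → ℝ, ‖∑ j, x j • o j‖ ^ 2 = ∑ j, x j ^ 2 := by
    intro x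
    have := o.sum_sq_norm_inner_right (∑ j, x j • o j)
    rw [← this]
    refine Finset.sum_congr rfl fun j _ => ?_
    rw [o.orthonormal.inner_right_fintype]
    simp
  have hsum : ∀ c : EuclideanSpace ℝ ι, ‖c‖ ^ 2 = ∑ a, (c a) ^ 2 := fun c => by
    simp [EuclideanSpace.norm_sq_eq]
  refine ⟨_, b, fun x => ⟨⟨WithLp.ofLp (∑ j, x j • o j : K).1, ?_, ?_⟩, ?_⟩⟩
  · have : T' (∑ j, x j • o j : K).1 = ∑ j, x j • (b j : V) := by
      simp [hb]
    exact this
  · rw [← hnorm, ← hsum]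
    rfl
  · rintro _ ⟨c, hc, rfl⟩
    set d : K := ∑ j, x j • o j with hd
    let c' : EuclideanSpace ℝ ι := WithLp.toLp 2 c
    have h1 : T' c' = T' d.1 := by
      have : T' d.1 = ∑ j, x j • (b j : V) := by
        simp [hb, hd]
      rw [this, ← hc]
      rfl
    have h2 : c' - d.1 ∈ LinearMap.ker T' := by
      rw [LinearMap.mem_ker, map_sub, h1, sub_self]
    have h3 : inner ℝ (c' - d.1) d.1 = 0 := d.2 _ h2
    have h4 : ‖c'‖ ^ 2 = ‖c' - d.1‖ ^ 2 + ‖d.1‖ ^ 2 := by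
      have := norm_add_sq_eq_norm_sq_add_norm_sq_of_inner_eq_zero _ _ h3
      rw [sub_add_cancel] at this
      simpa [sq] using this
    calc ∑ j, x j ^ 2 = ‖d.1‖ ^ 2 := (hnorm x).symm
      _ ≤ ‖c'‖ ^ 2 := by rw [h4]; nlinarith [sq_nonneg ‖c' - d.1‖]
      _ = _ := hsum c'

end NestedBracket

section Graded

variable {V : Type*} [AddCommGroup V] [Module ℝ V] [FiniteDimensional ℝ V]
  (br : V →ₗ[ℝ] V →ₗ[ℝ] V)

theorem sum_filter_sigma_fst {n : ℕ → ℕ} {N : ℕ} (σ : (Σ i, Fin (n i)) ≃ Fin N) (i : ℕ)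
    {M : Type*} [AddCommMonoid M] (f : Fin N → M) :
    ∑ j with (σ.symm j).1 = i, f j = ∑ a : Fin (n i), f (σ ⟨i, a⟩) := by
  symm
  refine Finset.sum_bij (fun a _ => σ ⟨i, a⟩) ?_ ?_ ?_ ?_
  · intro a _; simp
  · intro a _ a' _ h
    simpa using h
  · intro j hj
    simp only [Finset.mem_filter, Finset.mem_univ, true_and] at hj
    obtain ⟨⟨i, a⟩, rfl⟩ := σ.surjective j
    simp only [Equiv.symm_apply_apply] at hj
    subst hj
    exact ⟨a, Finset.mem_univ _, rfl⟩
  · intro a _; rfl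

/-- A graded Lie algebra generated by its first layer has a basis that is adapted to the grading and
orthonormal for the quotient norms of the layers. -/
theorem exists_graded_basis {k : ℕ} (e : Fin k → V) (L : ℕ → Submodule ℝ V)
    (hint : DirectSum.IsInternal L) (he : Submodule.span ℝ (Set.range e) = L 1)
    (hL : ∀ j, 1 ≤ j → Submodule.map₂ br (L 1) (L j) = L (j + 1)) :
    ∃ (b : Module.Basis (Fin (Module.finrank ℝ V)) ℝ V) (w : Fin (Module.finrank ℝ V) → ℕ),
      (∀ i, (⨆ j ≤ i, L j) = Submodule.span ℝ (b '' {j | w j ≤ i})) ∧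
      ∀ (r : ℕ) (x : Fin (Module.finrank ℝ V) → ℝ),
        IsLeast {s : ℝ | ∃ c, nestSum br e r c = ∑ j with w j = r + 1, x j • b j ∧
          s = ∑ a, c a ^ 2} (∑ j with w j = r + 1, x j ^ 2) := by
  classical
  -- The equation `i = r + 1` makes the condition void for `L 0`, which carries no tensor norm and
  -- gets an arbitrary basis.
  have H : ∀ i, ∃ (n : ℕ) (b : Module.Basis (Fin n) ℝ (L i)), ∀ r, i = r + 1 → ∀ x : Fin n → ℝ,
      IsLeast {s : ℝ | ∃ c, nestSum br e r c = ∑ j, x j • (b j : V) ∧ s = ∑ a, c a ^ 2}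
        (∑ j, x j ^ 2) := by
    intro i
    cases i with
    | zero => exact ⟨_, Module.finBasis ℝ (L 0), fun r hr => by omega⟩
    | succ r =>
      obtain ⟨n, b, hb⟩ := exists_basis_range_isLeast (nestSum br e r)
      refine ⟨n, b.map (LinearEquiv.ofEq _ _ (range_nestSum br e L he hL r)), ?_⟩
      rintro r' hr x
      obtain rfl : r = r' := by omega
      exact hb x
  choose n β hβ using H
  let B := hint.collectedBasis β
  let σ : (Σ i, Fin (n i)) ≃ Fin (Module.finrank ℝ V) := B.indexEquiv (Module.finBasis ℝ V)
  have hB : ∀ p, B p = (β p.1 p.2 : V) := fun p => by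
    simp [B, DirectSum.IsInternal.collectedBasis_coe]
  refine ⟨B.reindex σ, fun j => (σ.symm j).1, ?_, ?_⟩
  · intro i
    apply le_antisymm
    · refine iSup₂_le fun j hj => ?_
      have : L j = Submodule.span ℝ (Set.range fun a => (β j a : V)) := by
        have := congrArg (Submodule.map (L j).subtype) (β j).span_eq
        rw [Submodule.map_span, Submodule.map_top, Submodule.range_subtype] at this
        refine this.symm.trans ?_
        rw [← Set.range_comp]
        rfl
      rw [this]
      apply Submodule.span_mono
      rintro _ ⟨a, rfl⟩
      refine ⟨σ ⟨j, a⟩, ?_, ?_⟩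
      · simpa using hj
      · simp [hB]
    · rw [Submodule.span_le]
      rintro _ ⟨j, hj, rfl⟩
      have : (B.reindex σ) j ∈ L (σ.symm j).1 := by
        rw [Module.Basis.reindex_apply, hB]
        exact (β _ _).2
      exact (le_iSup₂ (f := fun j (_ : j ≤ i) => L j) (σ.symm j).1 hj) this
  · intro r x
    have h := hβ (r + 1) r rfl (fun a => x (σ ⟨r + 1, a⟩))
    beta_reduce
    rw [sum_filter_sigma_fst, sum_filter_sigma_fst]
    simpa [hB] using h

end Graded

end SubRiem

namespace SubRiem

/-! ### The flag of the horizontal distribution -/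

section Flag

variable {E : Type*} [NormedAddCommGroup E] [NormedSpace ℝ E] [FiniteDimensional ℝ E]
  {G : Type*} [TopologicalSpace G] [ChartedSpace E G] [Group G] [LieGroup 𝓘(ℝ, E) ∞ G]

theorem IsSmoothField.mlieBracket {X Y : VField E G} (hX : IsSmoothField X)
    (hY : IsSmoothField Y) : IsSmoothField (VectorField.mlieBracket 𝓘(ℝ, E) X Y) := by
  have : IsManifold 𝓘(ℝ, E) (((⊤ : ℕ∞) : ℕ∞ω) + 1) G := inferInstanceAs (IsManifold _ ∞ G)
  intro g
  refine ContMDiffAt.mlieBracket_vectorField (m := ⊤) (n := ⊤) (hX g) (hY g) ?_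
  rw [minSmoothness_of_isRCLikeNormedField]
  rfl

/-- Each functional that vanishes on `W` vanishes along `x`, hence also on the derivative of `x`;
these functionals determine `W`. -/
theorem leftDeriv_mem {x : G → E} (hx : ContMDiff 𝓘(ℝ, E) 𝓘(ℝ, E) ∞ x) (W : Submodule ℝ E)
    (hW : ∀ g, x g ∈ W) (g : G) (v : E) : leftDeriv x g v ∈ W := by
  rw [← Subspace.forall_mem_dualAnnihilator_apply_eq_zero_iff W]
  intro f hf
  have h := leftDeriv_clm_comp (LinearMap.toContinuousLinearMap f) hx g v
  have h0 : (fun g => LinearMap.toContinuousLinearMap f (x g)) = fun _ => 0 := by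
    funext g
    exact (Submodule.mem_dualAnnihilator f).1 hf _ (hW g)
  rw [h0] at h
  have h1 : leftDeriv (E := E) (fun _ : G => (0 : ℝ)) g v = 0 := by
    have : mfderiv 𝓘(ℝ, E) 𝓘(ℝ, ℝ) (fun _ : G => (0 : ℝ)) g = 0 := mfderiv_const
    exact DFunLike.congr_fun this (transL g v)
  rw [h1] at h
  exact h.symm

/-- The smooth vector fields whose left trivialization has values in a subspace. -/
def sectionsOf (W : Submodule ℝ E) : Submodule ℝ (VField E G) where
  carrier := {X | ∃ x : G → E, ContMDiff 𝓘(ℝ, E) 𝓘(ℝ, E) ∞ x ∧ X = fieldOf x ∧ ∀ g, x g ∈ W}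
  add_mem' := by
    rintro _ _ ⟨x, hx, rfl, hxW⟩ ⟨y, hy, rfl, hyW⟩
    exact ⟨x + y, hx.add hy, (fieldOf_add x y).symm, fun g => W.add_mem (hxW g) (hyW g)⟩
  zero_mem' := ⟨fun _ => 0, contMDiff_const,
    funext fun g => (map_zero (transL (E := E) g)).symm, fun _ => W.zero_mem⟩
  smul_mem' := by
    rintro c _ ⟨x, hx, rfl, hxW⟩
    exact ⟨fun g => c • x g, contMDiff_clm_comp (c • ContinuousLinearMap.id ℝ E) hx,
      (fieldOf_smul (fun _ => c) x).symm, fun g => W.smul_mem c (hxW g)⟩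

namespace CarnotStructure

variable (C : CarnotStructure E G)

/-- The layers of the stratification, as subspaces of the model space. -/
def lay (i : ℕ) : Submodule ℝ E := C.layer i

theorem isInternal_lay : DirectSum.IsInternal C.lay := C.isInternal

theorem map₂_lay (j : ℕ) (hj : 1 ≤ j) :
    Submodule.map₂ (lieBr E G) (C.lay 1) (C.lay j) = C.lay (j + 1) := by
  rw [Submodule.map₂_eq_span_image2]
  refine Eq.trans ?_ (C.bracket j hj)
  congr 1

/-- The increasing filtration `𝔤₁ ⊕ ⋯ ⊕ 𝔤ᵢ`. -/
def filt (i : ℕ) : Submodule ℝ E := ⨆ j ≤ i, C.lay j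

theorem lay_le_filt {i j : ℕ} (h : j ≤ i) : C.lay j ≤ C.filt i :=
  le_iSup₂ (f := fun j (_ : j ≤ i) => C.lay j) j h

theorem filt_mono {i j : ℕ} (h : i ≤ j) : C.filt i ≤ C.filt j :=
  iSup₂_le fun _ hk => C.lay_le_filt (hk.trans h)

theorem lieBr_mem_lay {x y : E} {j : ℕ} (hj : 1 ≤ j) (hx : x ∈ C.lay 1) (hy : y ∈ C.lay j) :
    lieBr E G x y ∈ C.lay (j + 1) := by
  rw [← C.map₂_lay j hj]
  exact Submodule.apply_mem_map₂ _ hx hy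

theorem lieBr_mem_filt {x y : E} {i : ℕ} (hx : x ∈ C.lay 1) (hy : y ∈ C.filt i) :
    lieBr E G x y ∈ C.filt (i + 1) := by
  have h : C.filt i ≤ (C.filt (i + 1)).comap (lieBr E G x) := by
    refine iSup₂_le fun j hj z hz => ?_
    rcases Nat.eq_zero_or_pos j with rfl | h0
    · have hz0 : z = 0 := by
        have : z ∈ (⊥ : Submodule ℝ E) := (C.layer_zero : C.lay 0 = ⊥) ▸ hz
        simpa using this
      simp [hz0]
    · exact C.lay_le_filt (by omega) (C.lieBr_mem_lay h0 hx hz)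
  exact h hy

theorem lieBr_swap (x y : E) : lieBr E G x y = - lieBr E G y x :=
  (lie_skew (L := GroupLieAlgebra 𝓘(ℝ, E) G) x y).symm

/-- This turns equalities modulo lower order between elements of a layer into genuine equalities. -/
theorem disjoint_filt_lay (r : ℕ) {x : E} (h1 : x ∈ C.filt r) (h2 : x ∈ C.lay (r + 1)) : x = 0 := by
  have h := C.isInternal_lay.submodule_iSupIndep (r + 1)
  have h3 : C.filt r ≤ ⨆ j, ⨆ (_ : j ≠ r + 1), C.lay j :=
    iSup₂_le fun j hj => le_iSup₂ (f := fun j (_ : j ≠ r + 1) => C.lay j) j (by omega)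
  exact Submodule.disjoint_def.1 h x h2 (h3 h1)

theorem mem_dist_iff (q : G) (x : E) :
    transL (E := E) q x ∈ (C.horizontal.dist q : Submodule ℝ E) ↔ x ∈ C.lay 1 := by
  constructor
  · rintro ⟨y, hy, hxy⟩
    have : y = x := transL_injective (E := E) q hxy
    exact this ▸ hy
  · intro hx
    exact ⟨x, hx, rfl⟩

theorem isHorizontalField_iff (X : VField E G) :
    C.horizontal.IsHorizontalField X ↔ X ∈ sectionsOf (G := G) (C.lay 1) := by
  constructor
  · rintro ⟨h1, h2⟩
    obtain ⟨x, rfl⟩ := exists_eq_fieldOf X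
    exact ⟨x, (isSmoothField_fieldOf_iff x).1 h1, rfl, fun g => (C.mem_dist_iff g _).1 (h2 g)⟩
  · rintro ⟨x, hx, rfl, h⟩
    exact ⟨(isSmoothField_fieldOf_iff x).2 hx, fun g => (C.mem_dist_iff g _).2 (h g)⟩

/-- In the trivialized bracket, the two derivative terms stay in the filtration of the field that is
differentiated; only the algebraic bracket with a horizontal vector raises it, by one. -/
theorem flagFields_le (i : ℕ) : C.horizontal.flagFields i ≤ sectionsOf (G := G) (C.filt i) := by
  have mono : ∀ {W W' : Submodule ℝ E}, W ≤ W' → sectionsOf (G := G) W ≤ sectionsOf W' := by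
    rintro W W' h _ ⟨x, hx, rfl, hxW⟩
    exact ⟨x, hx, rfl, fun g => h (hxW g)⟩
  match i with
  | 0 => exact bot_le
  | 1 =>
    refine Submodule.span_le.2 fun X hX => ?_
    exact mono (C.lay_le_filt le_rfl) ((C.isHorizontalField_iff X).1 hX)
  | i + 2 =>
    refine sup_le ((flagFields_le (i + 1)).trans (mono (C.filt_mono (by omega)))) ?_
    refine Submodule.span_le.2 ?_
    rintro _ ⟨X, hX, Y, hY, rfl⟩
    obtain ⟨x, hx, rfl, hxW⟩ := flagFields_le (i + 1) hX
    obtain ⟨y, hy, rfl, hyW⟩ := (C.isHorizontalField_iff Y).1 hY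
    obtain ⟨z, hz⟩ := exists_eq_fieldOf (VectorField.mlieBracket 𝓘(ℝ, E) (fieldOf x) (fieldOf y))
    have hs := ((isSmoothField_fieldOf_iff x).2 hx).mlieBracket
      ((isSmoothField_fieldOf_iff y).2 hy)
    rw [hz] at hs
    refine ⟨z, (isSmoothField_fieldOf_iff z).1 hs, hz, fun g => ?_⟩
    have hg := mlieBracket_fieldOf x y hx hy g
    rw [hz] at hg
    rw [transL_injective (E := E) g hg]
    refine Submodule.sub_mem _ (Submodule.add_mem _ ?_ ?_) ?_
    · rw [lieBr_swap]
      exact Submodule.neg_mem _ (C.lieBr_mem_filt (hyW g) (hxW g))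
    · exact C.lay_le_filt (by omega) (leftDeriv_mem hy _ hyW g _)
    · exact C.filt_mono (by omega) (leftDeriv_mem hx _ hxW g _)

/-- The vectors whose left-invariant extensions are sections of the flag. -/
def invFlag (i : ℕ) : Submodule ℝ E where
  carrier := {v | fieldOf (fun _ : G => v) ∈ C.horizontal.flagFields i}
  add_mem' := by
    intro v w hv hw
    have := Submodule.add_mem _ hv hw
    rw [← fieldOf_add] at this
    exact this
  zero_mem' := by
    have h : fieldOf (fun _ : G => (0 : E)) = 0 := funext fun g => map_zero (transL (E := E) g)
    change fieldOf (fun _ : G => (0 : E)) ∈ C.horizontal.flagFields i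
    rw [h]
    exact Submodule.zero_mem _
  smul_mem' := by
    intro c v hv
    have h : fieldOf (fun _ : G => c • v) = c • fieldOf (fun _ : G => v) :=
      fieldOf_smul (fun _ => c) _
    change fieldOf (fun _ : G => c • v) ∈ C.horizontal.flagFields i
    rw [h]
    exact Submodule.smul_mem _ c hv

theorem flagFields_mono (i : ℕ) : C.horizontal.flagFields i ≤ C.horizontal.flagFields (i + 1) := by
  match i with
  | 0 => exact bot_le
  | i + 1 => exact le_sup_left

theorem invFlag_mono {i j : ℕ} (h : i ≤ j) : C.invFlag i ≤ C.invFlag j := by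
  induction j, h using Nat.le_induction with
  | base => exact le_rfl
  | succ j _ ih => exact ih.trans fun v hv => C.flagFields_mono j hv

/-- Left-invariant fields suffice to fill the flag: their brackets have no derivative terms, and the
first layer generates. The sign comes from the order of the arguments, as the flag brackets with the
horizontal field on the right. -/
theorem lay_le_invFlag (i : ℕ) : C.lay i ≤ C.invFlag i := by
  have horiz : ∀ x ∈ C.lay 1, C.horizontal.IsHorizontalField (fieldOf (fun _ : G => x)) :=
    fun x hx => (C.isHorizontalField_iff _).2 ⟨_, contMDiff_const, rfl, fun _ => hx⟩
  match i with
  | 0 => exact (le_of_eq (C.layer_zero : C.lay 0 = ⊥)).trans bot_le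
  | 1 => exact fun x hx => Submodule.subset_span (horiz x hx)
  | i + 2 =>
    rw [← C.map₂_lay (i + 1) (by omega), Submodule.map₂_le]
    intro x hx y hy
    rw [lieBr_swap]
    refine Submodule.neg_mem _ ?_
    have hy' : fieldOf (fun _ : G => y) ∈ C.horizontal.flagFields (i + 1) :=
      lay_le_invFlag (i + 1) hy
    have h : fieldOf (fun _ : G => lieBr E G y x) = VectorField.mlieBracket 𝓘(ℝ, E)
        (fieldOf (fun _ : G => y)) (fieldOf (fun _ : G => x)) :=
      funext fun g => (mlieBracket_const_const y x g).symm
    change fieldOf (fun _ : G => lieBr E G y x) ∈ C.horizontal.flagFields (i + 2)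
    rw [h]
    exact Submodule.mem_sup_right (Submodule.subset_span ⟨_, hy', _, horiz x hx, rfl⟩)

theorem filt_le_invFlag (i : ℕ) : C.filt i ≤ C.invFlag i :=
  iSup₂_le fun j hj => (C.lay_le_invFlag j).trans (C.invFlag_mono hj)

/-- The inclusion from left to right bounds arbitrary sections by `flagFields_le`; the other one
extends a vector to a left-invariant section. -/
theorem flag_eq (i : ℕ) (q : G) :
    C.horizontal.flag i q = (C.filt i).map (transL (E := E) q).toLinearMap := by
  apply le_antisymm
  · rintro _ ⟨X, hX, rfl⟩
    obtain ⟨x, _, rfl, hxW⟩ := C.flagFields_le i hX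
    exact ⟨x q, hxW q, rfl⟩
  · rintro _ ⟨v, hv, rfl⟩
    exact ⟨fieldOf (fun _ : G => v), C.filt_le_invFlag i hv, rfl⟩

theorem transL_mem_flag_iff (i : ℕ) (q : G) (v : E) :
    transL (E := E) q v ∈ (C.horizontal.flag i q : Submodule ℝ E) ↔ v ∈ C.filt i := by
  rw [C.flag_eq]
  constructor
  · rintro ⟨y, hy, hxy⟩
    have : y = v := transL_injective (E := E) q hxy
    exact this ▸ hy
  · intro hx
    exact ⟨v, hx, rfl⟩

/-- Modulo lower order terms, the nested bracket of horizontal fields is tensorial. -/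
theorem nestedBracket_fieldOf (r : ℕ) (v : Fin (r + 1) → G → E)
    (hv : ∀ j, ContMDiff 𝓘(ℝ, E) 𝓘(ℝ, E) ∞ (v j)) (hv1 : ∀ j g, v j g ∈ C.lay 1) :
    ∃ n : G → E, ContMDiff 𝓘(ℝ, E) 𝓘(ℝ, E) ∞ n ∧
      nestedBracket r (fun j => fieldOf (v j)) = fieldOf n ∧ (∀ g, n g ∈ C.filt (r + 1)) ∧
      ∀ g, n g - nestML (lieBr E G) r (fun j => v j g) ∈ C.filt r := by
  induction r with
  | zero =>
    refine ⟨v 0, hv 0, rfl, fun g => C.lay_le_filt le_rfl (hv1 0 g), fun g => ?_⟩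
    rw [nestML_zero, sub_self]
    exact Submodule.zero_mem _
  | succ r ih =>
    obtain ⟨n, hn, hN, hn1, hn2⟩ := ih (fun j => v j.succ) (fun j => hv _) (fun j => hv1 _)
    have hN' : nestedBracket (r + 1) (fun j => fieldOf (v j)) =
        VectorField.mlieBracket 𝓘(ℝ, E) (fieldOf (v 0)) (fieldOf n) := by
      rw [← hN]; rfl
    obtain ⟨z, hz⟩ := exists_eq_fieldOf
      (VectorField.mlieBracket 𝓘(ℝ, E) (fieldOf (v 0)) (fieldOf n))
    have hs := ((isSmoothField_fieldOf_iff (v 0)).2 (hv 0)).mlieBracket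
      ((isSmoothField_fieldOf_iff n).2 hn)
    rw [hz] at hs
    have hzg : ∀ g, z g = lieBr E G (v 0 g) (n g) + leftDeriv n g (v 0 g)
        - leftDeriv (v 0) g (n g) := by
      intro g
      have hg := mlieBracket_fieldOf (v 0) n (hv 0) hn g
      rw [hz] at hg
      exact transL_injective (E := E) g hg
    -- The derivative terms, where the choice of the extensions enters, remain one step below the
    -- new order `r + 2`, so they are negligible.
    have m1 : ∀ g, leftDeriv n g (v 0 g) ∈ C.filt (r + 1) := fun g => leftDeriv_mem hn _ hn1 g _
    have m2 : ∀ g, leftDeriv (v 0) g (n g) ∈ C.filt (r + 1) := fun g =>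
      C.lay_le_filt (by omega) (leftDeriv_mem (hv 0) _ (hv1 0) g _)
    refine ⟨z, (isSmoothField_fieldOf_iff z).1 hs, hN'.trans hz, fun g => ?_, fun g => ?_⟩
    · rw [hzg]
      exact Submodule.sub_mem _ (Submodule.add_mem _ (C.lieBr_mem_filt (hv1 0 g) (hn1 g))
        (C.filt_mono (by omega) (m1 g))) (C.filt_mono (by omega) (m2 g))
    · rw [hzg, nestML_succ]
      have : lieBr E G (v 0 g) (n g) + leftDeriv n g (v 0 g) - leftDeriv (v 0) g (n g)
          - lieBr E G (v 0 g) (nestML (lieBr E G) r (fun j => v j.succ g)) =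
          lieBr E G (v 0 g) (n g - nestML (lieBr E G) r (fun j => v j.succ g)) +
            leftDeriv n g (v 0 g) - leftDeriv (v 0) g (n g) := by
        rw [map_sub]; abel
      rw [this]
      exact Submodule.sub_mem _ (Submodule.add_mem _ (C.lieBr_mem_filt (hv1 0 g) (hn2 g)) (m1 g))
        (m2 g)

end CarnotStructure

end Flag

end SubRiem

namespace SubRiem

/-! ### Left-invariant Popp bases -/

section Popp

variable {E : Type*} [NormedAddCommGroup E] [NormedSpace ℝ E] [FiniteDimensional ℝ E]
  {G : Type*} [TopologicalSpace G] [ChartedSpace E G] [Group G] [LieGroup 𝓘(ℝ, E) ∞ G]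

namespace CarnotStructure

variable (C : CarnotStructure E G)

/-- The scalar product of elements of the model space that belong to the first layer. -/
def ip (x y : E) (hx : x ∈ C.lay 1) (hy : y ∈ C.lay 1) : ℝ := C.inner ⟨x, hx⟩ ⟨y, hy⟩

/-- An orthonormal basis of the first layer, as a family of vectors of the model space. -/
structure IsFrame {k : ℕ} (e : Fin k → E) : Prop where
  mem : ∀ a, e a ∈ C.lay 1
  ortho : ∀ a b, C.ip (e a) (e b) (mem a) (mem b) = if a = b then 1 else 0
  span : Submodule.span ℝ (Set.range e) = C.lay 1

theorem exists_isFrame :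
    ∃ e : Fin (Module.finrank ℝ (C.lay 1)) → E, C.IsFrame e := by
  classical
  suffices ∃ e : Fin (Module.finrank ℝ (C.layer 1)) → E, C.IsFrame e from this
  have hfd : FiniteDimensional ℝ (C.layer 1) :=
    inferInstanceAs (FiniteDimensional ℝ (C.lay 1))
  obtain ⟨v, hv⟩ := LinearMap.BilinForm.exists_orthogonal_basis (B := C.inner) ⟨C.symm⟩
  have hpos : ∀ i, 0 < C.inner (v i) (v i) := fun i => C.pos _ (v.ne_zero i)
  let s : Fin (Module.finrank ℝ (C.layer 1)) → ℝ := fun i => (Real.sqrt (C.inner (v i) (v i)))⁻¹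
  have hs : ∀ i, s i ≠ 0 := fun i => inv_ne_zero (Real.sqrt_pos.2 (hpos i)).ne'
  let e := v.isUnitSMul (fun i => (hs i).isUnit)
  have he : ∀ i, e i = s i • v i := fun i => Module.Basis.isUnitSMul_apply _ i
  refine ⟨fun i => (e i : C.layer 1).1, fun i => (e i).2, fun i j => ?_, ?_⟩
  · change C.inner (e i) (e j) = _
    rw [he, he]
    simp only [map_smul, LinearMap.smul_apply, smul_eq_mul]
    split_ifs with h
    · subst h
      have := Real.mul_self_sqrt (hpos i).le
      have h2 := (Real.sqrt_pos.2 (hpos i)).ne'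
      simp only [s]
      field_simp
      rw [sq]; exact this.symm
    · rw [hv h]; simp
  · have := congrArg (Submodule.map (C.layer 1).subtype) e.span_eq
    rw [Submodule.map_span, Submodule.map_top, Submodule.range_subtype] at this
    refine Eq.trans ?_ this
    rw [← Set.range_comp]
    rfl

theorem inner_transL (q : G) {x y : E} (hx : x ∈ C.lay 1) (hy : y ∈ C.lay 1)
    (hx' : transL (E := E) q x ∈ (C.horizontal.dist q : Submodule ℝ E))
    (hy' : transL (E := E) q y ∈ (C.horizontal.dist q : Submodule ℝ E)) :
    C.horizontal.inner q ⟨transL (E := E) q x, hx'⟩ ⟨transL (E := E) q y, hy'⟩ =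
      C.ip x y hx hy := by
  have key : ∀ {x : E} (hx : x ∈ C.lay 1)
      (hx' : transL (E := E) q x ∈ (C.horizontal.dist q : Submodule ℝ E)),
      (Submodule.equivMapOfInjective _ (leftTranslate_injective (E := E) q) (C.layer 1)).symm
        ⟨transL (E := E) q x, hx'⟩ = ⟨x, hx⟩ := by
    intro x hx hx'
    rw [LinearEquiv.symm_apply_eq]
    rfl
  exact congrArg₂ (fun u v => C.inner u v) (key hx hx') (key hy hy')

variable {C}

namespace IsFrame

variable {k : ℕ} {e : Fin k → E} (he : C.IsFrame e)
include he

theorem exists_coeff {x : E} (hx : x ∈ C.lay 1) : ∃ c : Fin k → ℝ, x = ∑ a, c a • e a := by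
  rw [← he.span, Submodule.mem_span_range_iff_exists_fun] at hx
  obtain ⟨c, hc⟩ := hx
  exact ⟨c, hc.symm⟩

/-- Membership in the layer is an explicit argument because `ip` lives on the model space; the sums
must be lifted to the subtype before bilinearity can be used. -/
theorem ip_sum (c d : Fin k → ℝ) (hx : ∑ a, c a • e a ∈ C.lay 1) (hy : ∑ a, d a • e a ∈ C.lay 1) :
    C.ip _ _ hx hy = ∑ a, c a * d a := by
  let f : Fin k → C.layer 1 := fun a => ⟨e a, he.mem a⟩
  have h1 : ∀ c : Fin k → ℝ, ∀ hx : ∑ a, c a • e a ∈ C.lay 1,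
      (⟨∑ a, c a • e a, hx⟩ : C.layer 1) = ∑ a, c a • f a := by
    intro c hx
    apply Subtype.ext
    refine Eq.trans ?_ (map_sum (C.layer 1).subtype _ _).symm
    rfl
  have h2 : ∀ a b, C.inner (f a) (f b) = if a = b then 1 else 0 := he.ortho
  refine (congrArg₂ (fun u v => C.inner u v) (h1 c hx) (h1 d hy)).trans ?_
  simp [h2, mul_comm]

theorem linearIndependent : LinearIndependent ℝ e := by
  rw [Fintype.linearIndependent_iff]
  intro c hc i
  have hx : ∑ a, c a • e a ∈ C.lay 1 := by rw [hc]; exact Submodule.zero_mem _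
  have h := he.ip_sum c c hx hx
  have h0 : C.ip _ _ hx hx = 0 := by
    have : (⟨∑ a, c a • e a, hx⟩ : C.layer 1) = 0 := Subtype.ext hc
    refine (congrArg₂ (fun u v => C.inner u v) this this).trans ?_
    simp
  rw [h0] at h
  have := (Finset.sum_eq_zero_iff_of_nonneg (fun a _ => mul_self_nonneg (c a))).1 h.symm i
    (Finset.mem_univ i)
  exact mul_self_eq_zero.1 this

theorem finrank_eq : Module.finrank ℝ (C.lay 1) = k := by
  rw [← he.span, finrank_span_eq_card he.linearIndependent, Fintype.card_fin]

theorem rank_eq (q : G) : C.horizontal.rank q = k := by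
  rw [← he.finrank_eq]
  exact (Submodule.equivMapOfInjective _ (leftTranslate_injective (E := E) q)
    (C.layer 1)).finrank_eq.symm

theorem isHorizontalField (a : Fin k) :
    C.horizontal.IsHorizontalField (fieldOf (fun _ : G => e a)) :=
  (C.isHorizontalField_iff _).2 ⟨_, contMDiff_const, rfl, fun _ => he.mem a⟩

theorem nestSum_mem (r : ℕ) (c : (Fin (r + 1) → Fin k) → ℝ) :
    nestSum (lieBr E G) e r c ∈ C.lay (r + 1) := by
  rw [← range_nestSum (lieBr E G) e C.lay he.span C.map₂_lay r]
  exact ⟨c, rfl⟩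

/-- The norm of the graded space is purely algebraic and does not depend on `q`. Brackets of
horizontal fields are tensorial modulo lower order (`nestedBracket_fieldOf`), and the norm of a
tensor is unchanged when the orthonormal frame at `q` is replaced by `e`. -/
theorem tensorNormSq_transL (q : G) (r : ℕ) (v : E) (hv : v ∈ C.lay (r + 1)) :
    C.horizontal.tensorNormSq q r (transL (E := E) q v) =
      {s : ℝ | ∃ c, nestSum (lieBr E G) e r c = v ∧ s = ∑ a, c a ^ 2} := by
  obtain rfl : k = C.horizontal.rank q := (he.rank_eq q).symm
  ext s
  constructor
  · rintro ⟨B, hB, c, hortho, hc, rfl⟩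
    have hB' := fun a => (C.isHorizontalField_iff (B a)).1 (hB a)
    choose β hβ hBβ hβ1 using hB'
    obtain rfl : B = fun a => fieldOf (β a) := funext hBβ
    have hO : ∀ a, ∃ c : Fin (C.horizontal.rank q) → ℝ, β a q = ∑ s, c s • e s :=
      fun a => he.exists_coeff (hβ1 a q)
    choose O hO using hO
    have horth : ∀ a b, ∑ s, O a s * O b s = if a = b then 1 else 0 := by
      intro a b
      rw [← hortho a b]
      have h1 : C.ip (β a q) (β b q) (hβ1 a q) (hβ1 b q) = ∑ s, O a s * O b s := by
        have := he.ip_sum (O a) (O b) ((hO a) ▸ hβ1 a q) ((hO b) ▸ hβ1 b q)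
        rw [← this]
        congr 1
        exacts [hO a, hO b]
      rw [← h1]
      exact (C.inner_transL q _ _ _ _).symm
    obtain ⟨c', hc', hcc⟩ := exists_nestSum_eq_of_orthogonal (lieBr E G) e (fun a => β a q)
      (fun s a => O a s) hO horth r c
    refine ⟨c', ?_, hcc.symm⟩
    rw [hc']
    have h2 : ∀ a : Fin (r + 1) → Fin (C.horizontal.rank q), ∃ m : E,
        nestedBracket r (fun j => fieldOf (β (a j))) q = transL (E := E) q m ∧
          m - nestML (lieBr E G) r (fun j => β (a j) q) ∈ C.filt r := by
      intro a
      obtain ⟨n, _, hn, _, hn2⟩ := C.nestedBracket_fieldOf r (fun j => β (a j))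
        (fun j => hβ _) (fun j => hβ1 _)
      exact ⟨n q, congrFun hn q, hn2 q⟩
    choose m hm hm2 using h2
    have h3 : transL (E := E) q ((∑ a, c a • m a) - v) ∈
        (C.horizontal.flag r q : Submodule ℝ E) := by
      have : transL (E := E) q ((∑ a, c a • m a) - v) =
          (∑ a, c a • transL (E := E) q (m a)) - transL (E := E) q v := by
        simp
      rw [this]
      refine Eq.mp ?_ hc
      congr 2
      exact Finset.sum_congr rfl fun a _ => congrArg (fun z : E => c a • z) (hm a)
    rw [C.transL_mem_flag_iff] at h3
    have h4 : (∑ a, c a • m a) - nestSum (lieBr E G) (fun a => β a q) r c ∈ C.filt r := by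
      rw [nestSum_apply, ← Finset.sum_sub_distrib]
      refine Submodule.sum_mem _ fun a _ => ?_
      rw [← smul_sub]
      exact Submodule.smul_mem _ _ (hm2 a)
    -- The difference is of lower order and also belongs to the layer `r + 1`. Hence it is zero: on
    -- a stratified algebra a class modulo lower order has a unique representative in the layer.
    have h5 : nestSum (lieBr E G) (fun a => β a q) r c - v ∈ C.filt r := by
      have := Submodule.sub_mem _ h3 h4
      rwa [sub_sub_sub_cancel_left] at this
    have h6 : nestSum (lieBr E G) (fun a => β a q) r c - v ∈ C.lay (r + 1) := by
      rw [← hc']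
      exact Submodule.sub_mem _ (he.nestSum_mem r c') hv
    exact sub_eq_zero.1 (C.disjoint_filt_lay r h5 h6)
  · rintro ⟨c, hc, rfl⟩
    refine ⟨fun a => fieldOf (fun _ => e a), he.isHorizontalField, c, ?_, ?_, rfl⟩
    · intro a b
      rw [← he.ortho a b]
      exact C.inner_transL q _ _ _ _
    · have h2 : ∀ a : Fin (r + 1) → Fin (C.horizontal.rank q), ∃ m : E,
          nestedBracket r (fun j => fieldOf (fun _ : G => e (a j))) q = transL (E := E) q m ∧
            m - nestML (lieBr E G) r (fun j => e (a j)) ∈ C.filt r := by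
        intro a
        obtain ⟨n, _, hn, _, hn2⟩ := C.nestedBracket_fieldOf r (fun j _ => e (a j))
          (fun j => contMDiff_const) (fun j _ => he.mem _)
        exact ⟨n q, congrFun hn q, hn2 q⟩
      choose m hm hm2 using h2
      have h4 : (∑ a, c a • m a) - v ∈ C.filt r := by
        rw [← hc, nestSum_apply, ← Finset.sum_sub_distrib]
        refine Submodule.sum_mem _ fun a _ => ?_
        rw [← smul_sub]
        exact Submodule.smul_mem _ _ (hm2 a)
      rw [← C.transL_mem_flag_iff r q] at h4
      have : transL (E := E) q ((∑ a, c a • m a) - v) =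
          (∑ a, c a • transL (E := E) q (m a)) - transL (E := E) q v := by
        simp
      rw [this] at h4
      refine Eq.mp ?_ h4
      congr 2
      exact Finset.sum_congr rfl fun a _ => congrArg (fun z : E => c a • z) (hm a).symm

end IsFrame

variable (C)

/-- The left translates of a suitable basis of the Lie algebra are Popp bases. -/
theorem exists_isPoppBasis :
    ∃ (b : Module.Basis (Fin (Module.finrank ℝ E)) ℝ E) (w : Fin (Module.finrank ℝ E) → ℕ),
      ∀ q : G, C.horizontal.IsPoppBasis q
        (show Module.Basis (Fin (Module.finrank ℝ E)) ℝ (TangentSpace 𝓘(ℝ, E) q) from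
          b.map (transLE q).toLinearEquiv) w := by
  obtain ⟨e, he⟩ := C.exists_isFrame
  obtain ⟨b, w, h1, h2⟩ := exists_graded_basis (lieBr E G) e C.lay C.isInternal_lay he.span
    C.map₂_lay
  refine ⟨b, w, fun q => ⟨fun i => ?_, fun r x => ?_⟩⟩
  · rw [C.flag_eq]
    refine (congrArg (Submodule.map (transL (E := E) q).toLinearMap) (h1 i)).trans ?_
    rw [Submodule.map_span, ← Set.image_comp]
    rfl
  · have h := h2 r x
    have hv : ∑ j with w j = r + 1, x j • b j ∈ C.lay (r + 1) := by
      obtain ⟨c, hc, _⟩ := h.1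
      rw [← hc]
      exact he.nestSum_mem r c
    rw [← he.tensorNormSq_transL q r _ hv] at h
    refine Eq.mp ?_ h
    congr 2
    refine (map_sum (transL (E := E) q) _ _).trans ?_
    refine Finset.sum_congr rfl fun j _ => ?_
    exact map_smul (transL (E := E) q) (x j) (b j)

end CarnotStructure

end Popp

end SubRiem

namespace SubRiem

/-! ### Traces, the invariance of Popp's volume, and the macroscopic Laplacian -/

section TraceAlternating

variable {V : Type*} [AddCommGroup V] [Module ℝ V] {ι : Type*} [Fintype ι] [DecidableEq ι]

/-- The derivation of the exterior algebra induced by an endomorphism, on alternating forms. -/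
def altDerivation (f : V [⋀^ι]→ₗ[ℝ] ℝ) (A : V →ₗ[ℝ] V) : V [⋀^ι]→ₗ[ℝ] ℝ :=
  { ∑ i, f.toMultilinearMap.compLinearMap (Function.update (fun _ => LinearMap.id) i A) with
    map_eq_zero_of_eq' := by
      intro v i j hv hij
      have key : ∀ k, (fun l => (Function.update (fun _ => LinearMap.id) k A : ι → V →ₗ[ℝ] V) l (v l))
          = Function.update v k (A (v k)) := by
        intro k
        funext l
        by_cases h : l = k
        · subst h; simp
        · simp [h]
      simp only [AlternatingMap.coe_multilinearMap, MultilinearMap.toFun_eq_coe,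
        _root_.sum_apply, MultilinearMap.compLinearMap_apply, key]
      -- A change in a slot other than `i` and `j` leaves two equal arguments. The changes in the
      -- slots `i` and `j` differ by the transposition of these slots, so their contributions
      -- cancel.
      have h0 : ∀ k, k ≠ i → k ≠ j → f (Function.update v k (A (v k))) = 0 := by
        intro k hi hj
        refine f.map_eq_zero_of_eq _ ?_ hij
        rw [Function.update_of_ne hi.symm, Function.update_of_ne hj.symm, hv]
      rw [← Finset.sum_subset (Finset.subset_univ {i, j})]
      · rw [Finset.sum_pair hij]
        have h1 : Function.update v j (A (v j)) =
            (Function.update v i (A (v i))) ∘ Equiv.swap i j := by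
          funext l
          by_cases hli : l = i
          · subst hli
            simp [Function.update_of_ne hij, Function.update_of_ne hij.symm, hv]
          · by_cases hlj : l = j
            · subst hlj
              simp [hv]
            · simp [Function.update_of_ne hli, Function.update_of_ne hlj,
                Equiv.swap_apply_of_ne_of_ne hli hlj]
        have h2 : f (Function.update v j (A (v j))) = - f (Function.update v i (A (v i))) := by
          rw [h1, f.map_swap _ hij]
        exact (congrArg (f (Function.update v i (A (v i))) + ·) h2).trans (add_neg_cancel _)
      · intro k _ hk
        simp only [Finset.mem_insert, Finset.mem_singleton, not_or] at hk
        exact h0 k hk.1 hk.2 }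

theorem altDerivation_apply (f : V [⋀^ι]→ₗ[ℝ] ℝ) (A : V →ₗ[ℝ] V) (v : ι → V) :
    altDerivation f A v = ∑ i, f (Function.update v i (A (v i))) := by
  have key : ∀ k, (fun l => (Function.update (fun _ => LinearMap.id) k A : ι → V →ₗ[ℝ] V) l (v l))
      = Function.update v k (A (v k)) := by
    intro k
    funext l
    by_cases h : l = k
    · subst h; simp
    · simp [h]
  change (∑ i, f.toMultilinearMap.compLinearMap
    (Function.update (fun _ => LinearMap.id) i A) : MultilinearMap ℝ (fun _ : ι => V) ℝ) v = _
  simp only [_root_.sum_apply, MultilinearMap.compLinearMap_apply, key]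
  rfl

/-- The derivation induced by an endomorphism acts on forms of top degree by its trace. -/
theorem sum_update_eq_trace (f : V [⋀^ι]→ₗ[ℝ] ℝ) (b : Module.Basis ι ℝ V)
    (A : V →ₗ[ℝ] V) (v : ι → V) :
    ∑ i, f (Function.update v i (A (v i))) = LinearMap.trace ℝ V A * f v := by
  rw [← altDerivation_apply]
  -- Top-degree forms are determined by their value on the basis `b`; there, replacing `b i` by `A
  -- (b i)` retains only the diagonal coefficient of `A`.
  have : altDerivation f A = LinearMap.trace ℝ V A • f := by
    rw [AlternatingMap.eq_smul_basis_det b (altDerivation f A),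
      AlternatingMap.eq_smul_basis_det b (LinearMap.trace ℝ V A • f)]
    congr 1
    rw [altDerivation_apply, AlternatingMap.smul_apply,
      LinearMap.trace_eq_matrix_trace ℝ b, Matrix.trace, smul_eq_mul, Finset.sum_mul]
    refine Finset.sum_congr rfl fun i _ => ?_
    rw [Matrix.diag_apply, LinearMap.toMatrix_apply]
    conv_lhs => rw [← b.sum_repr (A (b i))]
    rw [f.map_update_sum]
    rw [Finset.sum_eq_single i]
    · rw [f.map_update_smul, Function.update_eq_self, smul_eq_mul]
    · intro j _ hj
      rw [f.map_update_smul, f.map_update_self b hj.symm, smul_zero]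
    · simp
  rw [this, AlternatingMap.smul_apply, smul_eq_mul]

end TraceAlternating

section Macro

variable {E : Type*} [NormedAddCommGroup E] [NormedSpace ℝ E] [FiniteDimensional ℝ E]
  {G : Type*} [TopologicalSpace G] [ChartedSpace E G] [Group G] [LieGroup 𝓘(ℝ, E) ∞ G]

theorem continuous_multilinear {ι : Type*} [Fintype ι]
    (f : MultilinearMap ℝ (fun _ : ι => E) ℝ) : Continuous f := by
  classical
  let b := Module.finBasis ℝ E
  have h : ∀ v : ι → E, f v = ∑ a : ι → Fin (Module.finrank ℝ E),
      (∏ i, b.coord (a i) (v i)) • f (fun i => b (a i)) := by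
    intro v
    conv_lhs => rw [show v = fun i => ∑ j, b.coord j (v i) • b j from
      funext fun i => (b.sum_repr (v i)).symm]
    rw [f.map_sum]
    simp only [f.map_smul_univ]
  have : (f : (ι → E) → ℝ) = fun v => ∑ a : ι → Fin (Module.finrank ℝ E),
      (∏ i, b.coord (a i) (v i)) • f (fun i => b (a i)) := funext h
  rw [this]
  refine continuous_finsetSum _ fun a _ => ?_
  refine Continuous.mul (M := ℝ) ?_ continuous_const
  refine continuous_finsetProd Finset.univ fun i _ => ?_
  exact (LinearMap.toContinuousLinearMap (b.coord (a i))).continuous.comp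
    (continuous_apply (A := fun _ : ι => E) i)

/-- The product rule, needed because an invariant form evaluated on vector fields is a constant
multilinear map of their trivializations. -/
theorem leftDeriv_multilinear {ι : Type*} [Fintype ι] [DecidableEq ι]
    (f : MultilinearMap ℝ (fun _ : ι => E) ℝ) (y : ι → G → E)
    (hy : ∀ i, ContMDiff 𝓘(ℝ, E) 𝓘(ℝ, E) ∞ (y i)) (g : G) (v : E) :
    leftDeriv (E := E) (fun g => f (fun i => y i g)) g v =
      ∑ i, f (Function.update (fun j => y j g) i (leftDeriv (y i) g v)) := by
  let F : ContinuousMultilinearMap ℝ (fun _ : ι => E) ℝ := ⟨f, continuous_multilinear f⟩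
  let Y : G → ι → E := fun g i => y i g
  have hY : ContMDiff 𝓘(ℝ, E) 𝓘(ℝ, ι → E) ∞ Y := contMDiff_pi_space.2 hy
  have h := (hY.mdifferentiableAt (by simp) (x := g)).hasMFDerivAt
  have h2 := (F.hasFDerivAt (x := Y g)).hasMFDerivAt
  have h3 := (h2.comp g h).mfderiv
  have h4 : leftDeriv (E := E) (fun g => f (fun i => y i g)) g v =
      F.linearDeriv (Y g) (leftDeriv Y g v) := DFunLike.congr_fun h3 (transL g v)
  rw [h4, ContinuousMultilinearMap.linearDeriv_apply]
  refine Finset.sum_congr rfl fun i _ => ?_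
  have h5 := leftDeriv_clm_comp (ContinuousLinearMap.proj (R := ℝ) (φ := fun _ : ι => E) i) hY g v
  have h6 : leftDeriv Y g v i = leftDeriv (y i) g v := h5.symm
  rw [h6]
  rfl

namespace CarnotStructure

variable (C : CarnotStructure E G)

/-- `ad x` sends each layer to the next, so its diagonal blocks vanish. This is what makes
left-invariant horizontal fields divergence-free. -/
theorem trace_lieBr {x : E} (hx : x ∈ C.lay 1) : LinearMap.trace ℝ E (lieBr E G x) = 0 := by
  refine LinearMap.trace_eq_zero_of_mapsTo_ne C.isInternal_lay (fun i => i + 1) (by simp) ?_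
  intro i y hy
  rcases Nat.eq_zero_or_pos i with rfl | h
  · have hy0 : y = 0 := by
      have : y ∈ (⊥ : Submodule ℝ E) := (C.layer_zero : C.lay 0 = ⊥) ▸ hy
      simpa using this
    rw [hy0, map_zero]
    exact Submodule.zero_mem _
  · exact C.lieBr_mem_lay h hx hy

/-- Popp's volume is left-invariant. -/
theorem IsPoppVolume.exists_form [PreconnectedSpace G] {P : TopForm E G}
    (hP : C.horizontal.IsPoppVolume P) :
    ∃ η : E [⋀^Fin (Module.finrank ℝ E)]→ₗ[ℝ] ℝ, ∀ (q : G) (v : Fin (Module.finrank ℝ E) → E),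
      P q (fun i => transL (E := E) q (v i)) = η v := by
  obtain ⟨b, w, hb⟩ := C.exists_isPoppBasis
  let Ω : G → E [⋀^Fin (Module.finrank ℝ E)]→ₗ[ℝ] ℝ := fun q =>
    AlternatingMap.compLinearMap (M := E) (M₂ := E) (P q) (transL (E := E) q).toLinearMap
  have hcont : Continuous fun q => Ω q b := by
    have := hP.1 (fun i => fieldOf (fun _ : G => b i))
      (fun i => (isSmoothField_fieldOf_iff _).2 contMDiff_const)
    exact this.continuous
  have habs : ∀ q, |Ω q b| = 1 := fun q => hP.2 q _ w (hb q)
  -- A continuous function with square 1 on a connected space is constant.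
  have hconst : ∀ q, Ω q b = Ω 1 b := by
    have hsq : ∀ q, Ω q b ^ 2 = 1 := fun q => by rw [← sq_abs, habs, one_pow]
    rcases isPreconnected_univ.eq_or_eq_neg_of_sq_eq (f := fun q => Ω q b) (g := fun _ => (1 : ℝ))
      hcont.continuousOn continuousOn_const (fun q _ => by simpa using hsq q)
      (fun _ => one_ne_zero) with h | h
    · intro q
      exact (h (mem_univ q)).trans (h (mem_univ 1)).symm
    · intro q
      exact (h (mem_univ q)).trans (h (mem_univ 1)).symm
  refine ⟨Ω 1, fun q v => ?_⟩
  have h : Ω q = Ω 1 := by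
    rw [AlternatingMap.eq_smul_basis_det b (Ω q), AlternatingMap.eq_smul_basis_det b (Ω 1), hconst]
  rw [← h]
  rfl

variable {C}

namespace IsFrame

variable {k : ℕ} {e : Fin k → E} (he : C.IsFrame e)
include he

theorem sharp_eq (q : G) (lam : Covec E) :
    ((C.horizontal.sharp q lam : TangentSpace 𝓘(ℝ, E) q) : E) =
      transL (E := E) q (∑ a, lam (transL (E := E) q (e a)) • e a) := by
  set u : E := ∑ a, lam (transL (E := E) q (e a)) • e a with hu
  have hu1 : u ∈ C.lay 1 := Submodule.sum_mem _ fun a _ => Submodule.smul_mem _ _ (he.mem a)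
  have hu' : transL (E := E) q u ∈ (C.horizontal.dist q : Submodule ℝ E) :=
    (C.mem_dist_iff q u).2 hu1
  suffices h : C.horizontal.sharp q lam = ⟨transL (E := E) q u, hu'⟩ from congrArg Subtype.val h
  rw [HorizontalStructure.sharp, LinearEquiv.symm_apply_eq]
  ext ⟨v, hv⟩
  rw [LinearMap.BilinForm.toDual_def]
  obtain ⟨x, hx, rfl⟩ := hv
  obtain ⟨c, hc⟩ := he.exists_coeff (x := x) hx
  have h1 : C.horizontal.inner q ⟨transL (E := E) q u, hu'⟩ ⟨transL (E := E) q x, ⟨x, hx, rfl⟩⟩ =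
      C.ip u x hu1 hx := C.inner_transL q _ _ _ _
  refine Eq.trans ?_ h1.symm
  have h2 : C.ip u x hu1 hx = ∑ a, lam (transL (E := E) q (e a)) * c a := by
    have := he.ip_sum (fun a => lam (transL (E := E) q (e a))) c hu1 (hc ▸ hx)
    rw [← this]
    congr 1
  rw [h2]
  change lam (transL (E := E) q x) = _
  rw [hc]
  simp [mul_comm]

theorem hamiltonian_eq (q : G) (lam : Covec E) :
    C.horizontal.hamiltonian q lam = 1 / 2 * ∑ a, (lam (transL (E := E) q (e a))) ^ 2 := by
  unfold HorizontalStructure.hamiltonian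
  congr 1
  change lam (C.horizontal.sharp q lam : TangentSpace 𝓘(ℝ, E) q) = _
  refine (congrArg lam (he.sharp_eq q lam)).trans ?_
  simp [sq]

theorem grad_eq (φ : G → ℝ) : C.horizontal.grad φ =
    fieldOf (fun g => ∑ a, leftDeriv (E := E) φ g (e a) • e a) :=
  funext fun q => he.sharp_eq q (dAt φ q)

/-- The macroscopic Laplacian is the sum of the squares of an orthonormal frame. -/
theorem isMacroLaplacianAt [PreconnectedSpace G] {P : TopForm E G}
    (hP : C.horizontal.IsPoppVolume P) {φ : G → ℝ} (hφ : ContMDiff 𝓘(ℝ, E) 𝓘(ℝ, ℝ) ∞ φ) (q : G) :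
    C.horizontal.IsMacroLaplacianAt P φ q
      (∑ a, leftDeriv (E := E) (fun g => leftDeriv (E := E) φ g (e a)) q (e a)) := by
  obtain ⟨η, hη⟩ := IsPoppVolume.exists_form C hP
  intro Y hY
  set x : G → E := fun g => ∑ a, leftDeriv (E := E) φ g (e a) • e a with hx_def
  have hf : ∀ a, ContMDiff 𝓘(ℝ, E) 𝓘(ℝ, ℝ) ∞ (fun g => leftDeriv (E := E) φ g (e a)) :=
    fun a => contMDiff_leftDeriv hφ (e a)
  have hx : ContMDiff 𝓘(ℝ, E) 𝓘(ℝ, E) ∞ x := by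
    refine contMDiff_finsetSum fun a _ => ?_
    exact contMDiff_clm_comp ((ContinuousLinearMap.id ℝ ℝ).smulRight (e a)) (hf a)
  have hx1 : x q ∈ C.lay 1 := Submodule.sum_mem _ fun a _ => Submodule.smul_mem _ _ (he.mem a)
  have hdx : ∀ v : E, leftDeriv x q v =
      ∑ a, leftDeriv (E := E) (fun g => leftDeriv (E := E) φ g (e a)) q v • e a := by
    intro v
    let y : Fin k → G → ℝ := fun a g => leftDeriv (E := E) φ g (e a)
    let Y : G → Fin k → ℝ := fun g a => y a g
    have hYs : ContMDiff 𝓘(ℝ, E) 𝓘(ℝ, Fin k → ℝ) ∞ Y := contMDiff_pi_space.2 hf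
    let T : (Fin k → ℝ) →L[ℝ] E := LinearMap.toContinuousLinearMap (Fintype.linearCombination ℝ e)
    have h1 := leftDeriv_clm_comp T hYs q v
    have h2 : ∀ c, T c = ∑ a, c a • e a := fun c => Fintype.linearCombination_apply ℝ e c
    simp only [h2] at h1
    refine h1.trans (Finset.sum_congr rfl fun a _ => ?_)
    have h5 := leftDeriv_clm_comp (ContinuousLinearMap.proj (R := ℝ) (φ := fun _ : Fin k => ℝ) a)
      hYs q v
    exact congrArg (· • e a) h5.symm
  rw [he.grad_eq φ]
  have hYy := fun i => exists_eq_fieldOf (Y i)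
  choose y hy using hYy
  obtain rfl : Y = fun i => fieldOf (y i) := funext hy
  have hys : ∀ i, ContMDiff 𝓘(ℝ, E) 𝓘(ℝ, E) ∞ (y i) := fun i =>
    (isSmoothField_fieldOf_iff (y i)).1 (hY i)
  -- In `ℒ_X P` the derivatives of the `y i` along `x` cancel between the two terms of the
  -- definition. What remains is the sum over the slots of `η` with `A` applied, that is, `tr A`
  -- times the form.
  let A : E →ₗ[ℝ] E := (leftDeriv x q).toLinearMap - lieBr E G (x q)
  have htr : LinearMap.trace ℝ E A =
      ∑ a, leftDeriv (E := E) (fun g => leftDeriv (E := E) φ g (e a)) q (e a) := by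
    rw [map_sub, C.trace_lieBr hx1, sub_zero]
    -- The derivative of the gradient is a sum of operators of rank one, and the trace of the one
    -- with functional `f` and vector `e a` is `f (e a)`.
    have : (leftDeriv x q).toLinearMap = ∑ a, LinearMap.smulRight
        (leftDeriv (E := E) (fun g => leftDeriv (E := E) φ g (e a)) q).toLinearMap (e a) := by
      ext v
      rw [LinearMap.sum_apply]
      exact hdx v
    rw [this, map_sum]
    refine Finset.sum_congr rfl fun a _ => ?_
    rw [LinearMap.trace_smulRight]
    rfl
  have h1 : dAt (E := E) (fun p => P p (fun i => fieldOf (y i) p)) q (fieldOf x q) =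
      ∑ i, η (Function.update (fun j => y j q) i (leftDeriv (y i) q (x q))) := by
    have : (fun p => P p (fun i => fieldOf (y i) p)) = fun p => η (fun i => y i p) :=
      funext fun p => hη p (fun i => y i p)
    rw [this]
    exact leftDeriv_multilinear η.toMultilinearMap y hys q (x q)
  have h2 : ∀ i, P q (Function.update (fun j => fieldOf (y j) q) i
      (VectorField.mlieBracket 𝓘(ℝ, E) (fieldOf x) (fieldOf (y i)) q)) =
      η (Function.update (fun j => y j q) i (leftDeriv (y i) q (x q))) -
        η (Function.update (fun j => y j q) i (A (y i q))) := by
    intro i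
    rw [← η.map_update_sub, ← hη q]
    refine congrArg (P q) ?_
    funext j
    by_cases hj : j = i
    · subst hj
      simp only [Function.update_self]
      refine (mlieBracket_fieldOf x (y j) hx (hys j) q).trans ?_
      refine congrArg (transL (E := E) q) ?_
      simp only [A, LinearMap.sub_apply]
      change _ = _ - (leftDeriv x q (y j q) - _)
      abel
    · rw [Function.update_of_ne hj, Function.update_of_ne hj]
      rfl
  have h3 : P q (fun i => fieldOf (y i) q) = η (fun i => y i q) := hη q (fun i => y i q)
  unfold lieDerivForm
  rw [h1, h3, ← htr, ← sum_update_eq_trace η (Module.finBasis ℝ E) A]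
  refine (congrArg (_ - ·) (Finset.sum_congr rfl fun i _ => h2 i)).trans ?_
  rw [Finset.sum_sub_distrib, sub_sub_cancel]

end IsFrame

end CarnotStructure

end Macro

end SubRiem

namespace SubRiem

/-! ### Left-invariant fields in a chart -/

section ChartFrame

variable {E : Type*} [NormedAddCommGroup E] [NormedSpace ℝ E] [FiniteDimensional ℝ E]
  {G : Type*} [TopologicalSpace G] [ChartedSpace E G] [Group G] [LieGroup 𝓘(ℝ, E) ∞ G]

/-- The left-invariant fields, in the chart at `x₀`. -/
def chartFrame (x₀ : G) (x : E) : E →L[ℝ] E :=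
  ContinuousLinearMap.comp (M₁ := E) (M₂ := E) (M₃ := E)
    (mfderiv 𝓘(ℝ, E) 𝓘(ℝ, E) (extChartAt 𝓘(ℝ, E) x₀) ((extChartAt 𝓘(ℝ, E) x₀).symm x))
    (transL (E := E) ((extChartAt 𝓘(ℝ, E) x₀).symm x))

theorem isOpen_chart_target (x₀ : G) : IsOpen (extChartAt 𝓘(ℝ, E) x₀).target :=
  isOpen_extChartAt_target x₀

/-- On its domain, the derivative of the chart is the trivialization of the tangent bundle at `x₀`,
so the smoothness of left-invariant fields can be read in it. -/
theorem contDiffOn_chartFrame (x₀ : G) :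
    ContDiffOn ℝ ∞ (chartFrame (E := E) x₀) (extChartAt 𝓘(ℝ, E) x₀).target := by
  rw [contDiffOn_clm_apply]
  intro v
  let e := trivializationAt E (TangentSpace 𝓘(ℝ, E) (M := G)) x₀
  have hX : IsSmoothField (fieldOf (fun _ : G => v)) :=
    (isSmoothField_fieldOf_iff _).2 contMDiff_const
  have h1 := (e.contMDiffOn_section_baseSet_iff (IB := 𝓘(ℝ, E)) (n := ∞)
    (s := fieldOf (fun _ : G => v))).1 hX.contMDiffOn
  have h2 : ContMDiffOn 𝓘(ℝ, E) 𝓘(ℝ, E) ∞ (fun g : G =>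
      (mfderiv 𝓘(ℝ, E) 𝓘(ℝ, E) (extChartAt 𝓘(ℝ, E) x₀) g (fieldOf (fun _ : G => v) g) : E))
      (extChartAt 𝓘(ℝ, E) x₀).source := by
    have hb : e.baseSet = (extChartAt 𝓘(ℝ, E) x₀).source := by
      rw [extChartAt_source]
      exact TangentBundle.trivializationAt_baseSet x₀
    rw [hb] at h1
    refine h1.congr fun g hg => ?_
    have hg' : g ∈ (chartAt E x₀).source := by rwa [extChartAt_source] at hg
    rw [← TangentBundle.continuousLinearMapAt_trivializationAt hg']
    exact Bundle.Trivialization.continuousLinearMapAt_apply_of_mem ℝ e (hb ▸ hg) _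
  have h3 := h2.comp (contMDiffOn_extChartAt_symm x₀)
    (fun x hx => (extChartAt 𝓘(ℝ, E) x₀).map_target hx)
  exact h3.contDiffOn

theorem chartFrame_apply (x₀ : G) {g : G} (hg : g ∈ (extChartAt 𝓘(ℝ, E) x₀).source) (v : E) :
    chartFrame (E := E) x₀ (extChartAt 𝓘(ℝ, E) x₀ g) v =
      mfderiv 𝓘(ℝ, E) 𝓘(ℝ, E) (extChartAt 𝓘(ℝ, E) x₀) g (transL (E := E) g v) := by
  unfold chartFrame
  rw [(extChartAt 𝓘(ℝ, E) x₀).left_inv hg]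
  rfl

theorem chartFrame_self (x₀ : G) : chartFrame (E := E) x₀ (extChartAt 𝓘(ℝ, E) x₀ x₀) = transL x₀ := by
  ext v
  rw [chartFrame_apply x₀ (mem_extChartAt_source x₀), mfderiv_extChartAt_self]
  rfl

theorem mfderiv_symm_chartFrame (x₀ : G) {x : E} (hx : x ∈ (extChartAt 𝓘(ℝ, E) x₀).target) (v : E) :
    (show E →L[ℝ] E from mfderiv 𝓘(ℝ, E) 𝓘(ℝ, E) (extChartAt 𝓘(ℝ, E) x₀).symm x)
      (chartFrame (E := E) x₀ x v) = transL (E := E) ((extChartAt 𝓘(ℝ, E) x₀).symm x) v := by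
  have h := mfderivWithin_extChartAt_symm_comp_mfderiv_extChartAt (I := 𝓘(ℝ, E)) hx
  rw [modelWithCornersSelf_coe, Set.range_id, mfderivWithin_univ] at h
  exact DFunLike.congr_fun h (transL (E := E) ((extChartAt 𝓘(ℝ, E) x₀).symm x) v)

theorem mfderiv_chart_symm_inverse (x₀ : G) {x : E} (hx : x ∈ (extChartAt 𝓘(ℝ, E) x₀).target) :
    (mfderiv 𝓘(ℝ, E) 𝓘(ℝ, E) (extChartAt 𝓘(ℝ, E) x₀).symm x).inverse =
      mfderiv 𝓘(ℝ, E) 𝓘(ℝ, E) (extChartAt 𝓘(ℝ, E) x₀) ((extChartAt 𝓘(ℝ, E) x₀).symm x) := by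
  have h := mfderivWithin_extChartAt_symm_comp_mfderiv_extChartAt (I := 𝓘(ℝ, E)) hx
  have h' := mfderiv_extChartAt_comp_mfderivWithin_extChartAt_symm (I := 𝓘(ℝ, E)) hx
  rw [modelWithCornersSelf_coe, Set.range_id, mfderivWithin_univ] at h h'
  exact ContinuousLinearMap.inverse_eq h h'

/-- The bracket of left-invariant fields, at the center of a chart. -/
theorem fderiv_chartFrame_bracket (x₀ : G) (u v : E) :
    fderiv ℝ (chartFrame (E := E) x₀) (extChartAt 𝓘(ℝ, E) x₀ x₀) (transL (E := E) x₀ u) v -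
      fderiv ℝ (chartFrame (E := E) x₀) (extChartAt 𝓘(ℝ, E) x₀ x₀) (transL (E := E) x₀ v) u =
      transL (E := E) x₀ (lieBr E G u v) := by
  have ht : (extChartAt 𝓘(ℝ, E) x₀).target ∈ 𝓝 (extChartAt 𝓘(ℝ, E) x₀ x₀) :=
    (isOpen_chart_target x₀).mem_nhds (mem_extChartAt_target x₀)
  have hZ : DifferentiableAt ℝ (chartFrame (E := E) x₀) (extChartAt 𝓘(ℝ, E) x₀ x₀) :=
    ((contDiffOn_chartFrame x₀).contDiffAt ht).differentiableAt (by simp)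
  have hd : ∀ w z : E, fderiv ℝ (fun x => chartFrame (E := E) x₀ x w)
      (extChartAt 𝓘(ℝ, E) x₀ x₀) z =
        fderiv ℝ (chartFrame (E := E) x₀) (extChartAt 𝓘(ℝ, E) x₀ x₀) z w := by
    intro w z
    have := (hZ.hasFDerivAt.clm_apply (hasFDerivAt_const w _)).fderiv
    rw [this]
    simp
  have hp : ∀ w : E, (VectorField.mpullbackWithin 𝓘(ℝ, E) 𝓘(ℝ, E) (extChartAt 𝓘(ℝ, E) x₀).symm
      (fieldOf (fun _ : G => w)) (range 𝓘(ℝ, E)) : E → E) =ᶠ[𝓝 (extChartAt 𝓘(ℝ, E) x₀ x₀)]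
        fun x => chartFrame (E := E) x₀ x w := by
    intro w
    filter_upwards [ht] with x hx
    rw [modelWithCornersSelf_coe, Set.range_id]
    change (mfderivWithin 𝓘(ℝ, E) 𝓘(ℝ, E) (extChartAt 𝓘(ℝ, E) x₀).symm univ x).inverse _ = _
    rw [mfderivWithin_univ, mfderiv_chart_symm_inverse x₀ hx]
    rfl
  -- The manifold bracket is the bracket in `E` of the fields pulled back by the inverse chart. No
  -- correction appears because the derivative of the chart at its own center is the identity.
  have hb : VectorField.mlieBracket 𝓘(ℝ, E) (fieldOf (fun _ : G => u)) (fieldOf (fun _ : G => v)) x₀ =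
      VectorField.lieBracket ℝ (fun x => chartFrame (E := E) x₀ x u)
        (fun x => chartFrame (E := E) x₀ x v) (extChartAt 𝓘(ℝ, E) x₀ x₀) := by
    rw [← VectorField.mlieBracketWithin_univ, VectorField.mlieBracketWithin_apply,
      mfderiv_extChartAt_self]
    have h1 : ((extChartAt 𝓘(ℝ, E) x₀).symm ⁻¹' univ ∩ range 𝓘(ℝ, E) : Set E) = univ := by
      simp
    rw [h1]
    have h2 := (hp u).lieBracket_vectorField_eq (𝕜 := ℝ) (hp v)
    have h3 : ∀ (V W : E → E) (y : E), (ContinuousLinearMap.id ℝ E).inverse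
        (VectorField.lieBracketWithin ℝ V W univ y) = VectorField.lieBracket ℝ V W y := by
      intro V W y
      rw [ContinuousLinearMap.inverse_id, VectorField.lieBracketWithin_univ]
      rfl
    exact (h3 _ _ _).trans h2
  rw [mlieBracket_const_const] at hb
  rw [hb, VectorField.lieBracket_eq]
  simp only [hd]
  rw [chartFrame_self]

end ChartFrame

end SubRiem

namespace SubRiem

/-! ### Hamilton's equations in the left trivialization -/

section HamiltonianCurve

variable {E : Type*} [NormedAddCommGroup E] [NormedSpace ℝ E] [FiniteDimensional ℝ E]
  {G : Type*} [TopologicalSpace G] [ChartedSpace E G] [Group G] [LieGroup 𝓘(ℝ, E) ∞ G]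

/-- The curve `γ` has the velocity `w` at time `t`, in the left trivialization. -/
def HasLeftVelWithinAt (γ : ℝ → G) (w : E) (s : Set ℝ) (t : ℝ) : Prop :=
  HasMFDerivWithinAt 𝓘(ℝ, ℝ) 𝓘(ℝ, E) γ s t
    (show ℝ →L[ℝ] E from ContinuousLinearMap.toSpanSingleton ℝ (transL (E := E) (γ t) w))

theorem hasLeftVelWithinAt_iff {γ : ℝ → G} {w : E} {s : Set ℝ} {t : ℝ} :
    HasLeftVelWithinAt γ w s t ↔ ContinuousWithinAt γ s t ∧
      HasDerivWithinAt (fun τ => extChartAt 𝓘(ℝ, E) (γ t) (γ τ)) (transL (E := E) (γ t) w) s t := by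
  unfold HasLeftVelWithinAt HasMFDerivWithinAt
  refine and_congr Iff.rfl ?_
  rw [hasDerivWithinAt_iff_hasFDerivWithinAt]
  simp only [mfld_simps, inter_univ]
  exact Iff.rfl

theorem HasLeftVelWithinAt.comp {F : Type*} [NormedAddCommGroup F] [NormedSpace ℝ F] {γ : ℝ → G}
    {w : E} {s : Set ℝ} {t : ℝ} (h : HasLeftVelWithinAt γ w s t) {f : G → F}
    (hf : MDifferentiableAt 𝓘(ℝ, E) 𝓘(ℝ, F) f (γ t)) :
    HasDerivWithinAt (fun τ => f (γ τ)) (leftDeriv f (γ t) w) s t := by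
  have h1 : HasFDerivWithinAt (fun τ => f (γ τ))
      ((show E →L[ℝ] F from mfderiv 𝓘(ℝ, E) 𝓘(ℝ, F) f (γ t)).comp
        (ContinuousLinearMap.toSpanSingleton ℝ (transL (E := E) (γ t) w))) s t :=
    (HasMFDerivAt.comp_hasMFDerivWithinAt t hf.hasMFDerivAt h).hasFDerivWithinAt
  have h2 := h1.hasDerivWithinAt
  refine Eq.mp ?_ h2
  congr 1
  have h3 : ((1 : ℝ) • transL (E := E) (γ t) w) = transL (E := E) (γ t) w := one_smul _ _
  exact congrArg (mfderiv 𝓘(ℝ, E) 𝓘(ℝ, F) f (γ t)) h3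

theorem HasLeftVelWithinAt.chart {γ : ℝ → G} {w : E} {s : Set ℝ} {t : ℝ}
    (h : HasLeftVelWithinAt γ w s t) {q : G} (hq : γ t ∈ (extChartAt 𝓘(ℝ, E) q).source) :
    HasDerivWithinAt (fun τ => extChartAt 𝓘(ℝ, E) q (γ τ))
      (chartFrame (E := E) q (extChartAt 𝓘(ℝ, E) q (γ t)) w) s t := by
  rw [chartFrame_apply q hq]
  exact h.comp (mdifferentiableAt_extChartAt (by rwa [extChartAt_source] at hq))

theorem hasLeftVelWithinAt_of_chart {x : ℝ → E} {w : E} {s : Set ℝ} {t : ℝ} {q : G}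
    (hq : x t ∈ (extChartAt 𝓘(ℝ, E) q).target)
    (h : HasDerivWithinAt x (chartFrame (E := E) q (x t) w) s t) :
    HasLeftVelWithinAt (fun τ => (extChartAt 𝓘(ℝ, E) q).symm (x τ)) w s t := by
  have h0 : MDifferentiableAt 𝓘(ℝ, E) 𝓘(ℝ, E) (extChartAt 𝓘(ℝ, E) q).symm (x t) :=
    ((contMDiffOn_extChartAt_symm (n := 1) q).contMDiffAt
      ((isOpen_chart_target q).mem_nhds hq)).mdifferentiableAt (by simp)
  have h1 := HasMFDerivAt.comp_hasMFDerivWithinAt t h0.hasMFDerivAt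
    h.hasFDerivWithinAt.hasMFDerivWithinAt
  unfold HasLeftVelWithinAt
  refine Eq.mp ?_ h1
  congr 1
  ext
  have h2 := mfderiv_symm_chartFrame q hq w
  have h3 : ∀ v : E, ((1 : ℝ) • v) = v := fun v => one_smul _ _
  refine (congrArg (mfderiv 𝓘(ℝ, E) 𝓘(ℝ, E) (extChartAt 𝓘(ℝ, E) q).symm (x t)) (h3 _)).trans ?_
  exact h2.trans (h3 _).symm

/-- The left trivialization of a covector. -/
def leftMom (l : G × Covec E) : Covec E := l.2.comp (transL (E := E) l.1)

/-- The horizontal vector that is dual to a covector of the Lie algebra. -/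
def vel {k : ℕ} (e : Fin k → E) (ξ : Covec E) : E := ∑ a, ξ (e a) • e a

variable (G) in
/-- The Lie–Poisson equation of the Hamiltonian `1/2 ∑ ξ(eₐ)²` is `ξ' = coad ξ`. -/
def coad {k : ℕ} (e : Fin k → E) (ξ : Covec E) : Covec E :=
  ξ.comp (LinearMap.toContinuousLinearMap (lieBr E G (vel e ξ)))

theorem coad_apply {k : ℕ} (e : Fin k → E) (ξ : Covec E) (v : E) :
    coad G e ξ v = ξ (lieBr E G (vel e ξ) v) := rfl

/-- With canonical coordinates `(x, p)` and the frame `Z x = chartFrame x₀ x`, the trivialized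
momentum is `ξ = p ∘ Z x`. This is the change of variables that links the chart to the group. -/
theorem coordsOf_comp_chartFrame (x₀ : G) {l : G × Covec E}
    (hl : l.1 ∈ (extChartAt 𝓘(ℝ, E) x₀).source) :
    (coordsOf x₀ l).2.comp (chartFrame (E := E) x₀ (coordsOf x₀ l).1) = leftMom l := by
  ext v
  have h := mfderiv_symm_chartFrame x₀ ((extChartAt 𝓘(ℝ, E) x₀).map_source hl) v
  rw [(extChartAt 𝓘(ℝ, E) x₀).left_inv hl] at h
  exact congrArg l.2 h

section Frame

variable {C : CarnotStructure E G} {k : ℕ} {e : Fin k → E} (he : C.IsFrame e)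
include he

theorem CarnotStructure.IsFrame.inChart_hamiltonian_eq (x₀ : G) (z : E × Covec E) :
    inChart C.horizontal.hamiltonian x₀ z =
      1 / 2 * ∑ a, (z.2 (chartFrame (E := E) x₀ z.1 (e a))) ^ 2 :=
  he.hamiltonian_eq _ _

theorem CarnotStructure.IsFrame.hasFDerivAt_inChart (x₀ : G) (p : Covec E) :
    ∃ dH : (E × Covec E) →L[ℝ] ℝ,
      HasFDerivAt (inChart C.horizontal.hamiltonian x₀) dH (extChartAt 𝓘(ℝ, E) x₀ x₀, p) ∧
      ∀ z : E × Covec E, dH z = z.2 (transL (E := E) x₀ (vel e (p.comp (transL (E := E) x₀)))) +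
        p (fderiv ℝ (chartFrame (E := E) x₀) (extChartAt 𝓘(ℝ, E) x₀ x₀) z.1
          (vel e (p.comp (transL (E := E) x₀)))) := by
  have ht : (extChartAt 𝓘(ℝ, E) x₀).target ∈ 𝓝 (extChartAt 𝓘(ℝ, E) x₀ x₀) :=
    (isOpen_chart_target x₀).mem_nhds (mem_extChartAt_target x₀)
  have hZ : DifferentiableAt ℝ (chartFrame (E := E) x₀) (extChartAt 𝓘(ℝ, E) x₀ x₀) :=
    ((contDiffOn_chartFrame x₀).contDiffAt ht).differentiableAt (by simp)
  set c₀ : E := extChartAt 𝓘(ℝ, E) x₀ x₀ with hc₀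
  have hZ1 : HasFDerivAt (fun z : E × Covec E => chartFrame (E := E) x₀ z.1)
      ((fderiv ℝ (chartFrame (E := E) x₀) c₀).comp (ContinuousLinearMap.fst ℝ E (Covec E)))
      (c₀, p) :=
    HasFDerivAt.comp (c₀, p) (f := Prod.fst) hZ.hasFDerivAt hasFDerivAt_fst
  have h1 := fun a => (((hasFDerivAt_snd (𝕜 := ℝ) (E := E) (F := Covec E)
    (p := (c₀, p))).clm_apply (hZ1.clm_apply (hasFDerivAt_const (e a) _))).pow 2)
  have h2 := (HasFDerivAt.fun_sum (u := Finset.univ) fun a _ => h1 a).const_mul (1 / 2)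
  have h3 : inChart C.horizontal.hamiltonian x₀ = fun z : E × Covec E =>
      1 / 2 * ∑ a, (z.2 (chartFrame (E := E) x₀ z.1 (e a))) ^ 2 :=
    funext (he.inChart_hamiltonian_eq x₀)
  rw [h3]
  refine ⟨_, h2, fun z => ?_⟩
  have h4 : chartFrame (E := E) x₀ c₀ = transL x₀ := chartFrame_self x₀
  simp [vel, h4, Finset.mul_sum, ← Finset.sum_add_distrib]
  refine Finset.sum_congr rfl fun a _ => ?_
  ring

/-- With `H = 1/2 ∑ p(Z x e_a) ^ 2` and `u = vel e ξ`, Hamilton's equations read `x' = Z u`, `p' =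
-p(DZ(·) u)`. Differentiating `ξ = p ∘ Z x` gives `ξ' w = p(DZ(Z u) w - DZ(Z w) u)`, which is `ξ [u,
w]` by the bracket formula at the center of the chart. -/
theorem CarnotStructure.IsFrame.hamilton_iff {l : ℝ → G × Covec E} {s : Set ℝ} {t : ℝ}
    (ht : t ∈ s) (hc : ContinuousWithinAt (fun τ => (l τ).1) s t) :
    (∃ (dH : (E × Covec E) →L[ℝ] ℝ) (v : E × Covec E),
      HasFDerivAt (inChart C.horizontal.hamiltonian (l t).1) dH (coordsOf (l t).1 (l t)) ∧
      HasDerivWithinAt (fun τ => coordsOf (l t).1 (l τ)) v s t ∧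
      ∀ z, dH z = symplecticForm z v) ↔
    HasLeftVelWithinAt (fun τ => (l τ).1) (vel e (leftMom (l t))) s t ∧
      HasDerivWithinAt (fun τ => leftMom (l τ)) (coad G e (leftMom (l t))) s t := by
  obtain ⟨x₀, hx₀⟩ : ∃ x₀, x₀ = (l t).1 := ⟨_, rfl⟩
  set c₀ : E := extChartAt 𝓘(ℝ, E) x₀ x₀ with hc₀
  set p : Covec E := (coordsOf x₀ (l t)).2 with hp
  set ξ : Covec E := leftMom (l t) with hξ
  have hcoord : coordsOf x₀ (l t) = (c₀, p) := by
    rw [hc₀, hp]; conv_rhs => rw [hx₀]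
    rw [← hx₀]; rw [hx₀]; rfl
  have hsrc : ∀ᶠ τ in 𝓝[s] t, (l τ).1 ∈ (extChartAt 𝓘(ℝ, E) x₀).source := by
    refine hc.eventually ?_
    rw [hx₀]
    exact (isOpen_extChartAt_source (l t).1).mem_nhds (mem_extChartAt_source (l t).1)
  have hZc : chartFrame (E := E) x₀ c₀ = transL x₀ := chartFrame_self x₀
  have hpξ : p.comp (transL (E := E) x₀) = ξ := by
    have h := coordsOf_comp_chartFrame x₀ (hsrc.self_of_nhdsWithin ht)
    rw [hcoord] at h
    rw [← hZc]
    exact h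
  obtain ⟨dH, hdH, hdHz⟩ := he.hasFDerivAt_inChart x₀ p
  rw [hpξ, ← hc₀] at hdHz
  rw [← hc₀] at hdH
  set u : E := vel e ξ with hu
  set D := fderiv ℝ (chartFrame (E := E) x₀) c₀ with hD
  have hbr : ∀ w : E, p (D (transL (E := E) x₀ u) w) - p (D (transL (E := E) x₀ w) u) =
      ξ (lieBr E G u w) := by
    intro w
    rw [← map_sub, hD, hc₀, fderiv_chartFrame_bracket, ← hpξ]
    rfl
  have hZd : HasFDerivAt (chartFrame (E := E) x₀) D c₀ :=
    (((contDiffOn_chartFrame x₀).contDiffAt ((isOpen_chart_target x₀).mem_nhds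
      (mem_extChartAt_target x₀))).differentiableAt (by simp)).hasFDerivAt
  have hev : (fun τ => leftMom (l τ)) =ᶠ[𝓝[s] t] fun τ => (coordsOf x₀ (l τ)).2.comp
      (chartFrame (E := E) x₀ (coordsOf x₀ (l τ)).1) := by
    filter_upwards [hsrc] with τ hτ
    exact (coordsOf_comp_chartFrame x₀ hτ).symm
  have hZt : (coordsOf x₀ (l t)).1 = c₀ := by rw [hcoord]
  rw [hasLeftVelWithinAt_iff, ← hx₀, hcoord]
  constructor
  · rintro ⟨dH', v, h1, h2, h3⟩
    rw [h1.unique hdH] at h3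
    -- Testing the symplectic identity on `(0, f)` gives the equation for `x`; testing it on `(z,
    -- 0)`, just below, gives the one for `p`.
    have hv1 : v.1 = transL (E := E) x₀ u := by
      refine (SeparatingDual.eq_iff_forall_dual_eq (R := ℝ)).2 fun f => ?_
      have := h3 (0, f)
      rw [hdHz] at this
      simp [symplecticForm] at this
      exact this.symm
    have hv2 : ∀ z, v.2 z = - p (D z u) := by
      intro z
      have := h3 (z, 0)
      rw [hdHz] at this
      simp [symplecticForm] at this
      linarith
    have hx' : HasDerivWithinAt (fun τ => (coordsOf x₀ (l τ)).1) v.1 s t := by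
      have := (ContinuousLinearMap.fst ℝ E (Covec E)).hasFDerivAt.comp_hasDerivWithinAt t h2
      exact this
    have hp' : HasDerivWithinAt (fun τ => (coordsOf x₀ (l τ)).2) v.2 s t := by
      have := (ContinuousLinearMap.snd ℝ E (Covec E)).hasFDerivAt.comp_hasDerivWithinAt t h2
      exact this
    refine ⟨⟨hc, ?_⟩, ?_⟩
    · rw [← hv1]
      exact hx'
    · have hZx : HasDerivWithinAt (fun τ => chartFrame (E := E) x₀ (coordsOf x₀ (l τ)).1)
          (D v.1) s t := by
        rw [← hZt] at hZd
        exact hZd.comp_hasDerivWithinAt t hx'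
      have h4 := hp'.clm_comp hZx
      have h5 := h4.congr_of_eventuallyEq hev (hev.self_of_nhdsWithin ht)
      refine Eq.mp ?_ h5
      congr 1
      ext w
      rw [coad_apply, ← hu, ← hbr w, hv1, hZt, hZc]
      change v.2 (transL (E := E) x₀ w) + p (D (transL (E := E) x₀ u) w) = _
      rw [hv2]
      ring
  · rintro ⟨⟨_, h1⟩, h2⟩
    have hx' : HasDerivWithinAt (fun τ => (coordsOf x₀ (l τ)).1) (transL (E := E) x₀ u) s t := h1
    have hZx : HasDerivWithinAt (fun τ => chartFrame (E := E) x₀ (coordsOf x₀ (l τ)).1)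
        (D (transL (E := E) x₀ u)) s t := by
      rw [← hZt] at hZd
      exact hZd.comp_hasDerivWithinAt t hx'
    -- For the converse, `p = ξ ∘ (Z x)⁻¹`. The frame is invertible near the center, and the
    -- derivative of inversion yields that of `p`.
    let U : (E →L[ℝ] E)ˣ := ContinuousLinearEquiv.toUnit (transLE (E := E) x₀)
    have hU : (U : E →L[ℝ] E) = transL x₀ := rfl
    have hUi : ∀ w : E, (↑U⁻¹ : E →L[ℝ] E) (transL (E := E) x₀ w) = w := fun w =>
      (transLE (E := E) x₀).symm_apply_apply w
    have hinv : HasDerivWithinAt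
        (fun τ => Ring.inverse (chartFrame (E := E) x₀ (coordsOf x₀ (l τ)).1))
        (-((↑U⁻¹ : E →L[ℝ] E) * (D (transL (E := E) x₀ u)) * (↑U⁻¹ : E →L[ℝ] E))) s t := by
      have h3 := hasFDerivAt_ringInverse (𝕜 := ℝ) U
      have h4 : (U : E →L[ℝ] E) = chartFrame (E := E) x₀ (coordsOf x₀ (l t)).1 := by
        rw [hZt, hZc, hU]
      rw [h4] at h3
      exact h3.comp_hasDerivWithinAt t hZx
    have hunit : ∀ᶠ τ in 𝓝[s] t, IsUnit (chartFrame (E := E) x₀ (coordsOf x₀ (l τ)).1) := by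
      refine hZx.continuousWithinAt.eventually ?_
      beta_reduce
      rw [hZt, hZc, ← hU]
      exact Units.nhds U
    have hev2 : (fun τ => (coordsOf x₀ (l τ)).2) =ᶠ[𝓝[s] t] fun τ => (leftMom (l τ)).comp
        (Ring.inverse (chartFrame (E := E) x₀ (coordsOf x₀ (l τ)).1)) := by
      filter_upwards [hev, hunit] with τ h3 h4
      rw [h3, ContinuousLinearMap.comp_assoc]
      have h6 := Ring.mul_inverse_cancel _ h4
      rw [ContinuousLinearMap.mul_def] at h6
      rw [h6]
      exact (ContinuousLinearMap.comp_id _).symm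
    have h7 := (h2.clm_comp hinv).congr_of_eventuallyEq hev2 (hev2.self_of_nhdsWithin ht)
    refine ⟨dH, _, hdH, hx'.prodMk h7, fun z => ?_⟩
    rw [hdHz, symplecticForm]
    have hinvt : Ring.inverse (chartFrame (E := E) x₀ (coordsOf x₀ (l t)).1) = ↑U⁻¹ := by
      rw [hZt, hZc, ← hU, Ring.inverse_unit]
    obtain ⟨w, hw⟩ := (transLE (E := E) x₀).surjective z.1
    rw [transLE_apply] at hw
    rw [hinvt, ← hw]
    have h8 : ((coad G e ξ).comp (↑U⁻¹ : E →L[ℝ] E) + ξ.comp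
        (-((↑U⁻¹ : E →L[ℝ] E) * (D (transL (E := E) x₀ u)) * (↑U⁻¹ : E →L[ℝ] E))))
          (transL (E := E) x₀ w) = ξ (lieBr E G u w) - p (D (transL (E := E) x₀ u) w) := by
      have h9 : ∀ y : E, ξ ((↑U⁻¹ : E →L[ℝ] E) y) = p y := by
        intro y
        obtain ⟨y', rfl⟩ := (transLE (E := E) x₀).surjective y
        rw [transLE_apply, hUi, ← hpξ]
        rfl
      change coad G e ξ ((↑U⁻¹ : E →L[ℝ] E) (transL (E := E) x₀ w)) + ξ (-((↑U⁻¹ : E →L[ℝ] E)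
        (D (transL (E := E) x₀ u) ((↑U⁻¹ : E →L[ℝ] E) (transL (E := E) x₀ w))))) = _
      rw [hUi, map_neg, h9, coad_apply]
      ring
    change _ = z.2 (transL (E := E) x₀ u) - ((coad G e ξ).comp (↑U⁻¹ : E →L[ℝ] E) + ξ.comp
        (-((↑U⁻¹ : E →L[ℝ] E) * (D (transL (E := E) x₀ u)) * (↑U⁻¹ : E →L[ℝ] E))))
          (transL (E := E) x₀ w)
    rw [h8, ← hbr w]
    ring

theorem CarnotStructure.IsFrame.isHamiltonianCurveOn_iff {l : ℝ → G × Covec E} {s : Set ℝ} :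
    IsHamiltonianCurveOn C.horizontal.hamiltonian l s ↔
      ∀ t ∈ s, HasLeftVelWithinAt (fun τ => (l τ).1) (vel e (leftMom (l t))) s t ∧
        HasDerivWithinAt (fun τ => leftMom (l τ)) (coad G e (leftMom (l t))) s t := by
  constructor
  · rintro ⟨h1, h2⟩ t ht
    exact (he.hamilton_iff ht (h1 t ht)).1 (h2 t ht)
  · intro h
    have h1 : ContinuousOn (fun t => (l t).1) s := fun t ht =>
      (hasLeftVelWithinAt_iff.1 (h t ht).1).1
    exact ⟨h1, fun t ht => (he.hamilton_iff ht (h1 t ht)).2 (h t ht)⟩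

end Frame

end HamiltonianCurve

end SubRiem

namespace SubRiem

/-! ### Auxiliary results on differential equations and Taylor expansion -/

section Analysis

open scoped NNReal

theorem exists_lipschitzOnWith_of_contDiffOn {E F : Type*} [NormedAddCommGroup E]
    [NormedSpace ℝ E] [NormedAddCommGroup F] [NormedSpace ℝ F] {f : E → F} {U K : Set E}
    (hU : IsOpen U) (hf : ContDiffOn ℝ 1 f U) (hK : IsCompact K) (hc : Convex ℝ K) (hKU : K ⊆ U) :
    ∃ c : ℝ≥0, LipschitzOnWith c f K := by
  have h1 : ContinuousOn (fun x => ‖fderiv ℝ f x‖₊) K :=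
    ((hf.continuousOn_fderiv_of_isOpen hU le_rfl).mono hKU).nnnorm
  obtain ⟨c, hcK⟩ := (hK.image_of_continuousOn h1).bddAbove
  refine ⟨c, hc.lipschitzOnWith_of_nnnorm_fderiv_le (𝕜 := ℝ) (fun x hx => ?_) fun x hx => ?_⟩
  · exact (hf.contDiffAt (hU.mem_nhds (hKU hx))).differentiableAt (by simp)
  · exact hcK (mem_image_of_mem _ hx)

/-- The Picard–Lindelöf theorem, forward in time, with the information that the solution does not
leave the ball. -/
theorem exists_solution_mem_closedBall {E : Type*} [NormedAddCommGroup E] [NormedSpace ℝ E]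
    [CompleteSpace E] {v : ℝ → E → E} {T : ℝ} (hT : 0 ≤ T) {x₀ : E} {a L : ℝ} (ha : 0 ≤ a)
    (hL : 0 ≤ L) {K : ℝ≥0} (hlip : ∀ t ∈ Icc 0 T, LipschitzOnWith K (v t) (Metric.closedBall x₀ a))
    (hcont : ∀ x ∈ Metric.closedBall x₀ a, ContinuousOn (fun t => v t x) (Icc 0 T))
    (hbd : ∀ t ∈ Icc 0 T, ∀ x ∈ Metric.closedBall x₀ a, ‖v t x‖ ≤ L) (hLT : L * T ≤ a) :
    ∃ y : ℝ → E, y 0 = x₀ ∧ ∀ t ∈ Icc 0 T, HasDerivWithinAt y (v t (y t)) (Icc 0 T) t ∧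
      y t ∈ Metric.closedBall x₀ a := by
  lift a to ℝ≥0 using ha
  lift L to ℝ≥0 using hL
  have hf : IsPicardLindelof v (⟨0, left_mem_Icc.2 hT⟩ : Icc 0 T) x₀ a 0 L K :=
    ⟨hlip, hcont, hbd, by simpa [hT] using hLT⟩
  have hx : x₀ ∈ Metric.closedBall x₀ ((0 : ℝ≥0) : ℝ) := by simp
  obtain ⟨α, hα⟩ := ODE.FunSpace.exists_isFixedPt_next hf hx
  -- The usual statement of the theorem does not keep this bound, so the fixed point of the Picard
  -- operator is used directly.
  have hmem : ∀ t, α.compProj t ∈ Metric.closedBall x₀ (a : ℝ) := fun t =>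
    α.compProj_mem_closedBall hf.mul_max_le
  refine ⟨α.compProj, ?_, fun t ht => ⟨?_, hmem t⟩⟩
  · exact ODE.FunSpace.compProj_val.trans (ODE.FunSpace.apply_of_zero α)
  · have h1 : ∀ t ∈ Icc 0 T, α.compProj t = ODE.picard v 0 x₀ α.compProj t := by
      intro t ht
      nth_rw 1 [← hα]
      rw [ODE.FunSpace.compProj_apply, ODE.FunSpace.next_apply, projIcc_of_mem _ ht]
    exact (ODE.hasDerivWithinAt_picard_Icc (left_mem_Icc.2 hT) hf.continuousOn_uncurry
      α.continuous_compProj.continuousOn (fun t _ => hmem t) x₀ ht).congr_of_mem h1 ht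

/-- The mean value inequality is applied twice. The constant `B` instead of `B / 2` is enough, since
only domination and smallness are needed. -/
theorem abs_sub_sub_le_of_second_deriv {y y' y'' : ℝ → ℝ} {t B : ℝ} (ht : 0 ≤ t)
    (h1 : ∀ s ∈ Icc 0 t, HasDerivWithinAt y (y' s) (Icc 0 t) s)
    (h2 : ∀ s ∈ Icc 0 t, HasDerivWithinAt y' (y'' s) (Icc 0 t) s)
    (hB : ∀ s ∈ Icc 0 t, |y'' s| ≤ B) : |y t - y 0 - t * y' 0| ≤ B * t ^ 2 := by
  have hB0 : 0 ≤ B := (abs_nonneg _).trans (hB 0 (left_mem_Icc.2 ht))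
  have h3 : ∀ s ∈ Icc 0 t, ‖y' s - y' 0‖ ≤ B * (s - 0) :=
    norm_image_sub_le_of_norm_deriv_le_segment' h2 fun s hs => hB s (Ico_subset_Icc_self hs)
  have h4 : ∀ s ∈ Icc 0 t, HasDerivWithinAt (fun s => y s - s * y' 0) (y' s - 1 * y' 0)
      (Icc 0 t) s := fun s hs => (h1 s hs).sub ((hasDerivWithinAt_id s _).mul_const _)
  have h5 := norm_image_sub_le_of_norm_deriv_le_segment' h4 (C := B * t) (fun s hs => by
    rw [one_mul]
    refine (h3 s (Ico_subset_Icc_self hs)).trans ?_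
    rw [sub_zero]
    exact mul_le_mul_of_nonneg_left hs.2.le hB0) t (right_mem_Icc.2 ht)
  rw [Real.norm_eq_abs] at h5
  calc |y t - y 0 - t * y' 0| = |y t - t * y' 0 - (y 0 - 0 * y' 0)| := by ring_nf
    _ ≤ B * t * (t - 0) := h5
    _ = B * t ^ 2 := by ring

theorem tendsto_second_order {y y' y'' : ℝ → ℝ} {T : ℝ} (hT : 0 < T)
    (h1 : ∀ s ∈ Icc 0 T, HasDerivWithinAt y (y' s) (Icc 0 T) s)
    (h2 : ∀ s ∈ Icc 0 T, HasDerivWithinAt y' (y'' s) (Icc 0 T) s)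
    (h3 : ContinuousWithinAt y'' (Icc 0 T) 0) :
    Tendsto (fun t => (y t - y 0 - t * y' 0) / t ^ 2) (𝓝[>] 0) (𝓝 (y'' 0 / 2)) := by
  rw [Metric.tendsto_nhds]
  intro ε hε
  obtain ⟨δ, hδ, hδ'⟩ := Metric.continuousWithinAt_iff.1 h3 (ε / 2) (half_pos hε)
  have h4 : ∀ᶠ t in 𝓝[>] (0 : ℝ), t ∈ Ioo 0 (min δ T) := Ioo_mem_nhdsGT (lt_min hδ hT)
  filter_upwards [h4] with t ht
  have ht0 : 0 < t := ht.1
  have htT : t ≤ T := (ht.2.trans_le (min_le_right _ _)).le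
  have hsub : Icc 0 t ⊆ Icc 0 T := Icc_subset_Icc_right htT
  -- Once the quadratic term is subtracted, the second derivative is `y'' s - y'' 0`, which is small
  -- near 0 by continuity.
  have h5 := abs_sub_sub_le_of_second_deriv (y := fun s => y s - s ^ 2 * (y'' 0 / 2))
    (y' := fun s => y' s - s * y'' 0) (y'' := fun s => y'' s - 1 * y'' 0) (B := ε / 2) ht0.le
    (fun s hs => by
      have := ((h1 s (hsub hs)).mono hsub).sub
        ((((hasDerivWithinAt_id s (Icc 0 t)).pow 2)).mul_const (y'' 0 / 2))
      refine this.congr_deriv ?_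
      simp
      ring)
    (fun s hs => ((h2 s (hsub hs)).mono hsub).sub ((hasDerivWithinAt_id s _).mul_const _))
    (fun s hs => by
      have := hδ' (hsub hs) (by
        rw [Real.dist_eq, sub_zero, abs_of_nonneg hs.1]
        exact hs.2.trans_lt (ht.2.trans_le (min_le_left _ _)))
      rw [Real.dist_eq] at this
      rw [one_mul]
      exact this.le)
  have h6 : (y t - y 0 - t * y' 0) / t ^ 2 - y'' 0 / 2 =
      (y t - t ^ 2 * (y'' 0 / 2) - (y 0 - 0 ^ 2 * (y'' 0 / 2)) - t * (y' 0 - 0 * y'' 0)) / t ^ 2 := by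
    field_simp
    ring
  rw [Real.dist_eq, h6, abs_div, abs_of_pos (pow_pos ht0 2), div_lt_iff₀ (pow_pos ht0 2)]
  refine h5.trans_lt ?_
  exact mul_lt_mul_of_pos_right (by linarith) (pow_pos ht0 2)

end Analysis

/-! ### The Lie–Poisson equation: conservation of energy and uniform existence -/

section Momentum

variable {E : Type*} [NormedAddCommGroup E] [NormedSpace ℝ E] [FiniteDimensional ℝ E]
  {G : Type*} [TopologicalSpace G] [ChartedSpace E G] [Group G] [LieGroup 𝓘(ℝ, E) ∞ G]
  {k : ℕ} (e : Fin k → E)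

/-- Twice the Hamiltonian. -/
def energy (ξ : Covec E) : ℝ := ∑ a, ξ (e a) ^ 2

theorem energy_nonneg (ξ : Covec E) : 0 ≤ energy e ξ := Finset.sum_nonneg fun _ _ => sq_nonneg _

/-- This form, linear in the energy, holds for all covectors and is what the normalization `2 / (1 +
energy)` in `exists_coad_solution` absorbs. -/
theorem two_mul_abs_le_one_add_energy (ξ : Covec E) (a : Fin k) :
    2 * |ξ (e a)| ≤ 1 + energy e ξ := by
  have h : ξ (e a) ^ 2 ≤ energy e ξ :=
    Finset.single_le_sum (f := fun b => ξ (e b) ^ 2) (fun _ _ => sq_nonneg _) (Finset.mem_univ a)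
  nlinarith [sq_nonneg (|ξ (e a)| - 1), sq_abs (ξ (e a))]

theorem abs_le_one_of_energy {ξ : Covec E} (h : energy e ξ = 1) (a : Fin k) : |ξ (e a)| ≤ 1 := by
  have := two_mul_abs_le_one_add_energy e ξ a
  linarith

theorem norm_vel_le (ξ : Covec E) : 2 * ‖vel e ξ‖ ≤ (1 + energy e ξ) * ∑ a, ‖e a‖ := by
  have h : ‖vel e ξ‖ ≤ ∑ a, |ξ (e a)| * ‖e a‖ :=
    (norm_sum_le _ _).trans_eq (Finset.sum_congr rfl fun a _ => by rw [norm_smul, Real.norm_eq_abs])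
  calc 2 * ‖vel e ξ‖ ≤ ∑ a, 2 * |ξ (e a)| * ‖e a‖ := by
        simp only [mul_assoc, ← Finset.mul_sum]
        linarith
    _ ≤ ∑ a, (1 + energy e ξ) * ‖e a‖ := Finset.sum_le_sum fun a _ =>
        mul_le_mul_of_nonneg_right (two_mul_abs_le_one_add_energy e ξ a) (norm_nonneg _)
    _ = _ := (Finset.mul_sum _ _ _).symm

theorem contDiff_energy : ContDiff ℝ ∞ (energy e) := by
  unfold energy
  fun_prop

theorem contDiff_vel : ContDiff ℝ ∞ (vel e) := by
  unfold vel
  fun_prop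

variable (E G) in
/-- The adjoint representation as a continuous linear map. -/
def adL : E →L[ℝ] E →L[ℝ] E :=
  LinearMap.toContinuousLinearMap
    ((LinearMap.toContinuousLinearMap : (E →ₗ[ℝ] E) ≃ₗ[ℝ] (E →L[ℝ] E)).toLinearMap ∘ₗ lieBr E G)

theorem coad_eq (ξ : Covec E) : coad G e ξ = ξ.comp (adL E G (vel e ξ)) := rfl

theorem contDiff_coad : ContDiff ℝ ∞ (coad G e) := by
  have h : coad G e = fun ξ => ξ.comp (adL E G (vel e ξ)) := rfl
  rw [h]
  exact contDiff_id.clm_comp ((adL E G).contDiff.comp (contDiff_vel e))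

variable (G) in
/-- A bound for the norm of the operators `ad u`, for `u` the velocity of a unit covector. -/
def adBound : ℝ := ‖adL E G‖ * ∑ a, ‖e a‖

theorem adBound_nonneg : 0 ≤ adBound G e :=
  mul_nonneg (ContinuousLinearMap.opNorm_nonneg _) (Finset.sum_nonneg fun _ _ => norm_nonneg _)

theorem norm_coad_le (ξ : Covec E) :
    2 * ‖coad G e ξ‖ ≤ (1 + energy e ξ) * (adBound G e * ‖ξ‖) := by
  have h1 : ‖coad G e ξ‖ ≤ ‖ξ‖ * (‖adL E G‖ * ‖vel e ξ‖) := by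
    rw [coad_eq]
    exact (ContinuousLinearMap.opNorm_comp_le _ _).trans
      (mul_le_mul_of_nonneg_left (ContinuousLinearMap.le_opNorm _ _) (norm_nonneg _))
  have h2 := mul_le_mul_of_nonneg_left (norm_vel_le e ξ)
    (mul_nonneg (norm_nonneg ξ) (norm_nonneg (adL E G)))
  unfold adBound
  nlinarith

/-- Conservation of energy in infinitesimal form: the bracket of the velocity with itself vanishes.
-/
theorem coad_vel (ξ : Covec E) : coad G e ξ (vel e ξ) = 0 := by
  rw [coad_apply, lieBr_self, map_zero]

/-- The derivative of the energy along a multiple of the Lie–Poisson field vanishes. -/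
theorem hasDerivWithinAt_energy {ξ : ℝ → Covec E} {c : ℝ} {s : Set ℝ} {t : ℝ}
    (h : HasDerivWithinAt ξ (c • coad G e (ξ t)) s t) :
    HasDerivWithinAt (fun τ => energy e (ξ τ)) 0 s t := by
  have h1 : ∀ a, HasDerivWithinAt (fun τ => ξ τ (e a) ^ 2)
      (2 * ξ t (e a) * (c * coad G e (ξ t) (e a))) s t := by
    intro a
    have h2 : HasDerivWithinAt (fun τ => ξ τ (e a)) (c * coad G e (ξ t) (e a)) s t := by
      refine (h.clm_apply (hasDerivWithinAt_const t s (e a))).congr_deriv ?_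
      simp
    refine (h2.pow 2).congr_deriv ?_
    simp
  have h3 := HasDerivWithinAt.fun_sum (u := Finset.univ) fun a _ => h1 a
  refine h3.congr_deriv ?_
  have h4 : ∑ a, ξ t (e a) * coad G e (ξ t) (e a) = 0 := by
    rw [← coad_vel (G := G) e (ξ t)]
    conv_rhs => rw [show coad G e (ξ t) (vel e (ξ t)) = coad G e (ξ t) (∑ a, ξ t (e a) • e a) from rfl]
    simp
  calc ∑ a, 2 * ξ t (e a) * (c * coad G e (ξ t) (e a))
      = 2 * c * ∑ a, ξ t (e a) * coad G e (ξ t) (e a) := by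
        rw [Finset.mul_sum]; exact Finset.sum_congr rfl fun a _ => by ring
    _ = 0 := by rw [h4, mul_zero]

theorem energy_eq_of_hasDerivWithinAt {ξ : ℝ → Covec E} {c : ℝ → ℝ} {T : ℝ}
    (h : ∀ t ∈ Icc 0 T, HasDerivWithinAt ξ (c t • coad G e (ξ t)) (Icc 0 T) t) :
    ∀ t ∈ Icc 0 T, energy e (ξ t) = energy e (ξ 0) := by
  have h1 := fun t ht => hasDerivWithinAt_energy e (h t ht)
  refine constant_of_has_deriv_right_zero (fun t ht => (h1 t ht).continuousWithinAt) fun t ht => ?_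
  exact (h1 t (Ico_subset_Icc_self ht)).mono_of_mem_nhdsWithin (Icc_mem_nhdsGE_of_mem ht)

variable (G) in
/-- The Lie–Poisson equation has solutions up to a time that is uniform on the unit cylinder. -/
theorem exists_coad_solution {T : ℝ} (hT : 0 ≤ T) (hT' : 2 * adBound G e * T ≤ 1) {ξ₀ : Covec E}
    (hξ₀ : energy e ξ₀ = 1) :
    ∃ ξ : ℝ → Covec E, ξ 0 = ξ₀ ∧ ∀ t ∈ Icc 0 T,
      HasDerivWithinAt ξ (coad G e (ξ t)) (Icc 0 T) t ∧ ‖ξ t‖ ≤ 2 * ‖ξ₀‖ + 1 ∧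
      energy e (ξ t) = 1 := by
  -- The field `coad` is quadratic, and its existence time would shrink as `‖ξ₀‖` grows. The factor
  -- gives `F` linear growth, preserves the energy, and equals 1 on the level `energy = 1`; so the
  -- solutions of `F` that start there solve the original equation.
  let F : Covec E → Covec E := fun ξ => (2 / (1 + energy e ξ)) • coad G e ξ
  have hpos : ∀ ξ, 0 < 1 + energy e ξ := fun ξ => by linarith [energy_nonneg e ξ]
  have hF : ContDiff ℝ ∞ F := by
    refine ContDiff.smul (ContDiff.div contDiff_const (contDiff_const.add (contDiff_energy e))
      fun ξ => (hpos ξ).ne') (contDiff_coad e)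
  have hFb : ∀ ξ, ‖F ξ‖ ≤ adBound G e * ‖ξ‖ := by
    intro ξ
    rw [norm_smul, Real.norm_eq_abs, abs_of_pos (div_pos two_pos (hpos ξ)), div_mul_eq_mul_div,
      div_le_iff₀ (hpos ξ)]
    linarith [norm_coad_le (G := G) e ξ]
  -- On the ball of radius `‖ξ₀‖ + 1` around `ξ₀` the speed is at most `adBound * (2 ‖ξ₀‖ + 1)`;
  -- with `2 * adBound * T ≤ 1`, the distance covered is at most `‖ξ₀‖ + 1 / 2`.
  have ha : 0 ≤ ‖ξ₀‖ + 1 := by positivity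
  have hB := adBound_nonneg (G := G) e
  obtain ⟨K, hK⟩ := exists_lipschitzOnWith_of_contDiffOn isOpen_univ
    (hF.of_le (by simp)).contDiffOn (isCompact_closedBall ξ₀ (‖ξ₀‖ + 1))
    (convex_closedBall ξ₀ (‖ξ₀‖ + 1)) (subset_univ _)
  obtain ⟨ξ, h0, h1⟩ := exists_solution_mem_closedBall (v := fun _ => F) hT ha
    (L := adBound G e * (2 * ‖ξ₀‖ + 1)) (by positivity) (fun t _ => hK)
    (fun _ _ => continuousOn_const) (fun t _ x hx => by
      refine (hFb x).trans (mul_le_mul_of_nonneg_left ?_ hB)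
      have := norm_le_norm_add_norm_sub' x ξ₀
      rw [mem_closedBall_iff_norm] at hx
      linarith) (by nlinarith [norm_nonneg ξ₀])
  have hE := energy_eq_of_hasDerivWithinAt (G := G) e (ξ := ξ)
    (c := fun t => 2 / (1 + energy e (ξ t))) fun t ht => (h1 t ht).1
  rw [h0, hξ₀] at hE
  refine ⟨ξ, h0, fun t ht => ⟨?_, ?_, hE t ht⟩⟩
  · refine (h1 t ht).1.congr_deriv ?_
    change (2 / (1 + energy e (ξ t))) • coad G e (ξ t) = _
    rw [hE t ht]
    norm_num
  · have := norm_le_norm_add_norm_sub' (ξ t) ξ₀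
    have h2 := mem_closedBall_iff_norm.1 (h1 t ht).2
    linarith

end Momentum

end SubRiem

namespace SubRiem

/-! ### Hamiltonian curves on the cylinder: existence, confinement, comparison -/

section Flow

open scoped NNReal

variable {E : Type*} [NormedAddCommGroup E] [NormedSpace ℝ E] [FiniteDimensional ℝ E]
  {G : Type*} [TopologicalSpace G] [ChartedSpace E G] [Group G] [LieGroup 𝓘(ℝ, E) ∞ G]

/-- The points whose coordinates, in the chart at `q`, are at distance at most `R` from those
of `q`. -/
def chartBox (E : Type*) [NormedAddCommGroup E] [NormedSpace ℝ E] {G : Type*} [TopologicalSpace G]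
    [ChartedSpace E G] (q : G) (R : ℝ) : Set G :=
  (extChartAt 𝓘(ℝ, E) q).source ∩
    extChartAt 𝓘(ℝ, E) q ⁻¹' Metric.closedBall (extChartAt 𝓘(ℝ, E) q q) R

theorem symm_mem_chartBox {q : G} {R : ℝ}
    (hR : Metric.closedBall (extChartAt 𝓘(ℝ, E) q q) R ⊆ (extChartAt 𝓘(ℝ, E) q).target) {x : E}
    (hx : x ∈ Metric.closedBall (extChartAt 𝓘(ℝ, E) q q) R) :
    (extChartAt 𝓘(ℝ, E) q).symm x ∈ chartBox E q R := by
  refine ⟨(extChartAt 𝓘(ℝ, E) q).map_target (hR hx), ?_⟩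
  rw [mem_preimage, (extChartAt 𝓘(ℝ, E) q).right_inv (hR hx)]
  exact hx

theorem isCompact_chartBox {q : G} {R : ℝ}
    (hR : Metric.closedBall (extChartAt 𝓘(ℝ, E) q q) R ⊆ (extChartAt 𝓘(ℝ, E) q).target) :
    IsCompact (chartBox E q R) := by
  have h : chartBox E q R = (extChartAt 𝓘(ℝ, E) q).symm ''
      Metric.closedBall (extChartAt 𝓘(ℝ, E) q q) R := by
    ext g
    constructor
    · rintro ⟨h1, h2⟩
      exact ⟨_, h2, (extChartAt 𝓘(ℝ, E) q).left_inv h1⟩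
    · rintro ⟨x, hx, rfl⟩
      exact symm_mem_chartBox hR hx
  rw [h]
  exact (isCompact_closedBall _ _).image_of_continuousOn ((continuousOn_extChartAt_symm _).mono hR)

theorem IsHamiltonianCurveOn.mono {H : G → Covec E → ℝ} {l : ℝ → G × Covec E} {s s' : Set ℝ}
    (h : IsHamiltonianCurveOn H l s) (hs : s' ⊆ s) : IsHamiltonianCurveOn H l s' := by
  refine ⟨h.1.mono hs, fun t ht => ?_⟩
  obtain ⟨dH, v, h1, h2, h3⟩ := h.2 t (hs ht)
  exact ⟨dH, v, h1, h2.mono hs, h3⟩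

/-- The field that drives the Hamiltonian curves, in a chart of the group and in the left
trivialization of the cotangent bundle. -/
def trivField {k : ℕ} (e : Fin k → E) (q : G) (z : E × Covec E) : E × Covec E :=
  (chartFrame (E := E) q z.1 (vel e z.2), coad G e z.2)

theorem contDiffOn_trivField {k : ℕ} (e : Fin k → E) (q : G) :
    ContDiffOn ℝ ∞ (trivField e q) ((extChartAt 𝓘(ℝ, E) q).target ×ˢ univ) := by
  refine ContDiffOn.prodMk ?_ ?_
  · refine ContDiffOn.clm_apply ?_ ((contDiff_vel e).comp contDiff_snd).contDiffOn
    exact (contDiffOn_chartFrame q).comp contDiff_fst.contDiffOn fun z hz => hz.1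
  · exact ((contDiff_coad e).comp contDiff_snd).contDiffOn

variable {C : CarnotStructure E G} {k : ℕ} {e : Fin k → E} (he : C.IsFrame e)
include he

theorem CarnotStructure.IsFrame.mem_cylinder_iff {q : G} {lam : Covec E} :
    lam ∈ C.horizontal.cylinder q ↔ energy e (leftMom (q, lam)) = 1 := by
  have h : C.horizontal.hamiltonian q lam = 1 / 2 * energy e (leftMom (q, lam)) :=
    he.hamiltonian_eq q lam
  change 2 * C.horizontal.hamiltonian q lam = 1 ↔ _
  rw [h, ← mul_assoc]
  norm_num

theorem CarnotStructure.IsFrame.energy_curve {l : ℝ → G × Covec E} {T : ℝ}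
    (hl : IsHamiltonianCurveOn C.horizontal.hamiltonian l (Icc 0 T)) :
    ∀ t ∈ Icc 0 T, energy e (leftMom (l t)) = energy e (leftMom (l 0)) := by
  refine energy_eq_of_hasDerivWithinAt (G := G) e (ξ := fun t => leftMom (l t))
    (c := fun _ => 1) fun t ht => ?_
  rw [one_smul]
  exact (he.isHamiltonianCurveOn_iff.1 hl t ht).2

/-- Existence of the Hamiltonian curves up to a time that is uniform on the cylinder. -/
theorem CarnotStructure.IsFrame.exists_curve {q : G} {R : ℝ} (hR0 : 0 < R)
    (hR : Metric.closedBall (extChartAt 𝓘(ℝ, E) q q) R ⊆ (extChartAt 𝓘(ℝ, E) q).target) :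
    ∃ T > 0, ∀ lam ∈ C.horizontal.cylinder q, ∃ l : ℝ → G × Covec E,
      IsHamiltonianCurveOn C.horizontal.hamiltonian l (Icc 0 T) ∧ l 0 = (q, lam) ∧
      ∀ t ∈ Icc 0 T, (l t).1 ∈ chartBox E q R ∧
        ‖leftMom (l t)‖ ≤ 2 * ‖leftMom (q, lam)‖ + 1 := by
  obtain ⟨Z, hZ⟩ := (isCompact_closedBall (extChartAt 𝓘(ℝ, E) q q) R).exists_bound_of_continuousOn
    ((contDiffOn_chartFrame q).continuousOn.mono hR)
  obtain ⟨c, hc⟩ := exists_lipschitzOnWith_of_contDiffOn (isOpen_chart_target q)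
    ((contDiffOn_chartFrame q).of_le (by simp)) (isCompact_closedBall (extChartAt 𝓘(ℝ, E) q q) R)
    (convex_closedBall _ _) hR
  have hZ0 : 0 ≤ Z := (ContinuousLinearMap.opNorm_nonneg _).trans
    (hZ _ (Metric.mem_closedBall_self hR0.le))
  obtain ⟨M, hM⟩ : ∃ M : ℝ≥0, (M : ℝ) = ∑ a, ‖e a‖ :=
    ⟨⟨∑ a, ‖e a‖, Finset.sum_nonneg fun a _ => norm_nonneg (e a)⟩, rfl⟩
  have hB := adBound_nonneg (G := G) e
  have hd : 0 < 2 * adBound G e + 1 := by positivity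
  have hd' : 0 < Z * M + 1 := by positivity
  -- The first time serves the momentum equation, the second keeps the base point in the ball, where
  -- its speed in the chart is at most `Z * M`. Neither depends on `lam`.
  refine ⟨min (1 / (2 * adBound G e + 1)) (R / (Z * M + 1)), by positivity, fun lam hlam => ?_⟩
  set T := min (1 / (2 * adBound G e + 1)) (R / (Z * M + 1)) with hT
  have hT0 : 0 ≤ T := by positivity
  have hT1 : 2 * adBound G e * T ≤ 1 := by
    have : T * (2 * adBound G e + 1) ≤ 1 := (le_div_iff₀ hd).1 (min_le_left _ _)
    linarith
  have hT2 : Z * M * T ≤ R := by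
    have : T * (Z * M + 1) ≤ R := (le_div_iff₀ hd').1 (min_le_right _ _)
    linarith
  obtain ⟨ξ, h0, hξ⟩ := exists_coad_solution G e hT0 hT1 (he.mem_cylinder_iff.1 hlam)
  have hvel : ∀ t ∈ Icc 0 T, ‖vel e (ξ t)‖ ≤ M := by
    intro t ht
    have := norm_vel_le e (ξ t)
    rw [(hξ t ht).2.2] at this
    rw [hM]
    linarith
  have hξc : ContinuousOn ξ (Icc 0 T) := fun t ht => (hξ t ht).1.continuousWithinAt
  -- The momentum equation does not involve the base point. So `ξ` is solved first, and the base
  -- point then follows a time-dependent field in the chart.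
  obtain ⟨x, hx0, hx⟩ := exists_solution_mem_closedBall
    (v := fun t x => chartFrame (E := E) q x (vel e (ξ t))) hT0 hR0.le (L := Z * M) (by positivity)
    (K := c * M) (fun t ht => LipschitzOnWith.of_dist_le_mul fun x hx y hy => by
      have h1 := hc.dist_le_mul x hx y hy
      rw [dist_eq_norm] at h1 ⊢
      rw [← _root_.sub_apply]
      refine (ContinuousLinearMap.le_opNorm _ _).trans ?_
      calc _ ≤ (c * dist x y) * M :=
            mul_le_mul h1 (hvel t ht) (norm_nonneg _) (by positivity)
        _ = _ := by push_cast; ring)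
    (fun x _ => (chartFrame (E := E) q x).continuous.comp_continuousOn
      ((contDiff_vel e).continuous.comp_continuousOn hξc))
    (fun t ht x hx => (ContinuousLinearMap.le_opNorm _ _).trans
      (mul_le_mul (hZ x hx) (hvel t ht) (norm_nonneg _) hZ0)) hT2
  let g : ℝ → G := fun t => (extChartAt 𝓘(ℝ, E) q).symm (x t)
  let l : ℝ → G × Covec E := fun t => (g t, (ξ t).comp (transLE (E := E) (g t)).symm.toContinuousLinearMap)
  have hl : ∀ t, leftMom (l t) = ξ t := by
    intro t
    ext v
    exact congrArg (ξ t) ((transLE (E := E) (g t)).symm_apply_apply v)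
  have hg0 : g 0 = q := by
    change (extChartAt 𝓘(ℝ, E) q).symm (x 0) = q
    rw [hx0]
    exact extChartAt_to_inv q
  refine ⟨l, he.isHamiltonianCurveOn_iff.2 fun t ht => ⟨?_, ?_⟩, ?_, fun t ht => ⟨?_, ?_⟩⟩
  · rw [hl]
    exact hasLeftVelWithinAt_of_chart (hR (hx t ht).2) (hx t ht).1
  · have h1 : (fun τ => leftMom (l τ)) = ξ := funext hl
    rw [h1, hl]
    exact (hξ t ht).1
  · refine Prod.ext hg0 ?_
    ext v
    change ξ 0 ((transLE (E := E) (g 0)).symm v) = lam v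
    rw [h0, hg0]
    exact congrArg lam ((transLE (E := E) q).apply_symm_apply v)
  · exact symm_mem_chartBox hR (hx t ht).2
  · rw [hl]
    exact (hξ t ht).2.1

/-- The unit Hamiltonian curves that start at `q` remain for a uniform time in a box. -/
theorem CarnotStructure.IsFrame.curve_mem_chartBox [T2Space G] {q : G}
    (f : SmoothBumpFunction 𝓘(ℝ, E) q) :
    ∃ T > 0, ∀ t ≤ T, ∀ l : ℝ → G × Covec E,
      IsHamiltonianCurveOn C.horizontal.hamiltonian l (Icc 0 t) → (l 0).1 = q →
      energy e (leftMom (l 0)) = 1 → ∀ s ∈ Icc 0 t, (l s).1 ∈ chartBox E q f.rOut := by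
  have hf : ContMDiff 𝓘(ℝ, E) 𝓘(ℝ, ℝ) ∞ f := f.contMDiff
  -- The bump function replaces an exit-time argument. Along any unit curve its derivative is at
  -- most `∑ a, D a`, as the momenta `ξ(e_a)` are bounded by 1; since `f` starts at 1, it cannot
  -- reach 0 before the chosen time, and its support lies in the box.
  have hsupp : ∀ v, HasCompactSupport fun g : G => leftDeriv (E := E) f g v := by
    intro v
    refine f.hasCompactSupport.mono' fun g hg => ?_
    by_contra h
    refine hg ?_
    have h1 : (f : G → ℝ) =ᶠ[𝓝 g] fun _ => 0 := notMem_tsupport_iff_eventuallyEq.1 h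
    have h2 : mfderiv 𝓘(ℝ, E) 𝓘(ℝ, ℝ) f g = 0 := h1.mfderiv_eq.trans mfderiv_const
    change (mfderiv 𝓘(ℝ, E) 𝓘(ℝ, ℝ) f g) (transL (E := E) g v) = 0
    rw [h2]
    rfl
  have hbd : ∀ a, ∃ D, ∀ g : G, ‖leftDeriv (E := E) f g (e a)‖ ≤ D := fun a =>
    (contMDiff_leftDeriv hf (e a)).continuous.bounded_above_of_compact_support (hsupp (e a))
  choose D hD using hbd
  have hD0 : 0 ≤ ∑ a, D a := Finset.sum_nonneg fun a _ => (norm_nonneg _).trans (hD a q)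
  refine ⟨1 / (2 * ∑ a, D a + 1), by positivity, fun t ht l hl hq hen s hs => ?_⟩
  have h1 : ∀ r ∈ Icc 0 t, HasDerivWithinAt (fun τ => f (l τ).1)
      (leftDeriv (E := E) f (l r).1 (vel e (leftMom (l r)))) (Icc 0 t) r := fun r hr =>
    (he.isHamiltonianCurveOn_iff.1 hl r hr).1.comp (hf.mdifferentiableAt (by simp))
  have h2 : ∀ r ∈ Ico 0 t, ‖leftDeriv (E := E) f (l r).1 (vel e (leftMom (l r)))‖ ≤ ∑ a, D a := by
    intro r hr
    have h3 := (he.energy_curve hl r (Ico_subset_Icc_self hr)).trans hen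
    unfold vel
    rw [map_sum]
    refine norm_sum_le_of_le _ fun a _ => ?_
    rw [map_smul, norm_smul, Real.norm_eq_abs]
    calc _ ≤ 1 * D a := mul_le_mul (abs_le_one_of_energy e h3 a) (hD a _) (norm_nonneg _) zero_le_one
      _ = _ := one_mul _
  have h4 := norm_image_sub_le_of_norm_deriv_le_segment' h1 h2 s hs
  have h5 : (∑ a, D a) * (s - 0) < 1 := by
    have h6 : s * (2 * ∑ a, D a + 1) ≤ 1 :=
      (le_div_iff₀ (by positivity)).1 (hs.2.trans ht)
    nlinarith [hs.1]
  have h7 : f (l s).1 ≠ 0 := by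
    intro h8
    rw [h8, hq, f.eq_one] at h4
    norm_num at h4
    linarith
  have h9 : (l s).1 ∈ Function.support f := h7
  rw [f.support_eq_inter_preimage] at h9
  refine ⟨?_, Metric.ball_subset_closedBall h9.2⟩
  rw [extChartAt_source]
  exact h9.1

theorem CarnotStructure.IsFrame.hasDerivWithinAt_triv {q : G} {l : ℝ → G × Covec E} {s : Set ℝ}
    (hl : IsHamiltonianCurveOn C.horizontal.hamiltonian l s) {t : ℝ} (ht : t ∈ s)
    (hq : (l t).1 ∈ (extChartAt 𝓘(ℝ, E) q).source) :
    HasDerivWithinAt (fun τ => (extChartAt 𝓘(ℝ, E) q (l τ).1, leftMom (l τ)))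
      (trivField e q (extChartAt 𝓘(ℝ, E) q (l t).1, leftMom (l t))) s t :=
  ((he.isHamiltonianCurveOn_iff.1 hl t ht).1.chart hq).prodMk
    (he.isHamiltonianCurveOn_iff.1 hl t ht).2

theorem CarnotStructure.IsFrame.dist_curve_le {q : G} {R : ℝ}
    (hR : Metric.closedBall (extChartAt 𝓘(ℝ, E) q q) R ⊆ (extChartAt 𝓘(ℝ, E) q).target) (r : ℝ) :
    ∃ K : ℝ≥0, ∀ (t : ℝ) (l l' : ℝ → G × Covec E),
      IsHamiltonianCurveOn C.horizontal.hamiltonian l (Icc 0 t) →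
      IsHamiltonianCurveOn C.horizontal.hamiltonian l' (Icc 0 t) →
      (∀ s ∈ Icc 0 t, (l s).1 ∈ chartBox E q R ∧ ‖leftMom (l s)‖ ≤ r) →
      (∀ s ∈ Icc 0 t, (l' s).1 ∈ chartBox E q R ∧ ‖leftMom (l' s)‖ ≤ r) →
      (l 0).1 = q → (l' 0).1 = q → ∀ s ∈ Icc 0 t,
      dist (extChartAt 𝓘(ℝ, E) q (l s).1) (extChartAt 𝓘(ℝ, E) q (l' s).1) ≤
        dist (leftMom (l 0)) (leftMom (l' 0)) * Real.exp (K * s) := by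
  obtain ⟨K, hK⟩ := exists_lipschitzOnWith_of_contDiffOn
    ((isOpen_chart_target q).prod isOpen_univ) ((contDiffOn_trivField e q).of_le (by simp))
    ((isCompact_closedBall (extChartAt 𝓘(ℝ, E) q q) R).prod (isCompact_closedBall (0 : Covec E) r))
    ((convex_closedBall _ _).prod (convex_closedBall _ _)) (prod_mono hR (subset_univ _))
  refine ⟨K, fun t l l' hl hl' hb hb' h0 h0' s hs => ?_⟩
  have hd : ∀ m : ℝ → G × Covec E, IsHamiltonianCurveOn C.horizontal.hamiltonian m (Icc 0 t) →
      (∀ s ∈ Icc 0 t, (m s).1 ∈ chartBox E q R ∧ ‖leftMom (m s)‖ ≤ r) → ∀ s ∈ Icc 0 t,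
      HasDerivWithinAt (fun τ => (extChartAt 𝓘(ℝ, E) q (m τ).1, leftMom (m τ)))
      (trivField e q (extChartAt 𝓘(ℝ, E) q (m s).1, leftMom (m s))) (Icc 0 t) s :=
    fun m hm hmb s hs => he.hasDerivWithinAt_triv hm hs (hmb s hs).1.1
  have hmem : ∀ m : ℝ → G × Covec E,
      (∀ s ∈ Icc 0 t, (m s).1 ∈ chartBox E q R ∧ ‖leftMom (m s)‖ ≤ r) → ∀ s ∈ Ico 0 t,
      (extChartAt 𝓘(ℝ, E) q (m s).1, leftMom (m s)) ∈
        Metric.closedBall (extChartAt 𝓘(ℝ, E) q q) R ×ˢ Metric.closedBall (0 : Covec E) r := by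
    intro m hmb s hs
    have h := hmb s (Ico_subset_Icc_self hs)
    exact ⟨h.1.2, by simpa using h.2⟩
  -- Grönwall's inequality for the autonomous system in `(x, ξ)`. The field is only locally
  -- Lipschitz, hence the bound `r` on the momenta.
  have key := dist_le_of_trajectories_ODE_of_mem (v := fun _ => trivField e q) (K := K)
    (s := fun _ => Metric.closedBall (extChartAt 𝓘(ℝ, E) q q) R ×ˢ
      Metric.closedBall (0 : Covec E) r) (fun _ _ => hK)
    (f := fun τ => (extChartAt 𝓘(ℝ, E) q (l τ).1, leftMom (l τ)))
    (g := fun τ => (extChartAt 𝓘(ℝ, E) q (l' τ).1, leftMom (l' τ)))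
    (fun s hs => (hd l hl hb s hs).continuousWithinAt)
    (fun s hs => (hd l hl hb s (Ico_subset_Icc_self hs)).mono_of_mem_nhdsWithin
      (Icc_mem_nhdsGE_of_mem hs)) (hmem l hb)
    (fun s hs => (hd l' hl' hb' s hs).continuousWithinAt)
    (fun s hs => (hd l' hl' hb' s (Ico_subset_Icc_self hs)).mono_of_mem_nhdsWithin
      (Icc_mem_nhdsGE_of_mem hs)) (hmem l' hb') (δ := dist (leftMom (l 0)) (leftMom (l' 0)))
    (by simp [Prod.dist_eq, h0, h0']) s hs
  rw [sub_zero] at key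
  exact (le_max_left _ _).trans key

end Flow

end SubRiem

namespace SubRiem

/-! ### Second-order expansion along the exponential map -/

section Expansion

open scoped NNReal

variable {E : Type*} [NormedAddCommGroup E] [NormedSpace ℝ E] [FiniteDimensional ℝ E]
  {G : Type*} [TopologicalSpace G] [ChartedSpace E G] [Group G] [LieGroup 𝓘(ℝ, E) ∞ G]
  {k : ℕ}

/-- The second derivative of `φ` along the Hamiltonian curves. -/
def secondDeriv (e : Fin k → E) (φ : G → ℝ) (g : G) (ξ : Covec E) : ℝ :=
  ∑ a, (coad G e ξ (e a) * leftDeriv (E := E) φ g (e a) + ξ (e a) * ∑ b, ξ (e b) *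
    leftDeriv (E := E) (fun g' => leftDeriv (E := E) φ g' (e a)) g (e b))

theorem continuous_secondDeriv (e : Fin k → E) {φ : G → ℝ}
    (hφ : ContMDiff 𝓘(ℝ, E) 𝓘(ℝ, ℝ) ∞ φ) :
    Continuous fun z : G × Covec E => secondDeriv e φ z.1 z.2 := by
  have h1 : ∀ a, Continuous fun z : G × Covec E => leftDeriv (E := E) φ z.1 (e a) := fun a =>
    (contMDiff_leftDeriv hφ (e a)).continuous.comp continuous_fst
  have h2 : ∀ a b, Continuous fun z : G × Covec E =>
      leftDeriv (E := E) (fun g' => leftDeriv (E := E) φ g' (e a)) z.1 (e b) := fun a b =>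
    (contMDiff_leftDeriv (contMDiff_leftDeriv hφ (e a)) (e b)).continuous.comp continuous_fst
  have h3 : ∀ v : E, Continuous fun z : G × Covec E => z.2 v := fun v =>
    continuous_snd.clm_apply continuous_const
  have h4 : ∀ v : E, Continuous fun z : G × Covec E => coad G e z.2 v := fun v =>
    (((contDiff_coad e).continuous.comp continuous_snd).clm_apply continuous_const)
  unfold secondDeriv
  exact continuous_finsetSum _ fun a _ => ((h4 (e a)).mul (h1 a)).add
    ((h3 (e a)).mul (continuous_finsetSum _ fun b _ => (h3 (e b)).mul (h2 a b)))

/-- On the cylinder the components `ξ(e_a)` are at most 1 in absolute value, so only `coad` sees the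
unbounded vertical part of `ξ`, and linearly. This growth makes the bound integrable. -/
theorem exists_abs_secondDeriv_le (e : Fin k → E) {φ : G → ℝ}
    (hφ : ContMDiff 𝓘(ℝ, E) 𝓘(ℝ, ℝ) ∞ φ) {K : Set G} (hK : IsCompact K) :
    ∃ B, 0 ≤ B ∧ ∀ g ∈ K, ∀ ξ : Covec E, energy e ξ = 1 →
      |secondDeriv e φ g ξ| ≤ B * (1 + ‖ξ‖) := by
  have h1 : ∀ a, ∃ A, ∀ g ∈ K, ‖leftDeriv (E := E) φ g (e a)‖ ≤ A := fun a =>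
    hK.exists_bound_of_continuousOn (contMDiff_leftDeriv hφ (e a)).continuous.continuousOn
  have h2 : ∀ a b, ∃ A, ∀ g ∈ K,
      ‖leftDeriv (E := E) (fun g' => leftDeriv (E := E) φ g' (e a)) g (e b)‖ ≤ A := fun a b =>
    hK.exists_bound_of_continuousOn
      (contMDiff_leftDeriv (contMDiff_leftDeriv hφ (e a)) (e b)).continuous.continuousOn
  choose A hA using h1
  choose A' hA' using h2
  have hB := adBound_nonneg (G := G) e
  refine ⟨∑ a, (adBound G e * ‖e a‖ * |A a| + ∑ b, |A' a b|), Finset.sum_nonneg fun a _ =>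
    by positivity, fun g hg ξ hξ => ?_⟩
  unfold secondDeriv
  rw [Finset.sum_mul]
  refine (Finset.abs_sum_le_sum_abs _ _).trans (Finset.sum_le_sum fun a _ => ?_)
  have h3 : |coad G e ξ (e a)| ≤ adBound G e * ‖ξ‖ * ‖e a‖ := by
    have h4 := norm_coad_le (G := G) e ξ
    rw [hξ] at h4
    refine ((coad G e ξ).le_opNorm (e a)).trans
      (mul_le_mul_of_nonneg_right (by linarith) (norm_nonneg _))
  have h5 : |∑ b, ξ (e b) * leftDeriv (E := E) (fun g' => leftDeriv (E := E) φ g' (e a)) g (e b)| ≤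
      ∑ b, |A' a b| := by
    refine (Finset.abs_sum_le_sum_abs _ _).trans (Finset.sum_le_sum fun b _ => ?_)
    rw [abs_mul]
    calc _ ≤ 1 * |A' a b| := mul_le_mul (abs_le_one_of_energy e hξ b)
          ((hA' a b g hg).trans (le_abs_self _)) (abs_nonneg _) zero_le_one
      _ = _ := one_mul _
  have h6 : 0 ≤ ∑ b, |A' a b| := Finset.sum_nonneg fun b _ => abs_nonneg _
  calc _ ≤ |coad G e ξ (e a)| * |leftDeriv (E := E) φ g (e a)| + |ξ (e a)| * |∑ b, ξ (e b) *
        leftDeriv (E := E) (fun g' => leftDeriv (E := E) φ g' (e a)) g (e b)| := by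
        rw [← abs_mul, ← abs_mul]
        exact abs_add_le _ _
    _ ≤ adBound G e * ‖ξ‖ * ‖e a‖ * |A a| + 1 * ∑ b, |A' a b| := by
        refine add_le_add (mul_le_mul h3 ((hA a g hg).trans (le_abs_self _)) (abs_nonneg _)
          (by positivity)) (mul_le_mul (abs_le_one_of_energy e hξ a) h5 (abs_nonneg _) zero_le_one)
    _ ≤ _ := by
        have : 0 ≤ adBound G e * ‖e a‖ * |A a| := by positivity
        nlinarith [norm_nonneg ξ, mul_nonneg h6 (norm_nonneg ξ)]

variable {C : CarnotStructure E G} {e : Fin k → E} (he : C.IsFrame e)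
include he

/-- The Hamiltonian curves that start on the cylinder at `q`. -/
theorem CarnotStructure.IsFrame.exists_flow [T2Space G] (q : G) :
    ∃ T > 0, ∃ K : Set G, IsCompact K ∧
      (∀ lam ∈ C.horizontal.cylinder q, ∃ l : ℝ → G × Covec E,
        IsHamiltonianCurveOn C.horizontal.hamiltonian l (Icc 0 T) ∧ l 0 = (q, lam) ∧
        ∀ t ∈ Icc 0 T, (l t).1 ∈ K ∧ ‖leftMom (l t)‖ ≤ 2 * ‖leftMom (q, lam)‖ + 1 ∧
          InExpDomain C.horizontal.hamiltonian q t lam ∧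
          normalExp C.horizontal.hamiltonian q t lam = (l t).1) ∧
      ∀ t ∈ Icc 0 T, ContinuousOn (fun lam => normalExp C.horizontal.hamiltonian q t lam)
        (C.horizontal.cylinder q) := by
  let f : SmoothBumpFunction 𝓘(ℝ, E) q := Classical.arbitrary _
  have hR : Metric.closedBall (extChartAt 𝓘(ℝ, E) q q) f.rOut ⊆ (extChartAt 𝓘(ℝ, E) q).target := by
    simpa using f.closedBall_subset
  obtain ⟨T₁, hT₁, h1⟩ := he.exists_curve f.rOut_pos hR
  obtain ⟨T₂, hT₂, h2⟩ := he.curve_mem_chartBox f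
  choose! l hl h0 hb using h1
  have hsub : ∀ {t}, t ∈ Icc 0 (min T₁ T₂) → Icc 0 t ⊆ Icc 0 T₁ := fun ht =>
    Icc_subset_Icc_right (ht.2.trans (min_le_left _ _))
  have hdom : ∀ t ∈ Icc 0 (min T₁ T₂), ∀ lam ∈ C.horizontal.cylinder q,
      InExpDomain C.horizontal.hamiltonian q t lam := fun t ht lam hlam =>
    ⟨l lam, (hl lam hlam).mono (hsub ht), h0 lam hlam⟩
  -- The exponential map is defined through an arbitrarily chosen curve. This curve is confined to
  -- the box for times up to `T₂`, its momentum is bounded by compactness, and the comparison with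
  -- `l lam` at distance zero gives equality.
  have huniq : ∀ t ∈ Icc 0 (min T₁ T₂), ∀ lam ∈ C.horizontal.cylinder q,
      normalExp C.horizontal.hamiltonian q t lam = (l lam t).1 := by
    intro t ht lam hlam
    have hd := hdom t ht lam hlam
    unfold normalExp
    rw [dif_pos hd]
    obtain ⟨hm1, hm2⟩ := hd.choose_spec
    set m := hd.choose
    have hmb := h2 t (ht.2.trans (min_le_right _ _)) m hm1 (by rw [hm2])
      (by rw [hm2]; exact he.mem_cylinder_iff.1 hlam)
    obtain ⟨r, hr⟩ := (isCompact_Icc (a := (0 : ℝ)) (b := t)).exists_bound_of_continuousOn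
      (f := fun s => leftMom (m s))
      fun s hs => (he.isHamiltonianCurveOn_iff.1 hm1 s hs).2.continuousWithinAt
    obtain ⟨K, hK⟩ := he.dist_curve_le hR (max r (2 * ‖leftMom (q, lam)‖ + 1))
    have hlb := fun s hs => hb lam hlam s (hsub ht hs)
    have h3 := hK t m (l lam) hm1 ((hl lam hlam).mono (hsub ht))
      (fun s hs => ⟨hmb s hs, (hr s hs).trans (le_max_left _ _)⟩)
      (fun s hs => ⟨(hlb s hs).1, (hlb s hs).2.trans (le_max_right _ _)⟩) (by rw [hm2])
      (by rw [h0 lam hlam]) t (right_mem_Icc.2 ht.1)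
    rw [hm2, h0 lam hlam, dist_self, zero_mul] at h3
    exact (extChartAt 𝓘(ℝ, E) q).injOn (hmb t (right_mem_Icc.2 ht.1)).1
      (hlb t (right_mem_Icc.2 ht.1)).1.1 (dist_le_zero.1 h3)
  refine ⟨min T₁ T₂, lt_min hT₁ hT₂, chartBox E q f.rOut, isCompact_chartBox hR,
    fun lam hlam => ⟨l lam, (hl lam hlam).mono (Icc_subset_Icc_right (min_le_left _ _)),
      h0 lam hlam, fun t ht => ?_⟩, fun t ht => ?_⟩
  · have h3 := hb lam hlam t (hsub ht (right_mem_Icc.2 ht.1))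
    exact ⟨h3.1, h3.2, hdom t ht lam hlam, huniq t ht lam hlam⟩
  · refine ContinuousOn.congr (f := fun lam => (l lam t).1) ?_ fun lam hlam => huniq t ht lam hlam
    intro lam₀ hlam₀
    have hmem : ∀ lam ∈ C.horizontal.cylinder q, (l lam t).1 ∈ chartBox E q f.rOut := fun lam h =>
      (hb lam h t (hsub ht (right_mem_Icc.2 ht.1))).1
    have hcont : Continuous fun lam : Covec E => leftMom (q, lam) :=
      
      continuous_id.clm_comp (continuous_const (y := transL (E := E) q))
    suffices h : ContinuousWithinAt (fun lam => extChartAt 𝓘(ℝ, E) q (l lam t).1)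
        (C.horizontal.cylinder q) lam₀ by
      have h4 : ContinuousAt (extChartAt 𝓘(ℝ, E) q).symm (extChartAt 𝓘(ℝ, E) q (l lam₀ t).1) :=
        (continuousOn_extChartAt_symm q).continuousAt ((isOpen_chart_target q).mem_nhds
          ((extChartAt 𝓘(ℝ, E) q).map_source (hmem lam₀ hlam₀).1))
      have h5 : ContinuousWithinAt
          (fun lam => (extChartAt 𝓘(ℝ, E) q).symm (extChartAt 𝓘(ℝ, E) q (l lam t).1))
          (C.horizontal.cylinder q) lam₀ :=
        Tendsto.comp (f := fun lam => extChartAt 𝓘(ℝ, E) q (l lam t).1) h4 h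
      exact h5.congr
        (fun lam hlam => ((extChartAt 𝓘(ℝ, E) q).left_inv (hmem lam hlam).1).symm)
        ((extChartAt 𝓘(ℝ, E) q).left_inv (hmem lam₀ hlam₀).1).symm
    -- One Lipschitz constant is needed for all covectors near `lam₀`: if their norm is less than
    -- `‖ξ₀‖ + 1`, their momenta stay below `2 (‖ξ₀‖ + 1) + 1`.
    obtain ⟨K, hK⟩ := he.dist_curve_le hR (2 * (‖leftMom (q, lam₀)‖ + 1) + 1)
    have hnear : ∀ᶠ lam in 𝓝[C.horizontal.cylinder q] lam₀,
        ‖leftMom (q, lam)‖ < ‖leftMom (q, lam₀)‖ + 1 :=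
      (hcont.norm.continuousWithinAt).eventually (gt_mem_nhds (lt_add_one _))
    have hbound : ∀ lam ∈ C.horizontal.cylinder q,
        ‖leftMom (q, lam)‖ < ‖leftMom (q, lam₀)‖ + 1 → ∀ s ∈ Icc 0 t,
        (l lam s).1 ∈ chartBox E q f.rOut ∧
          ‖leftMom (l lam s)‖ ≤ 2 * (‖leftMom (q, lam₀)‖ + 1) + 1 := by
      intro lam hlam hn s hs
      have h3 := hb lam hlam s (hsub ht hs)
      exact ⟨h3.1, by linarith [h3.2]⟩
    refine tendsto_iff_dist_tendsto_zero.2 ?_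
    have hlim : Tendsto (fun lam => dist (leftMom (q, lam)) (leftMom (q, lam₀)) *
        Real.exp (K * t)) (𝓝[C.horizontal.cylinder q] lam₀) (𝓝 0) := by
      have h5 : Tendsto (fun lam => dist (leftMom (q, lam)) (leftMom (q, lam₀)) *
          Real.exp (K * t)) (𝓝[C.horizontal.cylinder q] lam₀)
          (𝓝 (dist (leftMom (q, lam₀)) (leftMom (q, lam₀)) * Real.exp (K * t))) :=
        (((hcont.dist continuous_const).mul continuous_const).continuousWithinAt).tendsto
      rwa [dist_self, zero_mul] at h5
    refine squeeze_zero' (Eventually.of_forall fun _ => dist_nonneg) ?_ hlim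
    filter_upwards [hnear, self_mem_nhdsWithin] with lam hn hlam
    have h6 := hK t (l lam) (l lam₀) ((hl lam hlam).mono (hsub ht))
      ((hl lam₀ hlam₀).mono (hsub ht)) (hbound lam hlam hn)
      (hbound lam₀ hlam₀ (lt_add_one _)) (by rw [h0 lam hlam])
      (by rw [h0 lam₀ hlam₀]) t (right_mem_Icc.2 ht.1)
    rwa [h0 lam hlam, h0 lam₀ hlam₀] at h6


theorem CarnotStructure.IsFrame.hasDerivWithinAt_comp {φ : G → ℝ}
    (hφ : ContMDiff 𝓘(ℝ, E) 𝓘(ℝ, ℝ) ∞ φ) {l : ℝ → G × Covec E} {s : Set ℝ}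
    (hl : IsHamiltonianCurveOn C.horizontal.hamiltonian l s) {t : ℝ} (ht : t ∈ s) :
    HasDerivWithinAt (fun τ => φ (l τ).1)
      (∑ a, leftMom (l t) (e a) * leftDeriv (E := E) φ (l t).1 (e a)) s t := by
  refine ((he.isHamiltonianCurveOn_iff.1 hl t ht).1.comp
    (hφ.mdifferentiableAt (by simp))).congr_deriv ?_
  unfold vel
  rw [map_sum]
  exact Finset.sum_congr rfl fun a _ => map_smul _ _ _

theorem CarnotStructure.IsFrame.hasDerivWithinAt_deriv_comp {φ : G → ℝ}
    (hφ : ContMDiff 𝓘(ℝ, E) 𝓘(ℝ, ℝ) ∞ φ) {l : ℝ → G × Covec E} {s : Set ℝ}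
    (hl : IsHamiltonianCurveOn C.horizontal.hamiltonian l s) {t : ℝ} (ht : t ∈ s) :
    HasDerivWithinAt
      (fun τ => ∑ a, leftMom (l τ) (e a) * leftDeriv (E := E) φ (l τ).1 (e a))
      (secondDeriv e φ (l t).1 (leftMom (l t))) s t := by
  refine HasDerivWithinAt.fun_sum fun a _ => ?_
  have h1 : HasDerivWithinAt (fun τ => leftMom (l τ) (e a)) (coad G e (leftMom (l t)) (e a)) s t := by
    refine ((he.isHamiltonianCurveOn_iff.1 hl t ht).2.clm_apply
      (hasDerivWithinAt_const t s (e a))).congr_deriv ?_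
    simp
  exact h1.mul (he.hasDerivWithinAt_comp (contMDiff_leftDeriv hφ (e a)) hl ht)

/-- The expansion of second order of a function along the unit Hamiltonian curves. -/
theorem CarnotStructure.IsFrame.exists_expansion [T2Space G] (q : G) {φ : G → ℝ}
    (hφ : ContMDiff 𝓘(ℝ, E) 𝓘(ℝ, ℝ) ∞ φ) :
    ∃ T > 0, ∃ B, 0 ≤ B ∧
      (∀ lam ∈ C.horizontal.cylinder q,
        (∀ t ∈ Icc 0 T, InExpDomain C.horizontal.hamiltonian q t lam ∧
          |φ (normalExp C.horizontal.hamiltonian q t lam) - φ q -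
            t * ∑ a, leftMom (q, lam) (e a) * leftDeriv (E := E) φ q (e a)| ≤
              B * (1 + ‖leftMom (q, lam)‖) * t ^ 2) ∧
        Tendsto (fun t => (φ (normalExp C.horizontal.hamiltonian q t lam) - φ q -
            t * ∑ a, leftMom (q, lam) (e a) * leftDeriv (E := E) φ q (e a)) / t ^ 2) (𝓝[>] 0)
          (𝓝 (secondDeriv e φ q (leftMom (q, lam)) / 2))) ∧
      ∀ t ∈ Icc 0 T, ContinuousOn (fun lam => φ (normalExp C.horizontal.hamiltonian q t lam))
        (C.horizontal.cylinder q) := by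
  obtain ⟨T, hT, K, hK, hflow, hcont⟩ := he.exists_flow q
  obtain ⟨B, hB, hbd⟩ := exists_abs_secondDeriv_le e hφ hK
  -- The factor 2 comes from the growth of the momentum: `1 + (2 ‖ξ₀‖ + 1) = 2 (1 + ‖ξ₀‖)`.
  refine ⟨T, hT, 2 * B, by positivity, fun lam hlam => ?_, fun t ht =>
    hφ.continuous.comp_continuousOn (hcont t ht)⟩
  obtain ⟨l, hl, h0, hb⟩ := hflow lam hlam
  have hen : ∀ t ∈ Icc 0 T, energy e (leftMom (l t)) = 1 := fun t ht => by
    rw [he.energy_curve hl t ht, h0]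
    exact he.mem_cylinder_iff.1 hlam
  have hd1 := fun t ht => he.hasDerivWithinAt_comp hφ hl (t := t) ht
  have hd2 := fun t ht => he.hasDerivWithinAt_deriv_comp hφ hl (t := t) ht
  refine ⟨fun t ht => ⟨(hb t ht).2.2.1, ?_⟩, ?_⟩
  · have hsub : Icc 0 t ⊆ Icc 0 T := Icc_subset_Icc_right ht.2
    have h1 := abs_sub_sub_le_of_second_deriv ht.1 (fun s hs => (hd1 s (hsub hs)).mono hsub)
      (fun s hs => (hd2 s (hsub hs)).mono hsub)
      (B := 2 * B * (1 + ‖leftMom (q, lam)‖)) fun s hs => by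
        have h2 := hb s (hsub hs)
        refine (hbd _ h2.1 _ (hen s (hsub hs))).trans ?_
        calc B * (1 + ‖leftMom (l s)‖) ≤ B * (1 + (2 * ‖leftMom (q, lam)‖ + 1)) := by
              have := h2.2.1
              gcongr
          _ = _ := by ring
    rw [h0] at h1
    rw [(hb t ht).2.2.2]
    exact h1
  · have hc : ContinuousWithinAt (fun t => secondDeriv e φ (l t).1 (leftMom (l t))) (Icc 0 T) 0 := by
      have h2 : ContinuousWithinAt (fun t => ((l t).1, leftMom (l t))) (Icc 0 T) 0 :=
        (hl.1 0 (left_mem_Icc.2 hT.le)).prodMk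
          (he.isHamiltonianCurveOn_iff.1 hl 0 (left_mem_Icc.2 hT.le)).2.continuousWithinAt
      have h4 : Tendsto (fun z : G × Covec E => secondDeriv e φ z.1 z.2)
          (𝓝 ((l 0).1, leftMom (l 0))) (𝓝 (secondDeriv e φ (l 0).1 (leftMom (l 0)))) :=
        (continuous_secondDeriv e hφ).continuousAt
      exact Tendsto.comp (f := fun t => ((l t).1, leftMom (l t))) h4 h2
    have h3 := tendsto_second_order (y := fun t => φ (l t).1)
      (y' := fun t => ∑ a, leftMom (l t) (e a) * leftDeriv (E := E) φ (l t).1 (e a))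
      (y'' := fun t => secondDeriv e φ (l t).1 (leftMom (l t))) hT hd1 hd2 hc
    simp only [h0] at h3
    refine h3.congr' ?_
    filter_upwards [Ioo_mem_nhdsGT hT] with t ht
    rw [(hb t (Ioo_subset_Icc_self ht)).2.2.2]

end Expansion

end SubRiem

namespace SubRiem

/-! ### First and second moments of the uniform measure on the sphere -/

section Sphere

variable {V : Type*} [NormedAddCommGroup V] [NormedSpace ℝ V] [FiniteDimensional ℝ V]
  [MeasurableSpace V] [BorelSpace V] {k : ℕ} (L : V ≃L[ℝ] (Fin k → ℝ))

/-- The square of the Euclidean norm that is given by linear coordinates. -/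
def coordSq (v : V) : ℝ := ∑ a, L v a ^ 2

/-- The uniform probability measure on the unit sphere of the Euclidean norm that is given by linear
coordinates. -/
def uniformSphere : Measure V :=
  (ProbabilityTheory.cond (Measure.addHaar : Measure V) {v | coordSq L v < 1}).map
    fun v => (Real.sqrt (coordSq L v))⁻¹ • v

theorem continuous_coordSq : Continuous (coordSq L) := by
  unfold coordSq
  exact continuous_finsetSum _ fun a _ =>
    ((continuous_apply a).comp L.continuous).pow 2

theorem coordSq_nonneg (v : V) : 0 ≤ coordSq L v := Finset.sum_nonneg fun _ _ => sq_nonneg _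

theorem coordSq_smul (c : ℝ) (v : V) : coordSq L (c • v) = c ^ 2 * coordSq L v := by
  simp [coordSq, mul_pow, Finset.mul_sum]

theorem coordSq_pos {v : V} (hv : v ≠ 0) : 0 < coordSq L v := by
  refine lt_of_le_of_ne (coordSq_nonneg L v) fun h => hv ?_
  have h1 := (Finset.sum_eq_zero_iff_of_nonneg fun a _ => sq_nonneg (L v a)).1 h.symm
  apply L.injective
  ext a
  have h2 := h1 a (Finset.mem_univ a)
  simpa using h2

theorem abs_apply_le_of_coordSq {v : V} (hv : coordSq L v ≤ 1) (a : Fin k) : |L v a| ≤ 1 := by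
  have h : L v a ^ 2 ≤ coordSq L v :=
    Finset.single_le_sum (f := fun b => L v b ^ 2) (fun _ _ => sq_nonneg _) (Finset.mem_univ a)
  exact abs_le_one_iff_mul_self_le_one.2 (by nlinarith)

theorem norm_le_of_coordSq {v : V} (hv : coordSq L v ≤ 1) :
    ‖v‖ ≤ ‖(L.symm : (Fin k → ℝ) →L[ℝ] V)‖ := by
  have h1 : ‖L v‖ ≤ 1 := (pi_norm_le_iff_of_nonneg zero_le_one).2 fun a =>
    abs_apply_le_of_coordSq L hv a
  have h2 := (L.symm : (Fin k → ℝ) →L[ℝ] V).le_opNorm (L v)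
  rw [ContinuousLinearEquiv.coe_coe, L.symm_apply_apply] at h2
  exact h2.trans (mul_le_of_le_one_right (ContinuousLinearMap.opNorm_nonneg _) h1)

theorem isOpen_coordBall : IsOpen {v | coordSq L v < 1} :=
  isOpen_lt (continuous_coordSq L) continuous_const

theorem addHaar_coordBall_ne_zero : (Measure.addHaar : Measure V) {v | coordSq L v < 1} ≠ 0 :=
  ((isOpen_coordBall L).measure_pos _ ⟨0, by simp [coordSq]⟩).ne'

theorem addHaar_coordBall_ne_top : (Measure.addHaar : Measure V) {v | coordSq L v < 1} ≠ ⊤ := by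
  refine ((measure_mono ?_).trans_lt
    (measure_closedBall_lt_top (μ := (Measure.addHaar : Measure V)) (x := (0 : V))
      (r := ‖(L.symm : (Fin k → ℝ) →L[ℝ] V)‖))).ne
  intro v hv
  rw [mem_closedBall_zero_iff]
  exact norm_le_of_coordSq L (le_of_lt hv)

theorem measurable_radial :
    Measurable fun v : V => (Real.sqrt (coordSq L v))⁻¹ • v :=
  ((continuous_coordSq L).sqrt.measurable.inv).smul measurable_id

instance isProbabilityMeasure_uniformSphere : IsProbabilityMeasure (uniformSphere L) := by
  have h := ProbabilityTheory.cond_isProbabilityMeasure_of_finite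
    (addHaar_coordBall_ne_zero L) (addHaar_coordBall_ne_top L)
  exact Measure.isProbabilityMeasure_map (measurable_radial L).aemeasurable

/-- The radial projection lands on the sphere except at the origin, which it fixes; the origin is a
null set because the dimension is positive. -/
theorem ae_coordSq_eq_one (hk : k ≠ 0) : ∀ᵐ v ∂(uniformSphere L), coordSq L v = 1 := by
  have : Nontrivial V := by
    have : NeZero k := ⟨hk⟩
    exact L.toEquiv.nontrivial
  have hmeas : MeasurableSet {v | coordSq L v = 1} :=
    (continuous_coordSq L).measurable (measurableSet_singleton 1)
  unfold uniformSphere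
  rw [ae_map_iff (measurable_radial L).aemeasurable hmeas]
  refine (ProbabilityTheory.cond_absolutelyContinuous).ae_le ?_
  have h0 : ∀ᵐ v ∂(Measure.addHaar : Measure V), v ≠ 0 := by
    rw [ae_iff]
    simp
  filter_upwards [h0] with v hv
  have hp := coordSq_pos L hv
  rw [coordSq_smul, inv_pow, Real.sq_sqrt hp.le, inv_mul_cancel₀ hp.ne']

/-- An isometry maps the unit ball onto itself. Since the ball has positive finite Haar measure, the
determinant has absolute value 1; moreover the isometry commutes with the radial projection. -/
theorem measurePreserving_uniformSphere (A : (Fin k → ℝ) ≃ₗ[ℝ] (Fin k → ℝ))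
    (hA : ∀ x, ∑ a, A x a ^ 2 = ∑ a, x a ^ 2) :
    MeasurePreserving (fun v => L.symm (A (L v))) (uniformSphere L) (uniformSphere L) := by
  let f : V ≃ₗ[ℝ] V := L.toLinearEquiv.trans (A.trans L.symm.toLinearEquiv)
  have hf : ∀ v, f v = L.symm (A (L v)) := fun v => rfl
  have hsq : ∀ v, coordSq L (f v) = coordSq L v := by
    intro v
    rw [hf, coordSq, L.apply_symm_apply]
    exact hA (L v)
  have hcont : Continuous f := LinearMap.continuous_of_finiteDimensional f.toLinearMap
  have hpre : f ⁻¹' {v | coordSq L v < 1} = {v | coordSq L v < 1} := by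
    ext v
    simp [hsq]
  have hmap : MeasurePreserving f (Measure.addHaar : Measure V) Measure.addHaar := by
    refine ⟨hcont.measurable, ?_⟩
    have h1 : Measure.map f (Measure.addHaar : Measure V) =
        ENNReal.ofReal |(LinearMap.det f.toLinearMap)⁻¹| • Measure.addHaar :=
      Measure.map_linearMap_addHaar_eq_smul_addHaar _ (LinearEquiv.isUnit_det' f).ne_zero
    have h2 := congrArg (fun m => m {v | coordSq L v < 1}) h1
    simp only [Measure.smul_apply, smul_eq_mul] at h2
    rw [Measure.map_apply hcont.measurable (isOpen_coordBall L).measurableSet, hpre] at h2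
    have h3 : ENNReal.ofReal |(LinearMap.det f.toLinearMap)⁻¹| = 1 := by
      have h4 := (ENNReal.mul_eq_right (addHaar_coordBall_ne_zero L)
        (addHaar_coordBall_ne_top L)).1 h2.symm
      exact h4
    rw [h1, h3, one_smul]
  have hcond : MeasurePreserving f
      (ProbabilityTheory.cond (Measure.addHaar : Measure V) {v | coordSq L v < 1})
      (ProbabilityTheory.cond (Measure.addHaar : Measure V) {v | coordSq L v < 1}) := by
    have h := hmap.restrict_preimage (isOpen_coordBall L).measurableSet
    rw [hpre] at h
    exact h.smul_measure _
  refine ⟨hcont.measurable, ?_⟩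
  change Measure.map f (uniformSphere L) = _
  unfold uniformSphere
  rw [Measure.map_map hcont.measurable (measurable_radial L)]
  have hcomm : (f ∘ fun v => (Real.sqrt (coordSq L v))⁻¹ • v) =
      (fun v => (Real.sqrt (coordSq L v))⁻¹ • v) ∘ f := by
    ext v
    simp [hsq]
  rw [hcomm, ← Measure.map_map (measurable_radial L) hcont.measurable, hcond.map_eq]

theorem integral_uniformSphere_comp (A : (Fin k → ℝ) ≃ₗ[ℝ] (Fin k → ℝ))
    (hA : ∀ x, ∑ a, A x a ^ 2 = ∑ a, x a ^ 2) {g : (Fin k → ℝ) → ℝ} (hg : Continuous g) :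
    ∫ v, g (A (L v)) ∂(uniformSphere L) = ∫ v, g (L v) ∂(uniformSphere L) := by
  have h := measurePreserving_uniformSphere L A hA
  have h1 : AEStronglyMeasurable (fun v => g (L v)) (Measure.map (fun v => L.symm (A (L v)))
      (uniformSphere L)) := (hg.comp L.continuous).aestronglyMeasurable
  have h2 := integral_map h.measurable.aemeasurable h1
  rw [h.map_eq] at h2
  rw [h2]
  simp

/-- The change of sign of a coordinate. -/
def signFlip (a : Fin k) : (Fin k → ℝ) ≃ₗ[ℝ] (Fin k → ℝ) :=
  LinearEquiv.piCongrRight fun b => if b = a then LinearEquiv.neg ℝ else LinearEquiv.refl ℝ ℝ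

theorem signFlip_apply (a b : Fin k) (x : Fin k → ℝ) :
    signFlip a x b = if b = a then -x b else x b := by
  unfold signFlip
  rw [LinearEquiv.piCongrRight_apply]
  split_ifs <;> rfl

theorem sum_signFlip_sq (a : Fin k) (x : Fin k → ℝ) :
    ∑ b, signFlip a x b ^ 2 = ∑ b, x b ^ 2 := by
  refine Finset.sum_congr rfl fun b _ => ?_
  rw [signFlip_apply]
  split_ifs <;> ring

theorem integral_uniformSphere_coord (a : Fin k) : ∫ v, L v a ∂(uniformSphere L) = 0 := by
  have h := integral_uniformSphere_comp L (signFlip a) (sum_signFlip_sq a)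
    (g := fun x => x a) (continuous_apply a)
  simp only [signFlip_apply, if_true, integral_neg] at h
  linarith

theorem integrable_uniformSphere (hk : k ≠ 0) {F : Type*} [NormedAddCommGroup F] {g : V → F}
    (hg : AEStronglyMeasurable g (uniformSphere L)) {c : ℝ}
    (hb : ∀ v, coordSq L v = 1 → ‖g v‖ ≤ c) : Integrable g (uniformSphere L) :=
  Integrable.of_bound hg c ((ae_coordSq_eq_one L hk).mono hb)

theorem integrable_id_uniformSphere (hk : k ≠ 0) : Integrable (fun v : V => v) (uniformSphere L) :=
  integrable_uniformSphere L hk continuous_id.aestronglyMeasurable fun _ hv =>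
    norm_le_of_coordSq L hv.le

theorem integrable_uniformSphere_coord_mul (hk : k ≠ 0) (a b : Fin k) :
    Integrable (fun v => L v a * L v b) (uniformSphere L) := by
  refine integrable_uniformSphere L hk (((continuous_apply a).comp L.continuous).mul
    ((continuous_apply b).comp L.continuous)).aestronglyMeasurable (c := 1) fun v hv => ?_
  rw [norm_mul]
  exact mul_le_one₀ (abs_apply_le_of_coordSq L hv.le a) (norm_nonneg _)
    (abs_apply_le_of_coordSq L hv.le b)

/-- The mixed moments change sign when one coordinate is reflected. The squares have equal means, as
coordinates can be swapped, and these means add up to 1. -/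
theorem integral_uniformSphere_coord_mul (hk : k ≠ 0) (a b : Fin k) :
    ∫ v, L v a * L v b ∂(uniformSphere L) = if a = b then (k : ℝ)⁻¹ else 0 := by
  split_ifs with hab
  · subst hab
    have h1 : ∀ b, ∫ v, L v b * L v b ∂(uniformSphere L) =
        ∫ v, L v a * L v a ∂(uniformSphere L) := by
      intro b
      have h := integral_uniformSphere_comp L (LinearEquiv.funCongrLeft ℝ ℝ (Equiv.swap a b))
        (fun x => Equiv.sum_comp (Equiv.swap a b) fun c => x c ^ 2)
        (g := fun x => x a * x a) ((continuous_apply a).mul (continuous_apply a))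
      simpa [LinearEquiv.funCongrLeft_apply, LinearMap.funLeft_apply] using h
    have h2 : ∑ b, ∫ v, L v b * L v b ∂(uniformSphere L) = 1 := by
      rw [← integral_finsetSum _ fun b _ => integrable_uniformSphere_coord_mul L hk b b]
      have h3 : (fun v => ∑ b, L v b * L v b) =ᵐ[uniformSphere L] fun _ => 1 := by
        filter_upwards [ae_coordSq_eq_one L hk] with v hv
        simpa [coordSq, sq] using hv
      rw [integral_congr_ae h3]
      simp
    rw [Finset.sum_congr rfl fun b _ => h1 b, Finset.sum_const, Finset.card_univ,
      Fintype.card_fin, nsmul_eq_mul] at h2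
    exact eq_inv_of_mul_eq_one_right h2
  · have h := integral_uniformSphere_comp L (signFlip a) (sum_signFlip_sq a)
      (g := fun x => x a * x b) ((continuous_apply a).mul (continuous_apply b))
    simp only [signFlip_apply, if_true, if_neg (Ne.symm hab), neg_mul, integral_neg] at h
    linarith

end Sphere

end SubRiem

namespace SubRiem

/-! ### The complement and linear coordinates on horizontal covectors -/

section Adapted

variable {E : Type*} [NormedAddCommGroup E] [NormedSpace ℝ E] [FiniteDimensional ℝ E]
  {G : Type*} [TopologicalSpace G] [ChartedSpace E G] [Group G] [LieGroup 𝓘(ℝ, E) ∞ G]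

theorem integrable_id_of_forall_memLp {V : Type*} [NormedAddCommGroup V] [NormedSpace ℝ V]
    [FiniteDimensional ℝ V] [MeasurableSpace V] {ρ : Measure V} [IsFiniteMeasure ρ]
    (h : ∀ f : V →L[ℝ] ℝ, MemLp f 2 ρ) : Integrable (fun v : V => v) ρ := by
  let b := Module.finBasis ℝ V
  have h1 : ∀ i, Integrable (fun v : V => b.coord i v • b i) ρ := fun i =>
    ((h (LinearMap.toContinuousLinearMap (b.coord i))).integrable one_le_two).smul_const (b i)
  refine (integrable_finsetSum Finset.univ fun i _ => h1 i).congr ?_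
  filter_upwards with v
  exact b.sum_repr v

namespace CarnotStructure

variable (C : CarnotStructure E G)

/-- The sum of the layers above the first one. -/
def upper : Submodule ℝ E := ⨆ i ∈ Set.Icc 2 C.step, C.lay i

theorem isCompl_lay_upper : IsCompl (C.lay 1) C.upper := by
  refine ⟨?_, ?_⟩
  · exact C.isInternal_lay.submodule_iSupIndep.disjoint_biSup (y := Set.Icc 2 C.step) (by simp)
  · rw [codisjoint_iff, eq_top_iff, ← C.isInternal_lay.submodule_iSup_eq_top]
    refine iSup_le fun i => ?_
    rcases Nat.lt_or_ge i 2 with hi | hi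
    · interval_cases i
      · exact (le_of_eq (C.layer_zero : C.lay 0 = ⊥)).trans bot_le
      · exact le_sup_left
    · rcases le_or_gt i C.step with h | h
      · exact (le_iSup₂ (f := fun i (_ : i ∈ Set.Icc 2 C.step) => C.lay i) i ⟨hi, h⟩).trans
          le_sup_right
      · exact (le_of_eq (C.layer_eq_bot i h : C.lay i = ⊥)).trans bot_le

/-- Brackets of horizontal vectors lie in the complement, also in step 1, where they vanish. -/
theorem lay_two_le_upper : C.lay 2 ≤ C.upper := by
  rcases le_or_gt 2 C.step with h | h
  · exact le_iSup₂ (f := fun i (_ : i ∈ Set.Icc 2 C.step) => C.lay i) 2 ⟨le_rfl, h⟩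
  · exact (le_of_eq (C.layer_eq_bot 2 h : C.lay 2 = ⊥)).trans bot_le

theorem isCompl_dist_complement (q : G) : IsCompl (C.horizontal.dist q) (C.complement q) :=
  C.isCompl_lay_upper.map (Submodule.orderIsoMapComap (transLE (E := E) q).toLinearEquiv)

end CarnotStructure

section Frame

open HorizontalStructure

variable {C : CarnotStructure E G} {k : ℕ} {e : Fin k → E} (he : C.IsFrame e)

theorem leftMom_eq_zero_of_mem_annihilator_complement {q : G} {lam : Covec E}
    (h : lam ∈ annihilator q (C.complement q)) {x : E} (hx : x ∈ C.upper) :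
    leftMom (q, lam) x = 0 := h _ ⟨x, hx, rfl⟩

theorem leftMom_eq_zero_of_mem_annihilator_dist {q : G} {lam : Covec E}
    (h : lam ∈ annihilator q (C.horizontal.dist q)) {x : E} (hx : x ∈ C.lay 1) :
    leftMom (q, lam) x = 0 := h _ ((C.mem_dist_iff q x).2 hx)

theorem leftMom_injective (q : G) : Function.Injective fun lam : Covec E => leftMom (q, lam) := by
  intro l1 l2 h
  ext v
  obtain ⟨w, rfl⟩ := (transLE (E := E) q).surjective v
  exact DFunLike.congr_fun h w

/-- The trivialization of the covectors at `q`. -/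
def leftMomL (q : G) : Covec E →L[ℝ] Covec E :=
  (ContinuousLinearMap.compL ℝ E E ℝ).flip (transL (E := E) q)

include he

theorem CarnotStructure.IsFrame.k_ne_zero : k ≠ 0 := by
  rintro rfl
  refine C.layer_ne_bot 1 le_rfl C.step_pos ?_
  have h := he.span
  rw [Set.range_eq_empty, Submodule.span_empty] at h
  exact h.symm

theorem CarnotStructure.IsFrame.coord_injective (q : G) :
    Function.Injective fun (lam : annihilator q (C.complement q)) (a : Fin k) =>
      leftMom (q, (lam : Covec E)) (e a) := by
  intro l1 l2 h
  refine Subtype.ext (leftMom_injective q ?_)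
  ext v
  have hv : v ∈ C.lay 1 ⊔ C.upper := by
    rw [C.isCompl_lay_upper.sup_eq_top]
    trivial
  obtain ⟨x, hx, y, hy, rfl⟩ := Submodule.mem_sup.1 hv
  obtain ⟨c, rfl⟩ := he.exists_coeff hx
  rw [map_add, map_add, leftMom_eq_zero_of_mem_annihilator_complement l1.2 hy,
    leftMom_eq_zero_of_mem_annihilator_complement l2.2 hy, map_sum, map_sum]
  congr 1
  refine Finset.sum_congr rfl fun a _ => ?_
  rw [map_smul, map_smul]
  exact congrArg (c a • ·) (congrFun h a)

theorem CarnotStructure.IsFrame.exists_functional (c : Fin k → ℝ) :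
    ∃ f : E →ₗ[ℝ] ℝ, (∀ a, f (e a) = c a) ∧ ∀ x ∈ C.upper, f x = 0 := by
  let b : Module.Basis (Fin k) ℝ (Submodule.span ℝ (Set.range e)) :=
    Module.Basis.span he.linearIndependent
  have hc : IsCompl (Submodule.span ℝ (Set.range e)) C.upper := by
    rw [he.span]
    exact C.isCompl_lay_upper
  refine ⟨LinearMap.ofIsCompl hc (b.constr ℝ c) 0, fun a => ?_, fun x hx => ?_⟩
  · have h1 : (b a : E) = e a := congrArg Subtype.val (Module.Basis.span_apply he.linearIndependent a)
    rw [← h1, LinearMap.ofIsCompl_apply_left, b.constr_basis]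
  · exact LinearMap.ofIsCompl_apply_right hc (⟨x, hx⟩ : C.upper)

theorem CarnotStructure.IsFrame.coord_surjective (q : G) :
    Function.Surjective fun (lam : annihilator q (C.complement q)) (a : Fin k) =>
      leftMom (q, (lam : Covec E)) (e a) := by
  intro c
  obtain ⟨f, hf1, hf2⟩ := he.exists_functional c
  obtain ⟨lam, hlam⟩ : ∃ lam : Covec E, ∀ x, lam (transL (E := E) q x) = f x :=
    ⟨(LinearMap.toContinuousLinearMap f).comp (transLE (E := E) q).symm.toContinuousLinearMap,
      fun x => congrArg f ((transLE (E := E) q).symm_apply_apply x)⟩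
  have hmem : lam ∈ annihilator q (C.complement q) := by
    rintro _ ⟨x, hx, rfl⟩
    exact (hlam x).trans (hf2 x hx)
  exact ⟨⟨lam, hmem⟩, funext fun a => (hlam (e a)).trans (hf1 a)⟩

/-- The linear coordinates of the horizontal covectors at `q` that are given by a frame. -/
def CarnotStructure.IsFrame.coord (q : G) :
    annihilator q (C.complement q) ≃L[ℝ] (Fin k → ℝ) :=
  let f : annihilator q (C.complement q) →ₗ[ℝ] (Fin k → ℝ) :=
    { toFun := fun lam a => leftMom (q, (lam : Covec E)) (e a)
      map_add' := fun _ _ => rfl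
      map_smul' := fun _ _ => rfl }
  let L : annihilator q (C.complement q) ≃ₗ[ℝ] (Fin k → ℝ) :=
    LinearEquiv.ofBijective f ⟨he.coord_injective q, he.coord_surjective q⟩
  { L with
    continuous_toFun := LinearMap.continuous_of_finiteDimensional (𝕜 := ℝ)
      (E := annihilator q (C.complement q)) (F' := Fin k → ℝ) L.toLinearMap
    continuous_invFun := LinearMap.continuous_of_finiteDimensional (𝕜 := ℝ) (E := Fin k → ℝ)
      (F' := annihilator q (C.complement q)) L.symm.toLinearMap }

theorem CarnotStructure.IsFrame.coord_apply (q : G) (lam : annihilator q (C.complement q))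
    (a : Fin k) : he.coord q lam a = leftMom (q, (lam : Covec E)) (e a) := rfl

/-- In the coordinates `ξ(e_a)` twice the Hamiltonian is the Euclidean square, so the moments
computed for `uniformSphere` apply. -/
theorem CarnotStructure.IsFrame.sphereMeasure_eq (q : G) :
    C.horizontal.sphereMeasure q (annihilator q (C.complement q)) =
      uniformSphere (he.coord q) := by
  have h : ∀ lam : annihilator q (C.complement q),
      2 * C.horizontal.hamiltonian q lam = coordSq (he.coord q) lam := by
    intro lam
    rw [he.hamiltonian_eq, ← mul_assoc]
    norm_num
    rfl
  unfold HorizontalStructure.sphereMeasure uniformSphere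
  simp only [h]

end Frame

end Adapted

end SubRiem

namespace SubRiem

/-! ### Moments of adapted measures and the microscopic limit -/

section AdaptedMoments

open HorizontalStructure

variable {E : Type*} [NormedAddCommGroup E] [NormedSpace ℝ E] [FiniteDimensional ℝ E]
  {G : Type*} [TopologicalSpace G] [ChartedSpace E G] [Group G] [LieGroup 𝓘(ℝ, E) ∞ G]
  {C : CarnotStructure E G} {k : ℕ} {e : Fin k → E}

theorem coad_apply_eq_sum (ξ : Covec E) (v : E) :
    coad G e ξ v = ∑ b, ξ (e b) * ξ (lieBr E G (e b) v) := by
  rw [coad_apply, vel, map_sum, LinearMap.sum_apply, map_sum]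
  refine Finset.sum_congr rfl fun b _ => ?_
  rw [map_smul, LinearMap.smul_apply, map_smul, smul_eq_mul]

theorem continuous_leftMom_apply (q : G) (v : E) :
    Continuous fun lam : Covec E => leftMom (q, lam) v :=
  (leftMomL q).continuous.clm_apply continuous_const

theorem measurable_annihilator_add (q : G) : Measurable fun p : annihilator q (C.complement q) ×
    annihilator q (C.horizontal.dist q) => (p.1 : Covec E) + (p.2 : Covec E) :=
  ((continuous_subtype_val.comp continuous_fst).add
    (continuous_subtype_val.comp continuous_snd)).measurable

variable (he : C.IsFrame e)
include he

theorem CarnotStructure.IsFrame.measurableSet_cylinder (q : G) :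
    MeasurableSet (C.horizontal.cylinder q) := by
  have h : C.horizontal.cylinder q = {lam | energy e (leftMomL q lam) = 1} :=
    Set.ext fun lam => he.mem_cylinder_iff
  rw [h]
  exact (isClosed_eq ((contDiff_energy e).continuous.comp (leftMomL q).continuous)
    continuous_const).measurableSet

/-- An adapted measure: the image of a product measure, in linear coordinates. -/
structure CarnotStructure.IsFrame.IsProductAt (q : G) (μ : Measure (Covec E))
    (ρ : Measure (annihilator q (C.horizontal.dist q))) : Prop where
  prob : IsProbabilityMeasure ρ
  memLp : ∀ f : annihilator q (C.horizontal.dist q) →L[ℝ] ℝ, MemLp f 2 ρ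
  eq : μ = ((uniformSphere (he.coord q)).prod ρ).map
    fun p : annihilator q (C.complement q) × annihilator q (C.horizontal.dist q) =>
      (p.1 : Covec E) + (p.2 : Covec E)

namespace CarnotStructure.IsFrame.IsProductAt

variable {he} {q : G} {μ : Measure (Covec E)} {ρ : Measure (annihilator q (C.horizontal.dist q))}
  (h : he.IsProductAt q μ ρ)
include h

omit h in
theorem leftMom_add_frame (p : annihilator q (C.complement q) ×
    annihilator q (C.horizontal.dist q)) (a : Fin k) :
    leftMom (q, (p.1 : Covec E) + (p.2 : Covec E)) (e a) = he.coord q p.1 a := by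
  have h1 := leftMom_eq_zero_of_mem_annihilator_dist p.2.2 (he.mem a)
  have h2 : leftMom (q, (p.1 : Covec E) + (p.2 : Covec E)) (e a) =
      leftMom (q, (p.1 : Covec E)) (e a) + leftMom (q, (p.2 : Covec E)) (e a) := rfl
  rw [h2, h1, add_zero, he.coord_apply]

-- The point where the complement `V₀` matters: horizontal covectors annihilate it, hence also the
-- brackets of frame vectors, and only the vertical part of the covector contributes.
omit h in
theorem leftMom_add_bracket (p : annihilator q (C.complement q) ×
    annihilator q (C.horizontal.dist q)) (a b : Fin k) :
    leftMom (q, (p.1 : Covec E) + (p.2 : Covec E)) (lieBr E G (e a) (e b)) =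
      leftMom (q, (p.2 : Covec E)) (lieBr E G (e a) (e b)) := by
  have h1 := leftMom_eq_zero_of_mem_annihilator_complement p.1.2
    (C.lay_two_le_upper (C.lieBr_mem_lay le_rfl (he.mem a) (he.mem b)))
  have h2 : leftMom (q, (p.1 : Covec E) + (p.2 : Covec E)) (lieBr E G (e a) (e b)) =
      leftMom (q, (p.1 : Covec E)) (lieBr E G (e a) (e b)) +
      leftMom (q, (p.2 : Covec E)) (lieBr E G (e a) (e b)) := rfl
  rw [h2, h1, zero_add]

theorem isProbabilityMeasure : IsProbabilityMeasure μ := by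
  have := h.prob
  rw [h.eq]
  exact Measure.isProbabilityMeasure_map (measurable_annihilator_add q).aemeasurable

theorem ae_mem_cylinder : ∀ᵐ lam ∂μ, lam ∈ C.horizontal.cylinder q := by
  have := h.prob
  rw [h.eq]
  refine (ae_map_iff (measurable_annihilator_add q).aemeasurable (he.measurableSet_cylinder q)).2 ?_
  have h0 := ae_coordSq_eq_one (V := annihilator q (C.complement q)) (he.coord q) he.k_ne_zero
  have h1 := (Measure.quasiMeasurePreserving_fst (ν := ρ)).ae h0
  filter_upwards [h1] with p hp
  refine he.mem_cylinder_iff.2 ?_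
  unfold energy
  simp only [leftMom_add_frame (he := he)]
  exact hp

theorem integrable_id : Integrable (fun lam : Covec E => lam) μ := by
  have := h.prob
  rw [h.eq]
  refine (integrable_map_measure continuous_id.aestronglyMeasurable
    (measurable_annihilator_add q).aemeasurable).2 ?_
  have h1 : Integrable (fun l : annihilator q (C.complement q) => (l : Covec E))
      (uniformSphere (he.coord q)) := by
    have h3 := integrable_id_uniformSphere (V := annihilator q (C.complement q)) (he.coord q)
      he.k_ne_zero
    exact h3.mono continuous_subtype_val.aestronglyMeasurable (Eventually.of_forall fun _ => le_rfl)
  have h2 : Integrable (fun l : annihilator q (C.horizontal.dist q) => (l : Covec E)) ρ := by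
    have h3 := integrable_id_of_forall_memLp (V := annihilator q (C.horizontal.dist q)) h.memLp
    exact h3.mono continuous_subtype_val.aestronglyMeasurable (Eventually.of_forall fun _ => le_rfl)
  exact (h1.comp_fst ρ).add (h2.comp_snd _)

theorem integrable_leftMom : Integrable (fun lam : Covec E => leftMom (q, lam)) μ :=
  (leftMomL q).integrable_comp h.integrable_id

theorem integral_eq {g : Covec E → ℝ} (hg : Continuous g) :
    ∫ lam, g lam ∂μ = ∫ p : annihilator q (C.complement q) ×
      annihilator q (C.horizontal.dist q), g ((p.1 : Covec E) + (p.2 : Covec E))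
      ∂((uniformSphere (he.coord q)).prod ρ) := by
  rw [h.eq, integral_map (measurable_annihilator_add q).aemeasurable hg.aestronglyMeasurable]

theorem integrable_apply (v : E) : Integrable (fun lam : Covec E => leftMom (q, lam) v) μ :=
  (ContinuousLinearMap.apply ℝ ℝ v).integrable_comp h.integrable_leftMom

theorem integral_frame (a : Fin k) : ∫ lam, leftMom (q, lam) (e a) ∂μ = 0 := by
  have := h.prob
  rw [h.integral_eq (continuous_leftMom_apply q _)]
  simp only [leftMom_add_frame (he := he)]
  have h1 := integral_prod_mul (μ := uniformSphere (he.coord q)) (ν := ρ)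
    (fun l => he.coord q l a) fun _ => (1 : ℝ)
  simpa [integral_uniformSphere_coord] using h1

theorem integrable_mul (a : Fin k) (v : E) :
    Integrable (fun lam : Covec E => leftMom (q, lam) (e a) * leftMom (q, lam) v) μ := by
  refine (h.integrable_apply v).bdd_mul (c := 1)
    (continuous_leftMom_apply q (e a)).aestronglyMeasurable ?_
  filter_upwards [h.ae_mem_cylinder] with lam hlam
  exact abs_le_one_of_energy e (he.mem_cylinder_iff.1 hlam) a

theorem integral_frame_mul (a b : Fin k) :
    ∫ lam, leftMom (q, lam) (e a) * leftMom (q, lam) (e b) ∂μ =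
      if a = b then (k : ℝ)⁻¹ else 0 := by
  have := h.prob
  rw [h.integral_eq (g := fun lam => leftMom (q, lam) (e a) * leftMom (q, lam) (e b))
    ((continuous_leftMom_apply q _).mul (continuous_leftMom_apply q _))]
  simp only [leftMom_add_frame (he := he)]
  have h1 := integral_prod_mul (μ := uniformSphere (he.coord q)) (ν := ρ)
    (fun l => he.coord q l a * he.coord q l b) fun _ => (1 : ℝ)
  rw [integral_uniformSphere_coord_mul _ he.k_ne_zero] at h1
  simpa using h1

/-- The first factor depends on the spherical component only and the second on the vertical one, so
the integral is a product in which the spherical mean is zero. -/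
theorem integral_frame_mul_bracket (a b c : Fin k) :
    ∫ lam, leftMom (q, lam) (e a) * leftMom (q, lam) (lieBr E G (e b) (e c)) ∂μ = 0 := by
  have := h.prob
  rw [h.integral_eq
    (g := fun lam => leftMom (q, lam) (e a) * leftMom (q, lam) (lieBr E G (e b) (e c)))
    ((continuous_leftMom_apply q _).mul (continuous_leftMom_apply q _))]
  simp only [leftMom_add_frame (he := he), leftMom_add_bracket (he := he)]
  rw [integral_prod_mul (μ := uniformSphere (he.coord q)) (ν := ρ)
    (fun l => he.coord q l a) fun l => leftMom (q, (l : Covec E)) (lieBr E G (e b) (e c)),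
    integral_uniformSphere_coord, zero_mul]

theorem integral_coad (a : Fin k) : ∫ lam, coad G e (leftMom (q, lam)) (e a) ∂μ = 0 := by
  simp only [coad_apply_eq_sum]
  rw [integral_finsetSum _ fun b _ => h.integrable_mul b _]
  exact Finset.sum_eq_zero fun b _ => h.integral_frame_mul_bracket b b a

theorem integrable_coad (a : Fin k) :
    Integrable (fun lam => coad G e (leftMom (q, lam)) (e a)) μ := by
  simp only [coad_apply_eq_sum]
  exact integrable_finsetSum _ fun b _ => h.integrable_mul b _

theorem integral_secondDeriv (φ : G → ℝ) :
    ∫ lam, secondDeriv e φ q (leftMom (q, lam)) ∂μ =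
      (k : ℝ)⁻¹ * ∑ a, leftDeriv (E := E) (fun g => leftDeriv (E := E) φ g (e a)) q (e a) := by
  unfold secondDeriv
  simp only [Finset.mul_sum, ← mul_assoc]
  have h1 : ∀ a b, Integrable (fun lam => leftMom (q, lam) (e a) * leftMom (q, lam) (e b) *
      leftDeriv (E := E) (fun g' => leftDeriv (E := E) φ g' (e a)) q (e b)) μ := fun a b =>
    (h.integrable_mul a (e b)).mul_const _
  have h2 : ∀ a, Integrable (fun lam => coad G e (leftMom (q, lam)) (e a) *
      leftDeriv (E := E) φ q (e a)) μ := fun a => (h.integrable_coad a).mul_const _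
  have h3 : ∀ a, Integrable (fun lam => coad G e (leftMom (q, lam)) (e a) *
      leftDeriv (E := E) φ q (e a) + ∑ b, leftMom (q, lam) (e a) * leftMom (q, lam) (e b) *
      leftDeriv (E := E) (fun g' => leftDeriv (E := E) φ g' (e a)) q (e b)) μ := fun a =>
    (h2 a).add (integrable_finsetSum _ fun b _ => h1 a b)
  rw [integral_finsetSum _ fun a _ => h3 a]
  refine Finset.sum_congr rfl fun a _ => ?_
  rw [integral_add (h2 a) (integrable_finsetSum _ fun b _ => h1 a b), integral_mul_const,
    h.integral_coad, zero_mul, zero_add, integral_finsetSum _ fun b _ => h1 a b,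
    Finset.sum_eq_single a]
  · rw [integral_mul_const, h.integral_frame_mul, if_pos rfl]
  · intro b _ hb
    rw [integral_mul_const, h.integral_frame_mul, if_neg (Ne.symm hb), zero_mul]
  · simp

end CarnotStructure.IsFrame.IsProductAt

theorem CarnotStructure.IsFrame.exists_isProductAt {q : G} {μ : Measure (Covec E)}
    (hμ : C.horizontal.IsAdaptedAt C.complement q μ) : ∃ ρ, he.IsProductAt q μ ρ := by
  obtain ⟨ρ, h1, h2, h3⟩ := hμ
  rw [he.sphereMeasure_eq] at h3
  exact ⟨ρ, h1, h2, h3⟩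

/-- The limit that defines the microscopic Laplacian is the sum of the squares of the frame. -/
theorem CarnotStructure.IsFrame.hasMicroLimitAt [T2Space G] {q : G} {μ : Measure (Covec E)}
    (hμ : C.horizontal.IsAdaptedAt C.complement q μ) {φ : G → ℝ}
    (hφ : ContMDiff 𝓘(ℝ, E) 𝓘(ℝ, ℝ) ∞ φ) :
    C.horizontal.HasMicroLimitAt μ φ q
      (∑ a, leftDeriv (E := E) (fun g => leftDeriv (E := E) φ g (e a)) q (e a)) := by
  obtain ⟨ρ, h⟩ := he.exists_isProductAt hμ
  have := h.isProbabilityMeasure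
  obtain ⟨T, hT, B, hB, hexp, hcont⟩ := he.exists_expansion q hφ
  set X : Covec E → ℝ := fun lam => ∑ a, leftMom (q, lam) (e a) * leftDeriv (E := E) φ q (e a)
    with hX
  set F : ℝ → Covec E → ℝ := fun t lam =>
    (φ (normalExp C.horizontal.hamiltonian q t lam) - φ q - t * X lam) / t ^ 2 with hF
  have hXi : Integrable X μ := integrable_finsetSum _ fun a _ =>
    (h.integrable_apply (e a)).mul_const _
  have hX0 : ∫ lam, X lam ∂μ = 0 := by
    rw [hX, integral_finsetSum _ fun a _ => (h.integrable_apply (e a)).mul_const _]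
    refine Finset.sum_eq_zero fun a _ => ?_
    rw [integral_mul_const, h.integral_frame, zero_mul]
  have hsmall : ∀ᶠ t in 𝓝[>] (0 : ℝ), t ∈ Ioo 0 T := Ioo_mem_nhdsGT hT
  -- The exponential map is controlled only on the cylinder; since the cylinder is measurable and
  -- carries `μ`, continuity there is enough.
  have hFm : ∀ t ∈ Ioo 0 T, AEStronglyMeasurable (F t) μ := by
    intro t ht
    have h1 := (hcont t (Ioo_subset_Icc_self ht)).aestronglyMeasurable (μ := μ)
      (he.measurableSet_cylinder q)
    rw [Measure.restrict_eq_self_of_ae_mem h.ae_mem_cylinder] at h1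
    simp only [hF, div_eq_mul_inv]
    exact ((h1.sub aestronglyMeasurable_const).sub
      (hXi.aestronglyMeasurable.const_mul t)).mul_const _
  have hbi : Integrable (fun lam => B * (1 + ‖leftMom (q, lam)‖)) μ :=
    ((integrable_const 1).add h.integrable_leftMom.norm).const_mul B
  have hFb : ∀ t ∈ Ioo 0 T, ∀ᵐ lam ∂μ, ‖F t lam‖ ≤ B * (1 + ‖leftMom (q, lam)‖) := by
    intro t ht
    filter_upwards [h.ae_mem_cylinder] with lam hlam
    rw [hF, norm_div, Real.norm_eq_abs, Real.norm_eq_abs, abs_of_pos (pow_pos ht.1 2),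
      div_le_iff₀ (pow_pos ht.1 2)]
    exact (((hexp lam hlam).1 t (Ioo_subset_Icc_self ht)).2)
  have hFi : ∀ t ∈ Ioo 0 T, Integrable (F t) μ := fun t ht =>
    hbi.mono' (hFm t ht) (hFb t ht)
  -- A purely algebraic identity, valid also off the cylinder. The part `t * X`, which would diverge
  -- after division by `t ^ 2`, has mean zero.
  have hsplit : ∀ t ∈ Ioo 0 T, (fun lam => φ (normalExp C.horizontal.hamiltonian q t lam) - φ q) =
      fun lam => t ^ 2 * F t lam + t * X lam := by
    intro t ht
    funext lam
    have := ht.1.ne'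
    rw [hF]
    field_simp
    ring
  have hlim : Tendsto (fun t => ∫ lam, F t lam ∂μ) (𝓝[>] 0)
      (𝓝 (∫ lam, secondDeriv e φ q (leftMom (q, lam)) / 2 ∂μ)) := by
    refine tendsto_integral_filter_of_dominated_convergence _ (hsmall.mono hFm) (hsmall.mono hFb)
      hbi ?_
    filter_upwards [h.ae_mem_cylinder] with lam hlam
    exact (hexp lam hlam).2
  refine ⟨?_, ?_, ?_⟩
  · filter_upwards [hsmall] with t ht lam hlam
    exact ((hexp lam hlam).1 t (Ioo_subset_Icc_self ht)).1
  · filter_upwards [hsmall] with t ht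
    rw [hsplit t ht]
    exact ((hFi t ht).const_mul _).add (hXi.const_mul _)
  · rw [he.rank_eq]
    have hk : (k : ℝ) ≠ 0 := Nat.cast_ne_zero.2 he.k_ne_zero
    -- The factor `2 k` cancels the Taylor coefficient `1 / 2` and the covariance `1 / k`.
    have h1 := hlim.const_mul (2 * (k : ℝ))
    rw [integral_div, h.integral_secondDeriv, mul_comm (2 * (k : ℝ)), ← mul_div_right_comm,
      mul_assoc, mul_comm _ (2 * (k : ℝ)), mul_assoc] at h1
    have h2 : ∀ c : ℝ, (k : ℝ)⁻¹ * (2 * ((k : ℝ) * c)) / 2 = c := fun c => by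
      field_simp
    rw [h2] at h1
    refine h1.congr' ?_
    filter_upwards [hsmall] with t ht
    rw [hsplit t ht, integral_add ((hFi t ht).const_mul _) (hXi.const_mul _), integral_const_mul,
      integral_const_mul, hX0, mul_zero, add_zero, ← mul_assoc, div_mul_cancel₀]
    exact (pow_pos ht.1 2).ne'

end AdaptedMoments

end SubRiem

end

theorem mainTheorem6
    {E : Type*} [NormedAddCommGroup E] [NormedSpace ℝ E] [FiniteDimensional ℝ E]
    {G : Type*} [TopologicalSpace G] [T2Space G] [ChartedSpace E G] [Group G]
    [LieGroup 𝓘(ℝ, E) ∞ G] [SimplyConnectedSpace G]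
    (C : SubRiem.CarnotStructure E G)
    (P : SubRiem.TopForm E G) (hP : C.horizontal.IsPoppVolume P)
    (φ : G → ℝ) (hφ : ContMDiff 𝓘(ℝ, E) 𝓘(ℝ, ℝ) ∞ φ) (q : G) :
    ∃ c : ℝ, C.horizontal.IsMacroLaplacianAt P φ q c ∧
      C.horizontal.IsMicroLaplacianAt C.complement φ q c := by
  obtain ⟨e, he⟩ := C.exists_isFrame
  exact ⟨_, he.isMacroLaplacianAt hP hφ q, C.isCompl_dist_complement,
    fun _ hμ => he.hasMicroLimitAt hμ hφ⟩
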